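/- **Definitions.** For a real power series $\mathcal S(x)=-\frac{x^2}{2a}+V(x)$ with $a>0$ and $V\in x^3\mathbb R[[x]]$ let $$\mathcal F[\mathcal S(x)](\hbar)=\sqrt a\sum_{n\ge 0}(a\hbar)^n(2n-1)!!\,[x^{2n}]\,e^{V(x)/\hbar}\in\mathbb R[[\hbar]].$$ Let $S$ be an entire function that is real on the real line, with $S(x)=-\frac{x^2}{2}+O(x^3)$ at the origin, and let $x(y)\in\mathbb R[[y]]$ be the unique power series with $\frac{y^2}{2}=-S(x(y))$, $x(0)=0$, $x'(0)>0$. A *dominant singularity* of $x(y)$ is a point $\rho\in\mathbb C$ on the boundary of the disc of convergence of $x(y)$ such that $x(y)$ has no analytic continuation from the disc to a neighbourhood of $\rho$. It is *of square-root type*, with coordinates $(\tau,\rho)$, if $x(y)$ tends to a finite limit $\tau\in\mathbb C$ as $y\to\rho$ inside the disc and the curve $\frac{y^2}{2}=-S(x)$ is regular at $(x,y)=(\tau,\rho)$, i.e. the gradient of $\frac{y^2}{2}+S(x)$ does not vanish there. **Statement.** Suppose that all critical points of $S$ in $\mathbb C$ are simple ($S'(z)=0$ implies $S''(z)\ne 0$)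 and lie on the real line. 1. $x(y)$ has at most two dominant singularities of square-root type. Let $(\tau_i,\rho_i)_{i\in I}$ be their coordinates. There is an $A>0$ such that every $\tau_i$ is real, is a local minimum of $S|_{\mathbb R}$, and satisfies $S(\tau_i)=-A$. The quadratic coefficient of the power series $S(\tau_i)-S(x+\tau_i)$ in $x$ is strictly negative. 2. If all dominant singularities of $x(y)$ are of square-root type, then for every integer $R\ge 0$, as $n\to\infty$, $$[\hbar^n]\mathcal F[S(x)](\hbar)=\sum_{k=0}^{R-1}\sum_{i\in I}w_{i,k}\,A^{-(n-k)}\,\Gamma(n-k)+\mathcal O\Big(\sum_{i\in I}A^{-n}\,\Gamma(n-R)\Big),$$ where $$w_{i,k}=\frac{1}{2\pi}[\hbar^k]\,\mathcal F[S(\tau_i)-S(x+\tau_i)](-\hbar).$$ -/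

import Mathlib

open Filter Topology Asymptotics

open scoped Nat

namespace FormalIntegral

noncomputable section

/-! ### The formal integral -/

/-- The parameter `a` of an action `S = -x²/(2a) + V(x)`, read off from its quadratic coefficient. -/
def width (S : PowerSeries ℝ) : ℝ := -1 / (2 * PowerSeries.coeff 2 S)

/-- The potential `V` of an action `S = -x²/(2a) + V(x)`. -/
def potential (S : PowerSeries ℝ) : PowerSeries ℝ :=
  S - PowerSeries.C (PowerSeries.coeff 2 S) * PowerSeries.X ^ 2

/-- The formal integral
`F[S](ħ) = √a * ∑ₙ (a ħ)ⁿ (2n-1)!! [x²ⁿ] exp (V(x) / ħ)` of an action `S = -x²/(2a) + V(x)`,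
with `a > 0` and `V = O(x³)`.
Expanding the exponential, the coefficient of `ħᵐ` collects the terms `Vᵏ / (k! ħᵏ)` with
`n = m + k`. Those with `k > 2m` vanish (see `coeff_potential_pow_eq_zero`). For `m + k = 0` the
truncated subtraction gives `0‼ = 1`, which is the value of `(-1)!!`. -/
def formalIntegral (S : PowerSeries ℝ) : PowerSeries ℝ :=
  PowerSeries.mk fun m =>
    Real.sqrt (width S) * ∑ k ∈ Finset.range (2 * m + 1),
      width S ^ (m + k) * ((2 * (m + k) - 1)‼ : ℝ) *
        (PowerSeries.coeff (2 * (m + k)) (potential S ^ k) / (k ! : ℝ))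

theorem X_pow_three_dvd_potential (S : PowerSeries ℝ) (h0 : PowerSeries.coeff 0 S = 0)
    (h1 : PowerSeries.coeff 1 S = 0) : PowerSeries.X ^ 3 ∣ potential S := by
  rw [PowerSeries.X_pow_dvd_iff]
  intro m hm
  simp only [PowerSeries.coeff_zero_eq_constantCoeff] at h0
  interval_cases m <;> simp [potential, h0, h1, PowerSeries.coeff_X_pow]

/-- The terms left out of the finite sum in `formalIntegral` are zero. -/
theorem coeff_potential_pow_eq_zero (S : PowerSeries ℝ) (h0 : PowerSeries.coeff 0 S = 0)
    (h1 : PowerSeries.coeff 1 S = 0) (m k : ℕ) (hk : 2 * m < k) :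
    PowerSeries.coeff (2 * (m + k)) (potential S ^ k) = 0 := by
  have h := pow_dvd_pow_of_dvd (X_pow_three_dvd_potential S h0 h1) k
  rw [← pow_mul, PowerSeries.X_pow_dvd_iff] at h
  exact h _ (by omega)

/-- Likewise, no negative power of `ħ` occurs: a term with `n < k` is zero. -/
theorem coeff_potential_pow_eq_zero' (S : PowerSeries ℝ) (h0 : PowerSeries.coeff 0 S = 0)
    (h1 : PowerSeries.coeff 1 S = 0) (n k : ℕ) (hk : n < k) :
    PowerSeries.coeff (2 * n) (potential S ^ k) = 0 := by
  have h := pow_dvd_pow_of_dvd (X_pow_three_dvd_potential S h0 h1) k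
  rw [← pow_mul, PowerSeries.X_pow_dvd_iff] at h
  exact h _ (by omega)

/-- The Maclaurin series of an entire function that is real on the real line. -/
def maclaurin (f : ℂ → ℂ) : PowerSeries ℝ :=
  PowerSeries.mk fun n => (iteratedDeriv n f 0).re / (n ! : ℝ)

/-! ### The local solution `x(y)` -/

/-- `x` is a power series solution of `y = √(-2 S(x(y)))` with the positive branch of the root,
i.e. of `S(x(y)) = -y²/2` with `x(0) = 0` and `x'(0) > 0`. -/
def IsLocalSolution (S x : PowerSeries ℝ) : Prop :=
  PowerSeries.constantCoeff x = 0 ∧ 0 < PowerSeries.coeff 1 x ∧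
    PowerSeries.subst x S = -(PowerSeries.C (1 / 2 : ℝ) * PowerSeries.X ^ 2)

/-- Square roots of real power series with constant coefficient one. -/
theorem exists_sq_eq (W : PowerSeries ℝ) (hW : PowerSeries.constantCoeff W = 0) :
    ∃ q : PowerSeries ℝ, PowerSeries.constantCoeff q = 1 ∧ q ^ 2 = 1 + W := by
  have hs : PowerSeries.HasSubst W := PowerSeries.HasSubst.of_constantCoeff_zero' hW
  have hB : PowerSeries.binomialSeries ℝ (1 / 2 : ℝ) ^ 2 = 1 + PowerSeries.X := by
    rw [sq, ← PowerSeries.binomialSeries_add]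
    have := PowerSeries.binomialSeries_nat (R := ℝ) (A := ℝ) 1
    norm_num at this ⊢
    exact this
  have hq : (PowerSeries.subst W (PowerSeries.binomialSeries ℝ (1 / 2 : ℝ))) ^ 2 = 1 + W := by
    rw [← PowerSeries.subst_pow hs, hB, PowerSeries.subst_add hs, PowerSeries.subst_X hs]
    congr 1
    rw [← PowerSeries.coe_substAlgHom hs, map_one]
  have hc := congrArg PowerSeries.constantCoeff hq
  simp only [map_pow, map_add, map_one, hW, add_zero] at hc
  rcases eq_or_eq_neg_of_sq_eq_sq _ (1 : ℝ) (by rw [hc, one_pow]) with h | h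
  · exact ⟨_, h, hq⟩
  · exact ⟨-PowerSeries.subst W (PowerSeries.binomialSeries ℝ (1 / 2 : ℝ)), by rw [map_neg, h, neg_neg], by
      rw [neg_sq, hq]⟩

/-- The local solution `x(y)` exists and is unique. -/
theorem existsUnique_isLocalSolution (S : PowerSeries ℝ) (h0 : PowerSeries.coeff 0 S = 0)
    (h1 : PowerSeries.coeff 1 S = 0) (h2 : PowerSeries.coeff 2 S = -1 / 2) :
    ∃! x : PowerSeries ℝ, IsLocalSolution S x := by
  obtain ⟨q, hq0, hq⟩ := exists_sq_eq
    (PowerSeries.mk fun n => -2 * PowerSeries.coeff (n + 2) S - if n = 0 then 1 else 0)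
    (by rw [← PowerSeries.coeff_zero_eq_constantCoeff_apply, PowerSeries.coeff_mk]; norm_num [h2])
  set P : PowerSeries ℝ := PowerSeries.X * q with hP
  have hP2 : S = PowerSeries.C (-(1 / 2) : ℝ) * P ^ 2 := by
    rw [hP, mul_pow, hq]
    ext n
    rw [PowerSeries.coeff_C_mul, PowerSeries.coeff_X_pow_mul']
    rcases n with _ | _ | n
    · simpa using h0
    · simpa using h1
    · simp only [PowerSeries.coeff_one, map_add, PowerSeries.coeff_mk]
      norm_num
      ring
  have hPc : PowerSeries.constantCoeff P = 0 := by simp [hP]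
  have hP1 : PowerSeries.coeff 1 P = 1 := by
    rw [hP, show (1 : ℕ) = 0 + 1 from rfl, PowerSeries.coeff_succ_X_mul]
    simpa using hq0
  have hu : IsUnit (PowerSeries.coeff 1 P) := by rw [hP1]; exact isUnit_one
  have hsub : ∀ x : PowerSeries ℝ, PowerSeries.constantCoeff x = 0 →
      PowerSeries.subst x S = PowerSeries.C (-(1 / 2) : ℝ) * (PowerSeries.subst x P) ^ 2 := by
    intro x hx
    have hs : PowerSeries.HasSubst x := PowerSeries.HasSubst.of_constantCoeff_zero' hx
    conv_lhs => rw [hP2]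
    rw [PowerSeries.subst_mul hs, PowerSeries.subst_pow hs, PowerSeries.subst_C]
    rfl
  refine ⟨P.substInvOfIsUnit hu, ⟨by simp, ?_, ?_⟩, ?_⟩
  · rw [PowerSeries.coeff_one_substInvOfIsUnit]
    have : hu.unit = 1 := Units.ext hP1
    rw [this]
    simp
  · rw [hsub _ (by simp), PowerSeries.subst_substInvOfIsUnit_right P hPc hu]
    simp
  · rintro x ⟨hx0, hx1, hx⟩
    have hs : PowerSeries.HasSubst x := PowerSeries.HasSubst.of_constantCoeff_zero' hx0
    have hsq : PowerSeries.subst x P ^ 2 = (PowerSeries.X : PowerSeries ℝ) ^ 2 := by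
      rw [hsub x hx0] at hx
      rw [map_neg, neg_mul, neg_inj] at hx
      refine mul_left_cancel₀ (fun h => ?_) hx
      have h' := congrArg PowerSeries.constantCoeff h
      simp at h'
    have hmul : PowerSeries.subst x P = x * PowerSeries.subst x q := by
      rw [hP, PowerSeries.subst_mul hs, PowerSeries.subst_X hs]
    have hcq : PowerSeries.constantCoeff (PowerSeries.subst x q) = 1 := by
      have h := PowerSeries.constantCoeff_subst_eq_zero hx0 (q - 1) (by simp [hq0])
      rw [PowerSeries.subst_sub hs, ← PowerSeries.coe_substAlgHom hs, map_one, map_sub,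
        map_one, sub_eq_zero, PowerSeries.coe_substAlgHom hs] at h
      exact h
    have hc1 : PowerSeries.coeff 1 (PowerSeries.subst x P) = PowerSeries.coeff 1 x := by
      rw [← PowerSeries.coeff_zero_eq_constantCoeff_apply] at hcq
      rw [← PowerSeries.coeff_zero_eq_constantCoeff_apply] at hx0
      rw [hmul, PowerSeries.coeff_mul, Finset.Nat.sum_antidiagonal_eq_sum_range_succ_mk]
      rw [Finset.sum_range_succ, Finset.sum_range_one, hx0]
      rw [Nat.sub_self, hcq, zero_mul, zero_add, mul_one]
    have hX : PowerSeries.subst x P = (PowerSeries.X : PowerSeries ℝ) := by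
      rcases eq_or_eq_neg_of_sq_eq_sq _ _ hsq with h | h
      · exact h
      · rw [h] at hc1
        simp at hc1
        linarith
    calc x = PowerSeries.subst x (PowerSeries.X : PowerSeries ℝ) := (PowerSeries.subst_X hs).symm
      _ = PowerSeries.subst x (PowerSeries.subst P (P.substInvOfIsUnit hu)) := by
          rw [PowerSeries.subst_substInvOfIsUnit_left P hPc hu]
      _ = PowerSeries.subst (PowerSeries.subst x P) (P.substInvOfIsUnit hu) := by
          rw [PowerSeries.subst_comp_subst_apply
            (PowerSeries.HasSubst.of_constantCoeff_zero' hPc) hs]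
      _ = P.substInvOfIsUnit hu := by rw [hX, PowerSeries.X_subst]

/-- The local solution `x(y)` of `y = √(-2 S(x(y)))`. -/
def localSolution (S : PowerSeries ℝ) : PowerSeries ℝ :=
  Classical.epsilon (IsLocalSolution S)

theorem isLocalSolution_localSolution (S : PowerSeries ℝ) (h0 : PowerSeries.coeff 0 S = 0)
    (h1 : PowerSeries.coeff 1 S = 0) (h2 : PowerSeries.coeff 2 S = -1 / 2) :
    IsLocalSolution S (localSolution S) :=
  Classical.epsilon_spec (existsUnique_isLocalSolution S h0 h1 h2).exists

/-! ### Dominant singularities -/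

/-- A real power series as a formal multilinear series over `ℂ`. -/
def complexSeries (x : PowerSeries ℝ) : FormalMultilinearSeries ℂ ℂ ℂ :=
  FormalMultilinearSeries.ofScalars ℂ fun n => ((PowerSeries.coeff n x : ℝ) : ℂ)

/-- The radius of convergence of a real power series. -/
def convergenceRadius (x : PowerSeries ℝ) : ENNReal := (complexSeries x).radius

/-- The open disc of convergence in the complex plane. -/
def convergenceDisc (x : PowerSeries ℝ) : Set ℂ := Metric.eball 0 (convergenceRadius x)

/-- The sum `∑ₙ xₙ yⁿ` of a real power series at a complex point `y` of the disc of convergence. -/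
def evalSeries (x : PowerSeries ℝ) (y : ℂ) : ℂ := ∑' n, ((PowerSeries.coeff n x : ℝ) : ℂ) * y ^ n

/-- `ρ` is a dominant singularity of `x(y)`: it lies on the circle of convergence, and `x(y)` has no
analytic continuation from the disc of convergence to a neighbourhood of `ρ`. -/
def IsDominantSingularity (x : PowerSeries ℝ) (ρ : ℂ) : Prop :=
  ENNReal.ofReal ‖ρ‖ = convergenceRadius x ∧
    ¬ ∃ g : ℂ → ℂ, AnalyticAt ℂ g ρ ∧ g =ᶠ[𝓝[convergenceDisc x] ρ] evalSeries x

/-- `(τ, ρ)` is a regular point of the curve `y²/2 = -S(x)`: it lies on the curve, and the gradient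
of `y²/2 + S(x)` does not vanish there. -/
def IsRegularPoint (S : ℂ → ℂ) (τ ρ : ℂ) : Prop :=
  ρ ^ 2 / 2 = -S τ ∧ ¬ (deriv S τ = 0 ∧ ρ = 0)

/-- `ρ` is a dominant singularity of square-root type of the local solution `x(y)`, with coordinates
`(τ, ρ)`: `x(y)` tends to the finite limit `τ` as `y → ρ`, and the curve is regular at `(τ, ρ)`. -/
def IsSquareRootSingularity (S : ℂ → ℂ) (τ ρ : ℂ) : Prop :=
  IsDominantSingularity (localSolution (maclaurin S)) ρ ∧
    Tendsto (evalSeries (localSolution (maclaurin S)))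
      (𝓝[convergenceDisc (localSolution (maclaurin S))] ρ) (𝓝 τ) ∧
    IsRegularPoint S τ ρ

/-! ### The coefficients of the asymptotic expansion -/

/-- The action `x ↦ S(τ) - S(x + τ)` as a power series in `x`. -/
def saddleAction (S : ℂ → ℂ) (τ : ℝ) : PowerSeries ℝ :=
  maclaurin fun x => S τ - S (x + τ)

/-- `w k = (2π)⁻¹ [ħᵏ] F[S(τ) - S(x + τ)](-ħ)`. -/
def saddleCoeff (S : ℂ → ℂ) (τ : ℝ) (k : ℕ) : ℝ :=
  1 / (2 * Real.pi) *
    PowerSeries.coeff k (PowerSeries.rescale (-1 : ℝ) (formalIntegral (saddleAction S τ)))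

end

end FormalIntegral

/-! Lagrange inversion gives `[ħⁿ] F[S] = (2n+1)‼ [y^(2n+1)] x(y)` (`coeff_formalIntegral`), so the
theorem is a singularity analysis of the inverse function `x(y)`, written `sol S`, on its circle of
convergence, of radius `r`.

Location of the singularities. If `S'(τ) ≠ 0`, a local inverse of `S` continues `x(y)` past `ρ`;
hence `τ` is critical and therefore real, and `ρ² = -2 S(τ)` is real. An imaginary `ρ` is
impossible: `t ↦ x(it)` would join `0` to `τ` through the upper half plane with `S = t²/2 ≥ 0` on
it, while `S < 0` at some real point between `0` and `τ`; a Cauchy integral of `exp (-l S)` rules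
this out (`not_nonneg_along_upper_curve`). So `ρ = ±r` and `A = r²/2`. Along the real ray `S(x(y)) =
-y²/2` decreases to `S(τ)`, so `τ` is no local maximum, and nondegeneracy makes it a local minimum.

Asymptotics. Near `ρ` one has `x(y) = τ + ψ(√(r² - y²))`, where `ψ` inverts the Morse coordinate of
`S(τ) - S(x + τ)` (`IsRealSaddle.exists_continuation`). By the same inversion formula the odd
coefficients of `ψ` are those of the formal integral at the saddle. If every dominant singularity is
of this type, `x(y)` extends to the upper half of a larger disc, up to the real line; since its
coefficients are real, the upper half is enough. Cauchy's theorem expresses the coefficients, up to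
an exponentially small error, by integrals of `Im x` over the real rays beyond `±r`. There `Im x =
Im ψ(i √(u² - r²))` has an expansion in odd powers of `√(u² - r²)` with signs `(-1)^k`, the source
of the argument `-ħ`, and each power integrates exactly to a Gamma value
(`doubleFactorial_mul_cutIntegral`).

If the radius is infinite, `x(y)` is linear and there is nothing to expand. -/

namespace FormalIntegral

noncomputable section

/-! ### Lagrange inversion and the formal integral -/

open PowerSeries in
-- With `p = X u` the coefficient is the residue of `p' / p^(i+1)`: for `i > 0` this is an exact
-- derivative and has no residue, and for `i = 0` it is a logarithmic derivative with residue one.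
theorem coeff_deriv_mul_inv_pow (u : PowerSeries ℝ) (hu : constantCoeff u ≠ 0) (i : ℕ) :
    coeff i (d⁄dX ℝ (X * u) * u⁻¹ ^ (i + 1)) = if i = 0 then 1 else 0 := by
  have huu : u * u⁻¹ = 1 := PowerSeries.mul_inv_cancel u hu
  have hd : d⁄dX ℝ (X * u) = u + X * d⁄dX ℝ u := by
    rw [Derivation.leibniz]; simp [add_comm]
  have h1 : d⁄dX ℝ (X * u) * u⁻¹ ^ (i + 1) = u⁻¹ ^ i + X * (u⁻¹ ^ (i + 1) * d⁄dX ℝ u) := by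
    rw [hd, pow_succ]
    linear_combination (u⁻¹ ^ i) * huu
  rw [h1, map_add]
  rcases i with _ | i
  · simp
  · have h2 : d⁄dX ℝ (u⁻¹ ^ (i + 1)) = -((i + 1 : ℕ) : PowerSeries ℝ) * (u⁻¹ ^ (i + 1 + 1) * d⁄dX ℝ u) := by
      rw [derivative_pow, derivative_inv']
      push_cast
      ring
    have h3 := congrArg (coeff i) h2
    rw [coeff_derivative, coeff_succ_X_mul] at *
    rw [show -((i + 1 : ℕ) : PowerSeries ℝ) = C (-((i + 1 : ℕ) : ℝ)) by simp, coeff_C_mul] at h3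
    rw [if_neg (Nat.succ_ne_zero i)]
    have h4 : ((i + 1 : ℕ) : ℝ) ≠ 0 := by positivity
    apply mul_left_cancel₀ h4
    push_cast at *
    linear_combination h3

open PowerSeries in
/-- Lagrange inversion. -/
theorem coeff_compInverse (u x : PowerSeries ℝ) (hu : constantCoeff u ≠ 0)
    (hx : subst (X * u) x = (X : PowerSeries ℝ)) (n : ℕ) :
    (n + 1 : ℝ) * coeff (n + 1) x = coeff n (u⁻¹ ^ (n + 1)) := by
  have hs : HasSubst (X * u : PowerSeries ℝ) := HasSubst.of_constantCoeff_zero' (by simp)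
  have huu : u * u⁻¹ = 1 := PowerSeries.mul_inv_cancel u hu
  have hd : subst (X * u) (d⁄dX ℝ x) * d⁄dX ℝ (X * u) = 1 := by
    rw [← derivative_subst hs, hx]; simp
  set p : PowerSeries ℝ := X * u with hp
  -- The residue pairing: among the terms of `x'(p) p' / p^(n+1)` only `j = n` survives.
  have hterm : ∀ j : ℕ, coeff n (p ^ j * (d⁄dX ℝ p * u⁻¹ ^ (n + 1))) =
      if j = n then 1 else 0 := by
    intro j
    by_cases hj : j ≤ n
    · obtain ⟨i, rfl⟩ := Nat.exists_eq_add_of_le hj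
      have : p ^ j * (d⁄dX ℝ p * u⁻¹ ^ (j + i + 1)) =
          X ^ j * (d⁄dX ℝ (X * u) * u⁻¹ ^ (i + 1)) := by
        have : (u * u⁻¹) ^ j = 1 := by rw [huu, one_pow]
        rw [mul_pow] at this
        rw [hp, mul_pow, show j + i + 1 = j + (i + 1) by ring, pow_add u⁻¹]
        linear_combination (X ^ j * d⁄dX ℝ (X * u) * u⁻¹ ^ (i + 1)) * this
      rw [this, add_comm j i, coeff_X_pow_mul, coeff_deriv_mul_inv_pow u hu]
      simp
    · rw [if_neg (by omega), hp, mul_pow, mul_assoc, coeff_X_pow_mul', if_neg hj]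
  have key : u⁻¹ ^ (n + 1) = subst p (d⁄dX ℝ x) * (d⁄dX ℝ p * u⁻¹ ^ (n + 1)) := by
    rw [← mul_assoc, hd, one_mul]
  set G := d⁄dX ℝ p * u⁻¹ ^ (n + 1)
  -- Truncating `x'` makes the sum over `j` finite; the remainder is divisible by `X^(n+1)` after
  -- substitution.
  obtain ⟨T, hT⟩ : ∃ T : PowerSeries ℝ, d⁄dX ℝ x =
      ((trunc (n + 1) (d⁄dX ℝ x) : Polynomial ℝ) : PowerSeries ℝ) + X ^ (n + 1) * T := by
    have : X ^ (n + 1) ∣ d⁄dX ℝ x - ((trunc (n + 1) (d⁄dX ℝ x) : Polynomial ℝ) : PowerSeries ℝ) := by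
      rw [X_pow_dvd_iff]
      intro m hm
      rw [map_sub, Polynomial.coeff_coe, coeff_trunc, if_pos hm, sub_self]
    obtain ⟨T, hT⟩ := this
    exact ⟨T, by rw [← hT]; ring⟩
  rw [key, hT, subst_add hs, subst_mul hs, subst_pow hs, subst_X hs, add_mul _ _ G, map_add, hp,
    mul_pow, mul_assoc, mul_assoc, coeff_X_pow_mul', if_neg (by omega), add_zero, ← hp,
    subst_coe hs, Polynomial.aeval_eq_sum_range' (n := n + 1) (natDegree_trunc_lt _ _),
    Finset.sum_mul, map_sum]
  rw [Finset.sum_eq_single n]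
  · rw [smul_mul_assoc, map_smul, hterm, if_pos rfl, coeff_trunc, if_pos (Nat.lt_succ_self n),
      coeff_derivative]
    simp [mul_comm]
  · intro j _ hj
    rw [smul_mul_assoc, map_smul, hterm, if_neg hj, smul_zero]
  · simp

/-- Passing from `k` to `k + 1` multiplies both sides by `2(m + k) + 1`. The identity turns the
binomial series of exponent `-(m + 1/2)` into double factorials. -/
theorem choose_neg_half_mul (m k : ℕ) :
    ((2 * m - 1)‼ : ℝ) * ((-2) ^ k * (k ! : ℝ) * Ring.choose (-((m : ℝ) + 1 / 2)) k) =
      ((2 * (m + k) - 1)‼ : ℝ) := by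
  induction k with
  | zero => simp
  | succ k ih =>
    have h := Ring.descPochhammer_eq_factorial_smul_choose (-((m : ℝ) + 1 / 2)) k
    have h' := Ring.descPochhammer_eq_factorial_smul_choose (-((m : ℝ) + 1 / 2)) (k + 1)
    rw [descPochhammer_succ_right, Polynomial.smeval_mul, h] at h'
    simp only [nsmul_eq_mul, Polynomial.smeval_sub, Polynomial.smeval_X, Polynomial.smeval_natCast,
      pow_one, pow_zero] at h'
    have e : ((2 * (m + (k + 1)) - 1)‼ : ℝ) = (2 * (m + k) + 1 : ℝ) * ((2 * (m + k) - 1)‼ : ℝ) := by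
      rw [show 2 * (m + (k + 1)) - 1 = (2 * (m + k)) + 1 by omega]
      -- At `m + k = 0` the truncated subtraction yields `0‼ = 1` in place of `(-1)‼`, so the
      -- recurrence is checked separately.
      rcases Nat.eq_zero_or_pos (m + k) with h0 | h0
      · simp [h0, show (m : ℝ) + k = 0 by exact_mod_cast h0]
      · obtain ⟨t, ht⟩ := Nat.exists_eq_add_of_le h0
        have : (m : ℝ) + k = 1 + t := by exact_mod_cast ht
        rw [ht, this, show 2 * (1 + t) + 1 = (2 * t + 1) + 2 by ring, Nat.doubleFactorial_add_two,
          show 2 * (1 + t) - 1 = 2 * t + 1 by omega]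
        push_cast; ring
    rw [e, ← ih]
    linear_combination (-((2 * m - 1)‼ : ℝ) * (-2) ^ (k + 1)) * h'

open PowerSeries in
/-- The formal integral in terms of the local solution. -/
theorem coeff_formalIntegral (S x : PowerSeries ℝ) (h0 : coeff 0 S = 0) (h1 : coeff 1 S = 0)
    (h2 : coeff 2 S < 0) (hx : IsLocalSolution S x) (m : ℕ) :
    coeff m (formalIntegral S) = ((2 * m + 1)‼ : ℝ) * coeff (2 * m + 1) x := by
  obtain ⟨hx0, hx1, hx⟩ := hx
  set a := width S with ha
  have hapos : 0 < a := by
    rw [ha, width]; exact div_pos_of_neg_of_neg (by norm_num) (by linarith)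
  have has : coeff 2 S = -1 / (2 * a) := by
    rw [ha, width]; field_simp
  set V := potential S with hV
  -- `W = -2a V / X²`, so that `S = -X² (1 + W) / (2a)`.
  obtain ⟨W, hWV⟩ : ∃ W : PowerSeries ℝ, C (-2 * a) * V = X ^ 2 * W ∧ constantCoeff W = 0 := by
    obtain ⟨T, hT⟩ := X_pow_three_dvd_potential S h0 h1
    exact ⟨C (-2 * a) * X * T, by rw [hV, hT]; ring, by simp⟩
  obtain ⟨hWV, hW0⟩ := hWV
  have hW : HasSubst W := HasSubst.of_constantCoeff_zero' hW0
  set q : PowerSeries ℝ := subst W (binomialSeries ℝ (1 / 2 : ℝ)) with hq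
  have hqpow : ∀ n : ℕ, q ^ n = subst W (binomialSeries ℝ (n / 2 : ℝ)) := by
    intro n
    induction n with
    | zero => simp only [Nat.cast_zero, zero_div, binomialSeries_zero, pow_zero]
              rw [← coe_substAlgHom hW, map_one]
    | succ n ih =>
      rw [pow_succ, ih, hq, ← subst_mul hW, ← binomialSeries_add]
      congr 2; push_cast; ring
  have hq2 : q ^ 2 = 1 + W := by
    rw [hqpow, show ((2 : ℕ) / 2 : ℝ) = ((1 : ℕ) : ℝ) by norm_num, binomialSeries_nat, pow_one,
      subst_add hW, subst_X hW, ← coe_substAlgHom hW, map_one]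
  have hq0 : constantCoeff q = 1 := by
    have h := constantCoeff_subst_eq_zero hW0 (PowerSeries.binomialSeries ℝ (1 / 2 : ℝ) - 1) (by simp)
    rw [subst_sub hW, ← coe_substAlgHom hW, map_one, map_sub, map_one, sub_eq_zero,
      coe_substAlgHom hW] at h
    exact h
  set s : ℝ := Real.sqrt a with hs
  have hspos : 0 < s := Real.sqrt_pos.2 hapos
  have hss : s ^ 2 = a := Real.sq_sqrt hapos.le
  -- With `u = √(1 + W) / √a` the action is `-(X u)² / 2`, and `x` is the compositional inverse of
  -- `X u`.
  set u : PowerSeries ℝ := C s⁻¹ * q with hu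
  have hu0 : constantCoeff u = s⁻¹ := by simp [hu, hq0]
  have hSu : S = C (-(1 / 2) : ℝ) * (X * u) ^ 2 := by
    have e1 : S = V + C (-1 / (2 * a)) * X ^ 2 := by rw [hV, potential, has]; ring
    have e2 : V = C (-1 / (2 * a)) * (X ^ 2 * W) := by
      rw [← hWV, ← mul_assoc, ← map_mul, show -1 / (2 * a) * (-2 * a) = 1 by field_simp, map_one,
        one_mul]
    rw [e1, hu, mul_pow, mul_pow, hq2, ← map_pow, inv_pow, hss, e2]
    rw [show (-1 / (2 * a)) = (-(1 / 2)) * a⁻¹ by field_simp, map_mul]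
    ring
  have hPc : constantCoeff (X * u) = 0 := by simp
  have hP1 : coeff 1 (X * u) = s⁻¹ := by
    rw [show (1 : ℕ) = 0 + 1 from rfl, coeff_succ_X_mul]; simpa using hu0
  have hunit : IsUnit (coeff 1 (X * u)) := by
    rw [hP1]; exact (inv_pos.2 hspos).ne'.isUnit
  have hsx : HasSubst x := HasSubst.of_constantCoeff_zero' hx0
  have hsq : subst x (X * u) ^ 2 = (X : PowerSeries ℝ) ^ 2 := by
    rw [hSu, subst_mul hsx, subst_pow hsx, subst_C] at hx
    change C (-(1 / 2) : ℝ) * _ = _ at hx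
    rw [map_neg, neg_mul, neg_inj] at hx
    refine mul_left_cancel₀ (fun h => ?_) hx
    simpa using congrArg constantCoeff h
  -- The equation fixes `X u ∘ x` up to sign; the minus sign would make `x'(0)` negative.
  have hX : subst x (X * u) = (X : PowerSeries ℝ) := by
    rcases eq_or_eq_neg_of_sq_eq_sq _ _ hsq with h | h
    · exact h
    · exfalso
      have hmul : subst x (X * u) = x * subst x u := by rw [subst_mul hsx, subst_X hsx]
      have hcq : constantCoeff (subst x u) = s⁻¹ := by
        have h := constantCoeff_subst_eq_zero hx0 (u - C s⁻¹) (by simp [hu0])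
        rw [subst_sub hsx, subst_C, map_sub, sub_eq_zero] at h
        exact h.trans (constantCoeff_C _)
      have hc1 := congrArg (coeff 1) h
      rw [hmul, coeff_mul, Finset.Nat.sum_antidiagonal_eq_sum_range_succ_mk,
        Finset.sum_range_succ, Finset.sum_range_one, coeff_zero_eq_constantCoeff_apply, hx0,
        Nat.sub_self, coeff_zero_eq_constantCoeff_apply, hcq] at hc1
      simp at hc1
      have := mul_pos hx1 (inv_pos.2 hspos)
      linarith
  have hinv : subst (X * u) x = (X : PowerSeries ℝ) := by
    have hy := subst_substInvOfIsUnit_left (X * u) hPc hunit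
    have : x = (X * u).substInvOfIsUnit hunit := by
      calc x = subst x (X : PowerSeries ℝ) := (subst_X hsx).symm
        _ = subst x (subst (X * u) ((X * u).substInvOfIsUnit hunit)) := by rw [hy]
        _ = subst (subst x (X * u)) ((X * u).substInvOfIsUnit hunit) := by
            rw [subst_comp_subst_apply (HasSubst.of_constantCoeff_zero' hPc) hsx]
        _ = _ := by rw [hX, X_subst]
    rw [this, hy]
  have hL := coeff_compInverse u x (by rw [hu0]; exact (inv_pos.2 hspos).ne') hinv (2 * m)
  -- This is `(1 + W)^(-(m + 1/2))`, whose binomial expansion is the sum over `k` in the formal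
  -- integral.
  have hqinv : q⁻¹ ^ (2 * m + 1) = subst W (binomialSeries ℝ (-((m : ℝ) + 1 / 2))) := by
    have hB : q ^ (2 * m + 1) * subst W (binomialSeries ℝ (-((m : ℝ) + 1 / 2))) = 1 := by
      rw [hqpow, ← subst_mul hW, ← binomialSeries_add,
        show (((2 * m + 1 : ℕ) : ℝ) / 2 + -((m : ℝ) + 1 / 2)) = 0 by push_cast; ring,
        binomialSeries_zero, ← coe_substAlgHom hW, map_one]
    have hq' : q⁻¹ ^ (2 * m + 1) * q ^ (2 * m + 1) = 1 := by
      rw [← mul_pow, PowerSeries.inv_mul_cancel q (by simp [hq0]), one_pow]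
    calc q⁻¹ ^ (2 * m + 1) = q⁻¹ ^ (2 * m + 1) *
          (q ^ (2 * m + 1) * subst W (binomialSeries ℝ (-((m : ℝ) + 1 / 2)))) := by
            rw [hB, mul_one]
      _ = _ := by rw [← mul_assoc, hq', one_mul]
  have huinv : u⁻¹ = C s * q⁻¹ := by
    rw [hu, PowerSeries.mul_inv_rev, C_inv, inv_inv, mul_comm]
  have hWpow : ∀ k, coeff (2 * m) (W ^ k) = (-2 * a) ^ k * coeff (2 * (m + k)) (V ^ k) := by
    intro k
    have := congrArg (coeff (2 * (m + k))) (congrArg (· ^ k) hWV)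
    simp only [mul_pow (C (-2 * a)), mul_pow (X ^ 2 : PowerSeries ℝ)] at this
    rw [← map_pow, coeff_C_mul, ← pow_mul, show 2 * (m + k) = 2 * m + 2 * k by ring,
      coeff_X_pow_mul] at this
    rw [← this, show 2 * (m + k) = 2 * m + 2 * k by ring]
  -- `X^k` divides `W^k`, which cuts the sum at `k = 2m`, the range used in `formalIntegral`.
  have hsub : coeff (2 * m) (subst W (binomialSeries ℝ (-((m : ℝ) + 1 / 2)))) =
      ∑ k ∈ Finset.range (2 * m + 1), Ring.choose (-((m : ℝ) + 1 / 2)) k *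
        ((-2 * a) ^ k * coeff (2 * (m + k)) (V ^ k)) := by
    rw [coeff_subst' hW, finsum_eq_sum_of_support_subset (s := Finset.range (2 * m + 1))]
    · refine Finset.sum_congr rfl fun k _ => ?_
      rw [hWpow, binomialSeries_coeff]; simp only [smul_eq_mul, mul_one]
    · intro k hk
      simp only [Finset.coe_range, Set.mem_Iio]
      by_contra hlt
      apply hk
      have : X ^ k ∣ W ^ k := pow_dvd_pow_of_dvd (X_dvd_iff.2 hW0) k
      rw [X_pow_dvd_iff] at this
      simp [this (2 * m) (by omega)]
  rw [huinv, mul_pow, ← map_pow, coeff_C_mul, hqinv, hsub] at hL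
  have hdf : ((2 * m + 1)‼ : ℝ) = ((2 * m - 1)‼ : ℝ) * (2 * m + 1) := by
    rcases m with _ | m
    · simp
    · rw [show 2 * (m + 1) + 1 = (2 * m + 1) + 2 by ring, Nat.doubleFactorial_add_two,
        show 2 * (m + 1) - 1 = 2 * m + 1 by omega]
      push_cast; ring
  push_cast at hL
  rw [formalIntegral, coeff_mk, hdf, mul_assoc, hL, ← ha, ← hs, ← hV, Finset.mul_sum, Finset.mul_sum, Finset.mul_sum]
  refine Finset.sum_congr rfl fun k _ => ?_
  rw [← choose_neg_half_mul, pow_succ, pow_mul, hss, mul_pow, pow_add]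
  have : (k ! : ℝ) ≠ 0 := by positivity
  field_simp

/-! ### Taylor series of analytic functions at the origin -/

/-- The Taylor series at the origin. -/
def taylor (f : ℂ → ℂ) : PowerSeries ℂ :=
  PowerSeries.mk fun n => iteratedDeriv n f 0 / (n ! : ℂ)

theorem coeff_taylor (f : ℂ → ℂ) (n : ℕ) :
    PowerSeries.coeff n (taylor f) = iteratedDeriv n f 0 / (n ! : ℂ) := by
  rw [taylor, PowerSeries.coeff_mk]

theorem constantCoeff_taylor (f : ℂ → ℂ) : PowerSeries.constantCoeff (taylor f) = f 0 := by
  rw [← PowerSeries.coeff_zero_eq_constantCoeff_apply, coeff_taylor]; simp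

theorem taylor_congr {f g : ℂ → ℂ} (h : f =ᶠ[𝓝 0] g) : taylor f = taylor g := by
  ext n; rw [coeff_taylor, coeff_taylor, h.iteratedDeriv_eq]

theorem taylor_const (c : ℂ) : taylor (fun _ => c) = PowerSeries.C c := by
  ext n
  rw [coeff_taylor, PowerSeries.coeff_C, iteratedDeriv_const]
  split_ifs with h <;> simp [h]

theorem taylor_id : taylor (fun z => z) = PowerSeries.X := by
  ext n
  rw [coeff_taylor, PowerSeries.coeff_X]
  rcases n with _ | _ | n
  · simp
  · simp
  · rw [iteratedDeriv_succ', show deriv (fun z : ℂ => z) = fun _ => 1 from deriv_id', iteratedDeriv_const]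
    simp

theorem taylor_add {f g : ℂ → ℂ} (hf : AnalyticAt ℂ f 0) (hg : AnalyticAt ℂ g 0) :
    taylor (fun z => f z + g z) = taylor f + taylor g := by
  ext n
  rw [map_add, coeff_taylor, coeff_taylor, coeff_taylor, ← add_div]
  congr 1
  exact iteratedDeriv_add hf.contDiffAt hg.contDiffAt

theorem taylor_mul {f g : ℂ → ℂ} (hf : AnalyticAt ℂ f 0) (hg : AnalyticAt ℂ g 0) :
    taylor (fun z => f z * g z) = taylor f * taylor g := by
  ext n
  rw [PowerSeries.coeff_mul, coeff_taylor, iteratedDeriv_fun_mul hf.contDiffAt hg.contDiffAt,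
    Finset.Nat.sum_antidiagonal_eq_sum_range_succ_mk, Finset.sum_div]
  refine Finset.sum_congr rfl fun i hi => ?_
  rw [coeff_taylor, coeff_taylor, Nat.cast_choose ℂ (Nat.lt_succ_iff.1 (Finset.mem_range.1 hi))]
  have h1 : (n ! : ℂ) ≠ 0 := by exact_mod_cast n.factorial_ne_zero
  field_simp

theorem taylor_pow {f : ℂ → ℂ} (hf : AnalyticAt ℂ f 0) (n : ℕ) :
    taylor (fun z => f z ^ n) = taylor f ^ n := by
  induction n with
  | zero => simpa using taylor_const 1
  | succ n ih =>
    simp only [pow_succ]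
    rw [taylor_mul (hf.fun_pow n) hf, ih]

theorem taylor_sum {ι : Type*} (s : Finset ι) {f : ι → ℂ → ℂ} (hf : ∀ i ∈ s, AnalyticAt ℂ (f i) 0) :
    taylor (fun z => ∑ i ∈ s, f i z) = ∑ i ∈ s, taylor (f i) := by
  classical
  induction s using Finset.induction_on with
  | empty => simpa using taylor_const 0
  | insert a s ha ih =>
    simp only [Finset.sum_insert ha]
    rw [taylor_add (hf a (Finset.mem_insert_self _ _))
      (Finset.analyticAt_fun_sum s fun i hi => hf i (Finset.mem_insert_of_mem hi)),
      ih fun i hi => hf i (Finset.mem_insert_of_mem hi)]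

/-- Taylor's formula with an analytic remainder. -/
theorem exists_taylor_remainder {f : ℂ → ℂ} (hf : AnalyticAt ℂ f 0) (N : ℕ) :
    ∃ g : ℂ → ℂ, AnalyticAt ℂ g 0 ∧ ∀ᶠ z in 𝓝 0,
      f z = ∑ j ∈ Finset.range N, PowerSeries.coeff j (taylor f) * z ^ j + z ^ N * g z := by
  obtain ⟨g, hg, h⟩ := hf.exists_eventuallyEq_sum_add_pow_mul N
  refine ⟨g, hg, ?_⟩
  filter_upwards [h] with z h
  rw [h, smul_eq_mul]
  congr 1
  refine Finset.sum_congr rfl fun j _ => ?_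
  rw [coeff_taylor, smul_eq_mul]
  ring

/-- The `n`-th coefficient sees only the Taylor polynomial of `f` of degree `n`: the remainder,
composed with `ψ`, carries a factor `ψ^(n+1)`. -/
theorem taylor_comp {f ψ : ℂ → ℂ} (hf : AnalyticAt ℂ f 0) (hψ : AnalyticAt ℂ ψ 0) (h0 : ψ 0 = 0) :
    taylor (fun z => f (ψ z)) = PowerSeries.subst (taylor ψ) (taylor f) := by
  have hc : PowerSeries.constantCoeff (taylor ψ) = 0 := by rw [constantCoeff_taylor, h0]
  have hs : PowerSeries.HasSubst (taylor ψ) := PowerSeries.HasSubst.of_constantCoeff_zero' hc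
  ext n
  have hvan : ∀ d, n < d → ∀ T : PowerSeries ℂ, PowerSeries.coeff n (taylor ψ ^ d * T) = 0 := by
    intro d hd T
    have : PowerSeries.X ^ d ∣ taylor ψ ^ d * T :=
      (pow_dvd_pow_of_dvd (PowerSeries.X_dvd_iff.2 hc) d).mul_right T
    exact PowerSeries.X_pow_dvd_iff.1 this n hd
  obtain ⟨g, hg, hfg⟩ := exists_taylor_remainder hf (n + 1)
  have hev : (fun z => f (ψ z)) =ᶠ[𝓝 0] fun z =>
      ∑ j ∈ Finset.range (n + 1), PowerSeries.coeff j (taylor f) * ψ z ^ j +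
        ψ z ^ (n + 1) * g (ψ z) := by
    have : Tendsto ψ (𝓝 0) (𝓝 0) := by
      have := hψ.continuousAt.tendsto; rwa [h0] at this
    exact this.eventually hfg
  have hgψ : AnalyticAt ℂ (fun z => g (ψ z)) 0 := by
    have : AnalyticAt ℂ g (ψ 0) := by rwa [h0]
    exact this.comp hψ
  rw [taylor_congr hev, taylor_add (Finset.analyticAt_fun_sum _ fun i _ => analyticAt_const.fun_mul (hψ.fun_pow i))
    ((hψ.fun_pow _).fun_mul hgψ), taylor_sum _ fun i _ => analyticAt_const.fun_mul (hψ.fun_pow i),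
    taylor_mul (hψ.fun_pow _) hgψ, taylor_pow hψ, map_add, hvan _ (Nat.lt_succ_self n), add_zero,
    PowerSeries.coeff_subst' hs, map_sum,
    finsum_eq_sum_of_support_subset (s := Finset.range (n + 1))]
  · refine Finset.sum_congr rfl fun j _ => ?_
    rw [taylor_mul analyticAt_const (hψ.fun_pow j), taylor_const, taylor_pow hψ,
      PowerSeries.coeff_C_mul, smul_eq_mul]
  · intro d hd
    simp only [Finset.coe_range, Set.mem_Iio]
    by_contra hlt
    apply hd
    have := hvan d (by omega) 1
    rw [mul_one] at this
    simp [this]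

/-- Functions that commute with complex conjugation have real Taylor coefficients. -/
theorem im_iteratedDeriv_eq_zero {f : ℂ → ℂ} (hf : AnalyticAt ℂ f 0)
    (hc : ∀ᶠ t : ℝ in 𝓝 0, (f t).im = 0) (n : ℕ) : (iteratedDeriv n f 0).im = 0 := by
  suffices h : ∀ n, ∀ᶠ t : ℝ in 𝓝 0, (iteratedDeriv n f t).im = 0 by
    simpa using (h n).self_of_nhds
  intro n
  have hcont : Tendsto (fun t : ℝ => (t : ℂ)) (𝓝 0) (𝓝 0) := by
    simpa using Complex.continuous_ofReal.tendsto 0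
  induction n with
  | zero => simpa using hc
  | succ n ih =>
    have han : ∀ᶠ t : ℝ in 𝓝 0, AnalyticAt ℂ (iteratedDeriv n f) t :=
      hcont.eventually (AnalyticAt.iterated_deriv hf n |> fun h => (by simpa [iteratedDeriv_eq_iterate] using h : AnalyticAt ℂ (iteratedDeriv n f) 0)).eventually_analyticAt
    filter_upwards [han, ih.eventually_nhds] with t ht h2
    rw [iteratedDeriv_succ]
    have hd : HasDerivAt (iteratedDeriv n f) (deriv (iteratedDeriv n f) t) (t : ℂ) :=
      ht.differentiableAt.hasDerivAt
    have h3 := (Complex.imCLM.hasFDerivAt.comp_hasDerivAt t hd.comp_ofReal)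
    have h4 : HasDerivAt (fun _ : ℝ => (0 : ℝ)) 0 t := hasDerivAt_const t 0
    have h5 := (h4.congr_of_eventuallyEq (f₁ := fun t : ℝ => (iteratedDeriv n f t).im) h2)
    exact h3.unique h5

/-- Transfers identities between analytic functions to real power series, since the map to complex
coefficients is injective. -/
theorem map_maclaurin {f : ℂ → ℂ} (hf : AnalyticAt ℂ f 0)
    (hc : ∀ᶠ t : ℝ in 𝓝 0, (f t).im = 0) :
    PowerSeries.map Complex.ofRealHom (maclaurin f) = taylor f := by
  ext n
  rw [PowerSeries.coeff_map, coeff_taylor, maclaurin, PowerSeries.coeff_mk]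
  have h : iteratedDeriv n f 0 = ((iteratedDeriv n f 0).re : ℂ) :=
    Complex.ext (by simp) (by simpa using im_iteratedDeriv_eq_zero hf hc n)
  rw [h]
  simp

theorem coeff_maclaurin {f : ℂ → ℂ} (n : ℕ) :
    PowerSeries.coeff n (maclaurin f) = (iteratedDeriv n f 0).re / (n ! : ℝ) := by
  rw [maclaurin, PowerSeries.coeff_mk]

/-! ### The Morse coordinate at a nondegenerate critical point -/

/-- `ψ` inverts the Morse coordinate `P` of `f`, where `f = -P² / 2` near the origin. -/
structure IsMorseChart (f ψ P : ℂ → ℂ) : Prop where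
  analyticAt_inv : AnalyticAt ℂ ψ 0
  analyticAt_coord : AnalyticAt ℂ P 0
  inv_zero : ψ 0 = 0
  coord_zero : P 0 = 0
  coord_sq : ∀ᶠ z in 𝓝 0, P z ^ 2 = -2 * f z
  inv_coord : ∀ᶠ z in 𝓝 0, ψ (P z) = z
  coord_inv : ∀ᶠ z in 𝓝 0, P (ψ z) = z
  im_inv : ∀ᶠ t : ℝ in 𝓝 0, (ψ t).im = 0
  deriv_pos : 0 < (deriv ψ 0).re

/-- Write `-2f = z² h` with `h(0) = b > 0` and take `P = z √h`; then `P'(0) = √b ≠ 0` and `P` is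
locally invertible. -/
theorem exists_isMorseChart {f : ℂ → ℂ} {b : ℝ} (hf : AnalyticAt ℂ f 0)
    (hc : ∀ᶠ t : ℝ in 𝓝 0, (f t).im = 0) (h0 : f 0 = 0) (h1 : deriv f 0 = 0)
    (h2 : iteratedDeriv 2 f 0 = -b) (hb : 0 < b) : ∃ ψ P : ℂ → ℂ, IsMorseChart f ψ P := by
  obtain ⟨g, hg, hfg⟩ := exists_taylor_remainder hf 3
  have hfg' : ∀ᶠ z in 𝓝 0, -2 * f z = z ^ 2 * (b - 2 * z * g z) := by
    filter_upwards [hfg] with z hz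
    rw [hz]
    simp only [Finset.sum_range_succ, Finset.sum_range_zero, coeff_taylor, iteratedDeriv_zero,
      iteratedDeriv_one, h0, h1, h2]
    norm_num
    ring
  set h : ℂ → ℂ := fun z => b - 2 * z * g z with hh
  have hha : AnalyticAt ℂ h 0 := by fun_prop
  have hh0 : h 0 = b := by simp [hh]
  have hslit : h 0 ∈ Complex.slitPlane := by rw [hh0]; exact Complex.ofReal_mem_slitPlane.2 hb
  -- The principal root of `h`, analytic near `0` because `h(0)` is positive.
  set u : ℂ → ℂ := fun z => Complex.exp (Complex.log (h z) / 2) with hu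
  have hua : AnalyticAt ℂ u 0 := by
    have := hha.clog hslit
    exact (this.div analyticAt_const two_ne_zero).cexp
  have hu2 : ∀ᶠ z in 𝓝 0, u z ^ 2 = h z := by
    have : ∀ᶠ z in 𝓝 0, h z ∈ Complex.slitPlane :=
      hha.continuousAt.eventually_mem (Complex.isOpen_slitPlane.mem_nhds hslit)
    filter_upwards [this] with z hz
    rw [hu, ← Complex.exp_nat_mul]
    have : ((2 : ℕ) : ℂ) * (Complex.log (h z) / 2) = Complex.log (h z) := by push_cast; ring
    rw [this, Complex.exp_log (Complex.slitPlane_ne_zero hz)]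
  set P : ℂ → ℂ := fun z => z * u z with hP
  have hPa : AnalyticAt ℂ P 0 := by fun_prop
  have hu0 : u 0 = (Real.exp (Real.log b / 2) : ℝ) := by
    rw [hu]; simp only [hh0]; rw [← Complex.ofReal_log hb.le]; push_cast; rfl
  set c := Real.exp (Real.log b / 2) with hcdef
  have hcpos : 0 < c := Real.exp_pos _
  have hPd : deriv P 0 = c := by
    have := (hasDerivAt_id (0 : ℂ)).mul hua.differentiableAt.hasDerivAt
    have h' : HasDerivAt P (1 * u 0 + 0 * deriv u 0) 0 := this
    rw [h'.deriv, hu0]; simp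
  have hPd0 : deriv P 0 ≠ 0 := by rw [hPd]; exact_mod_cast hcpos.ne'
  have hP0 : P 0 = 0 := by simp [hP]
  set ψ := hPa.hasStrictDerivAt.localInverse _ _ _ hPd0 with hψ
  have hψa : AnalyticAt ℂ ψ 0 := by simpa [hP0] using hPa.analyticAt_localInverse hPd0
  have hψP : ∀ᶠ z in 𝓝 0, ψ (P z) = z :=
    HasStrictDerivAt.eventually_left_inverse hPa.hasStrictDerivAt hPd0
  have hPψ : ∀ᶠ z in 𝓝 0, P (ψ z) = z := by
    have := HasStrictDerivAt.eventually_right_inverse hPa.hasStrictDerivAt hPd0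
    rwa [hP0] at this
  have hψ0 : ψ 0 = 0 := by have := hψP.self_of_nhds; rwa [hP0] at this
  have hψd : deriv ψ 0 = ((c⁻¹ : ℝ) : ℂ) := by
    have := HasStrictDerivAt.to_localInverse hPa.hasStrictDerivAt hPd0
    rw [hP0] at this
    rw [hψ, this.hasDerivAt.deriv, hPd]; push_cast; rfl
  have hreal : Tendsto (fun t : ℝ => (t : ℂ)) (𝓝 0) (𝓝 0) := by
    simpa using Complex.continuous_ofReal.tendsto 0
  have hPreal : ∀ᶠ t : ℝ in 𝓝 0, (P t).im = 0 := by
    have hre : ∀ᶠ z in 𝓝 0, 0 < (h z).re :=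
      (Complex.continuous_re.continuousAt.comp hha.continuousAt).eventually_const_lt
        (by simpa [hh0] using hb)
    filter_upwards [hc, hreal.eventually hfg', hreal.eventually hre] with t h3 h4 h5
    rcases eq_or_ne t 0 with rfl | ht
    · simp [hP0]
    · have him : (h t).im = 0 := by
        have h6 := congrArg Complex.im h4
        rw [← Complex.ofReal_pow, show (-2 : ℂ) = ((-2 : ℝ) : ℂ) by norm_num, Complex.im_ofReal_mul, h3, mul_zero,
          Complex.im_ofReal_mul] at h6
        exact (mul_eq_zero.1 h6.symm).resolve_left (pow_ne_zero 2 ht)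
      have hhr : h t = ((h t).re : ℂ) := Complex.ext (by simp) (by simpa using him)
      have hur : u t = (Real.exp (Real.log (h t).re / 2) : ℝ) := by
        simp only [hu]; rw [hhr, ← Complex.ofReal_log h5.le]; push_cast; rfl
      rw [hP]; simp only [hur, ← Complex.ofReal_mul, Complex.ofReal_im]
  -- `P` is real on the real line, so the real inverse function theorem provides a real preimage of
  -- each small real `t`, and `ψ` must return it.
  have hψreal : ∀ᶠ t : ℝ in 𝓝 0, (ψ t).im = 0 := by
    have hs : HasStrictDerivAt (fun t : ℝ => (P t).re) c 0 := by
      have := hPa.hasStrictDerivAt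
      rw [hPd] at this
      have h' : HasStrictDerivAt P (c : ℂ) ((0 : ℝ) : ℂ) := by simpa using this
      simpa using h'.real_of_complex
    have e1 := HasStrictDerivAt.eventually_right_inverse hs hcpos.ne'
    have e2 : Tendsto (hs.localInverse _ _ _ hcpos.ne') (𝓝 0) (𝓝 0) := by
      have e3 := (HasStrictDerivAt.to_localInverse hs hcpos.ne').hasDerivAt.continuousAt
      have e4 := (HasStrictDerivAt.eventually_left_inverse hs hcpos.ne').self_of_nhds
      have e5 : (P ((0 : ℝ) : ℂ)).re = 0 := by simp [hP0]
      rw [ContinuousAt, e4] at e3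
      rwa [e5] at e3
    simp only [Complex.ofReal_zero, hP0, Complex.zero_re] at e1
    filter_upwards [e1, e2.eventually hPreal, e2.eventually (hreal.eventually hψP)] with t h3 h4 h5
    have h6 : P (hs.localInverse _ _ _ hcpos.ne' t : ℝ) = t := Complex.ext (by simpa using h3) (by simpa using h4)
    rw [h6] at h5
    rw [h5, Complex.ofReal_im]
  refine ⟨ψ, P, hψa, hPa, hψ0, hP0, ?_, hψP, hPψ, hψreal, ?_⟩
  · filter_upwards [hu2, hfg'] with z h3 h4
    rw [h4]; simp only [hP]; rw [mul_pow, h3]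
  · rw [hψd, Complex.ofReal_re]; exact inv_pos.2 hcpos

namespace IsMorseChart

variable {f ψ P : ℂ → ℂ}

theorem tendsto_inv (h : IsMorseChart f ψ P) : Tendsto ψ (𝓝 0) (𝓝 0) := by
  have := h.analyticAt_inv.continuousAt.tendsto; rwa [h.inv_zero] at this

theorem apply_inv (h : IsMorseChart f ψ P) : ∀ᶠ z in 𝓝 0, f (ψ z) = -z ^ 2 / 2 := by
  filter_upwards [h.coord_inv, h.tendsto_inv.eventually h.coord_sq] with z h1 h2
  rw [h1] at h2
  linear_combination (1 / 2 : ℂ) * h2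

/-- The equation `f(ψ(z)) = -z²/2` becomes one between Taylor series over `ℂ` and descends to the
real coefficients. -/
theorem isLocalSolution (h : IsMorseChart f ψ P) (hf : AnalyticAt ℂ f 0)
    (hc : ∀ᶠ t : ℝ in 𝓝 0, (f t).im = 0) : IsLocalSolution (maclaurin f) (maclaurin ψ) := by
  have hc0 : PowerSeries.constantCoeff (maclaurin ψ) = 0 := by
    rw [← PowerSeries.coeff_zero_eq_constantCoeff_apply, coeff_maclaurin]; simp [h.inv_zero]
  refine ⟨hc0, ?_, ?_⟩
  · rw [coeff_maclaurin]; simpa using h.deriv_pos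
  · have hs : PowerSeries.HasSubst (maclaurin ψ) := PowerSeries.HasSubst.of_constantCoeff_zero' hc0
    apply PowerSeries.map_injective Complex.ofRealHom Complex.ofReal_injective
    have h3 := PowerSeries.map_subst hs (h := Complex.ofRealHom) (maclaurin f)
    have h4 : PowerSeries.map Complex.ofRealHom (PowerSeries.subst (maclaurin ψ) (maclaurin f)) = _ := h3
    rw [h4]
    change PowerSeries.subst (PowerSeries.map Complex.ofRealHom (maclaurin ψ)) _ = _
    rw [map_maclaurin hf hc, map_maclaurin h.analyticAt_inv h.im_inv,
      ← taylor_comp hf h.analyticAt_inv h.inv_zero]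
    have h5 : (fun z => f (ψ z)) =ᶠ[𝓝 0] fun z => (-(1 / 2 : ℝ) : ℂ) * z ^ 2 := by
      filter_upwards [h.apply_inv] with z hz
      rw [hz]; push_cast; ring
    rw [taylor_congr h5, taylor_mul (by fun_prop) (by fun_prop), taylor_const, taylor_pow (by fun_prop),
      taylor_id]
    simp

/-- The coefficients of the formal integral in terms of the inverse Morse coordinate. -/
theorem coeff_formalIntegral_maclaurin (h : IsMorseChart f ψ P) {b : ℝ} (hf : AnalyticAt ℂ f 0)
    (hc : ∀ᶠ t : ℝ in 𝓝 0, (f t).im = 0) (h0 : f 0 = 0) (h1 : deriv f 0 = 0)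
    (h2 : iteratedDeriv 2 f 0 = -b) (hb : 0 < b) (m : ℕ) :
    PowerSeries.coeff m (formalIntegral (maclaurin f)) =
      ((2 * m + 1)‼ : ℝ) * PowerSeries.coeff (2 * m + 1) (maclaurin ψ) := by
  refine coeff_formalIntegral _ _ ?_ ?_ ?_ (h.isLocalSolution hf hc) m
  · rw [coeff_maclaurin]; simp [h0]
  · rw [coeff_maclaurin]; simp [h1]
  · rw [coeff_maclaurin, h2, ← Complex.ofReal_neg, Complex.ofReal_re]
    exact div_neg_of_neg_of_pos (by linarith) (by positivity)

end IsMorseChart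

/-! ### The local solution as an analytic function -/

/-- An entire action that is real on the real line, with `S = -x²/2 + O(x³)`. -/
structure IsAction (S : ℂ → ℂ) : Prop where
  differentiable : Differentiable ℂ S
  im_eq_zero : ∀ t : ℝ, (S t).im = 0
  map_zero : S 0 = 0
  deriv_zero : deriv S 0 = 0
  deriv2_zero : iteratedDeriv 2 S 0 = -1

/-- The sum of the local solution `x(y)`. -/
def sol (S : ℂ → ℂ) : ℂ → ℂ := evalSeries (localSolution (maclaurin S))

/-- The disc of convergence of the local solution. -/
def solDisc (S : ℂ → ℂ) : Set ℂ := convergenceDisc (localSolution (maclaurin S))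

theorem sum_complexSeries (x : PowerSeries ℝ) : (complexSeries x).sum = evalSeries x := by
  funext y
  rw [complexSeries, evalSeries, FormalMultilinearSeries.sum]
  refine tsum_congr fun n => ?_
  rw [FormalMultilinearSeries.ofScalars_apply_eq, smul_eq_mul]

theorem evalSeries_zero (x : PowerSeries ℝ) : evalSeries x 0 = PowerSeries.constantCoeff x := by
  rw [evalSeries, tsum_eq_single 0]
  · simp
  · intro n hn; simp [hn]

theorem evalSeries_conj (x : PowerSeries ℝ) (y : ℂ) :
    evalSeries x (starRingEnd ℂ y) = starRingEnd ℂ (evalSeries x y) := by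
  rw [evalSeries, evalSeries, Complex.conj_tsum]
  refine tsum_congr fun n => ?_
  simp

theorem isOpen_solDisc (S : ℂ → ℂ) : IsOpen (solDisc S) := Metric.isOpen_eball

theorem convex_solDisc (S : ℂ → ℂ) : Convex ℝ (solDisc S) := by
  rw [solDisc, convergenceDisc]
  exact convex_eball _ _

theorem neg_mem_solDisc {S : ℂ → ℂ} {y : ℂ} (hy : y ∈ solDisc S) : -y ∈ solDisc S := by
  rw [solDisc, convergenceDisc, Metric.mem_eball] at *
  simpa [edist_zero_right] using hy

theorem conj_mem_solDisc {S : ℂ → ℂ} {y : ℂ} (hy : y ∈ solDisc S) :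
    starRingEnd ℂ y ∈ solDisc S := by
  rw [solDisc, convergenceDisc, Metric.mem_eball] at *
  rw [edist_zero_right] at *
  rwa [← ofReal_norm, Complex.norm_conj, ofReal_norm]

theorem sol_conj (S : ℂ → ℂ) (y : ℂ) : sol S (starRingEnd ℂ y) = starRingEnd ℂ (sol S y) :=
  evalSeries_conj _ y

theorem sol_ofReal_im (S : ℂ → ℂ) (t : ℝ) : (sol S t).im = 0 := by
  have := sol_conj S t
  rw [Complex.conj_ofReal] at this
  exact Complex.conj_eq_iff_im.1 this.symm

namespace IsAction

variable {S : ℂ → ℂ}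

theorem coeff_zero (h : IsAction S) : PowerSeries.coeff 0 (maclaurin S) = 0 := by
  rw [coeff_maclaurin]; simp [h.map_zero]

theorem coeff_one (h : IsAction S) : PowerSeries.coeff 1 (maclaurin S) = 0 := by
  rw [coeff_maclaurin]; simp [h.deriv_zero]

theorem coeff_two (h : IsAction S) : PowerSeries.coeff 2 (maclaurin S) = -1 / 2 := by
  rw [coeff_maclaurin, h.deriv2_zero]; simp

theorem exists_chart (h : IsAction S) : ∃ ψ P : ℂ → ℂ, IsMorseChart S ψ P :=
  exists_isMorseChart (b := 1) (h.differentiable.analyticAt 0)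
    (Eventually.of_forall h.im_eq_zero) h.map_zero h.deriv_zero
    (by rw [h.deriv2_zero]; simp) one_pos

theorem localSolution_eq (h : IsAction S) {ψ P : ℂ → ℂ} (hc : IsMorseChart S ψ P) :
    localSolution (maclaurin S) = maclaurin ψ :=
  (existsUnique_isLocalSolution _ h.coeff_zero h.coeff_one h.coeff_two).unique
    (isLocalSolution_localSolution _ h.coeff_zero h.coeff_one h.coeff_two)
    (hc.isLocalSolution (h.differentiable.analyticAt 0) (Eventually.of_forall h.im_eq_zero))

theorem isLocalSolution (h : IsAction S) :
    IsLocalSolution (maclaurin S) (localSolution (maclaurin S)) :=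
  isLocalSolution_localSolution _ h.coeff_zero h.coeff_one h.coeff_two

end IsAction

theorem hasFPowerSeriesAt_complexSeries {ψ : ℂ → ℂ} (hψ : AnalyticAt ℂ ψ 0)
    (hr : ∀ᶠ t : ℝ in 𝓝 0, (ψ t).im = 0) : HasFPowerSeriesAt ψ (complexSeries (maclaurin ψ)) 0 := by
  have h1 := hψ.hasFPowerSeriesAt
  have h2 : (fun n => iteratedDeriv n ψ 0 / (n ! : ℂ)) =
      fun n => ((PowerSeries.coeff n (maclaurin ψ) : ℝ) : ℂ) := by
    funext n
    rw [← coeff_taylor, ← map_maclaurin hψ hr, PowerSeries.coeff_map]; rfl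
  rw [h2] at h1
  exact h1

namespace IsAction

variable {S : ℂ → ℂ}

/-- By uniqueness the formal solution is the Taylor series of an analytic inverse Morse coordinate,
hence converges. -/
theorem radius_pos (h : IsAction S) : 0 < convergenceRadius (localSolution (maclaurin S)) := by
  obtain ⟨ψ, P, hc⟩ := h.exists_chart
  rw [h.localSolution_eq hc]
  exact (hasFPowerSeriesAt_complexSeries hc.analyticAt_inv hc.im_inv).radius_pos

theorem hasFPowerSeriesOnBall_sol (h : IsAction S) :
    HasFPowerSeriesOnBall (sol S) (complexSeries (localSolution (maclaurin S))) 0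
      (convergenceRadius (localSolution (maclaurin S))) := by
  have := (complexSeries (localSolution (maclaurin S))).hasFPowerSeriesOnBall h.radius_pos
  rwa [sum_complexSeries] at this

theorem sol_eventuallyEq (h : IsAction S) {ψ P : ℂ → ℂ} (hc : IsMorseChart S ψ P) :
    sol S =ᶠ[𝓝 0] ψ := by
  have h1 := hasFPowerSeriesAt_complexSeries hc.analyticAt_inv hc.im_inv
  have h2 := h.hasFPowerSeriesOnBall_sol.hasFPowerSeriesAt
  rw [h.localSolution_eq hc] at h2
  have h3 := h2.sub h1
  rw [sub_self] at h3
  filter_upwards [h3.eventually_eq_zero] with z hz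
  exact sub_eq_zero.1 hz

theorem zero_mem_solDisc (h : IsAction S) : (0 : ℂ) ∈ solDisc S :=
  Metric.mem_eball_self h.radius_pos

theorem analyticOnNhd_sol (h : IsAction S) : AnalyticOnNhd ℂ (sol S) (solDisc S) :=
  h.hasFPowerSeriesOnBall_sol.analyticOnNhd

/-- It holds near `0`, where `sol S` is the inverse Morse coordinate, and spreads over the disc by
the identity theorem. -/
theorem apply_sol (h : IsAction S) {y : ℂ} (hy : y ∈ solDisc S) : S (sol S y) = -y ^ 2 / 2 := by
  obtain ⟨ψ, P, hc⟩ := h.exists_chart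
  have h1 : AnalyticOnNhd ℂ (fun y => S (sol S y)) (solDisc S) := fun y hy =>
    (h.differentiable.analyticAt _).comp (h.analyticOnNhd_sol y hy)
  have h2 : AnalyticOnNhd ℂ (fun y : ℂ => -y ^ 2 / 2) (solDisc S) := fun y _ => by fun_prop
  refine h1.eqOn_of_preconnected_of_eventuallyEq h2 (convex_solDisc S).isPreconnected
    h.zero_mem_solDisc ?_ hy
  filter_upwards [h.sol_eventuallyEq hc, hc.apply_inv] with z h3 h4
  rw [h3, h4]

theorem sol_zero (h : IsAction S) : sol S 0 = 0 := by
  rw [sol, evalSeries_zero, h.isLocalSolution.1]; simp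

theorem deriv_sol_zero_re (h : IsAction S) : 0 < (deriv (sol S) 0).re := by
  obtain ⟨ψ, P, hc⟩ := h.exists_chart
  rw [(h.sol_eventuallyEq hc).deriv_eq]
  exact hc.deriv_pos

theorem hasDerivAt_sol (h : IsAction S) {y : ℂ} (hy : y ∈ solDisc S) :
    HasDerivAt (sol S) (deriv (sol S) y) y :=
  (h.analyticOnNhd_sol y hy).differentiableAt.hasDerivAt

theorem deriv_mul_deriv_sol (h : IsAction S) {y : ℂ} (hy : y ∈ solDisc S) :
    deriv S (sol S y) * deriv (sol S) y = -y := by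
  have h1 : HasDerivAt (fun y => S (sol S y)) (deriv S (sol S y) * deriv (sol S) y) y :=
    (h.differentiable _).hasDerivAt.comp y (h.hasDerivAt_sol hy)
  have h2 : HasDerivAt (fun y : ℂ => -y ^ 2 / 2) (-y) y := by
    have := (((hasDerivAt_id y).pow 2).neg.div_const 2)
    refine (this.congr_deriv ?_)
    simp
    ring
  refine h1.unique (h2.congr_of_eventuallyEq ?_)
  filter_upwards [(isOpen_solDisc S).mem_nhds hy] with z hz using h.apply_sol hz

/-- Away from `0` this follows from `S'(x) x' = -y`; at `0` from `x'(0) > 0`. -/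
theorem deriv_sol_ne_zero (h : IsAction S) {y : ℂ} (hy : y ∈ solDisc S) : deriv (sol S) y ≠ 0 := by
  intro h0
  have h1 := h.deriv_mul_deriv_sol hy
  rw [h0, mul_zero] at h1
  have h2 : y = 0 := by simpa using h1.symm
  have := h.deriv_sol_zero_re
  rw [← h2, h0] at this
  simp at this

theorem deriv_apply_sol_ne_zero (h : IsAction S) {y : ℂ} (hy : y ∈ solDisc S) (h0 : y ≠ 0) :
    deriv S (sol S y) ≠ 0 := by
  intro h1
  have h2 := h.deriv_mul_deriv_sol hy
  rw [h1, zero_mul] at h2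
  exact h0 (by simpa using h2.symm)

/-- Equal values force `w = ±y`. If `x(y) = x(-y)` with `y ≠ 0`, local injectivity of `S` gives
`x(z) = x(-z)` near `y`, so `x` is even on the disc, contradicting `x'(0) > 0`. -/
theorem injOn_sol (h : IsAction S) : Set.InjOn (sol S) (solDisc S) := by
  intro y hy w hw hyw
  have h1 := h.apply_sol hy
  rw [hyw, h.apply_sol hw] at h1
  rcases eq_or_eq_neg_of_sq_eq_sq y w (by linear_combination (-2 : ℂ) * h1.symm) with h2 | h2
  · exact h2
  by_cases hy0 : y = 0
  · rw [hy0] at h2 ⊢; rw [neg_eq_zero.1 h2.symm]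
  exfalso
  have hw' : w = -y := by rw [h2, neg_neg]
  rw [hw'] at hyw
  have hneg : AnalyticOnNhd ℂ (fun y => sol S (-y)) (solDisc S) := fun z hz =>
    (h.analyticOnNhd_sol (-z) (neg_mem_solDisc hz)).comp analyticAt_id.neg
  have hSa := h.differentiable.analyticAt (sol S y)
  have hloc := HasStrictDerivAt.eventually_left_inverse hSa.hasStrictDerivAt
    (h.deriv_apply_sol_ne_zero hy hy0)
  have e1 := (h.analyticOnNhd_sol y hy).continuousAt.eventually hloc
  have hc2 : Tendsto (fun y => sol S (-y)) (𝓝 y) (𝓝 (sol S y)) := by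
    have := (hneg y hy).continuousAt.tendsto
    simpa only [← hyw] using this
  have e2 := hc2.eventually hloc
  have hD := (isOpen_solDisc S).mem_nhds hy
  have heq : sol S =ᶠ[𝓝 y] fun y => sol S (-y) := by
    filter_upwards [e1, e2, hD] with z h3 h4 h5
    rw [← h3, ← h4, h.apply_sol h5, h.apply_sol (neg_mem_solDisc h5)]
    simp
  have hall := h.analyticOnNhd_sol.eqOn_of_preconnected_of_eventuallyEq hneg
    (convex_solDisc S).isPreconnected hy heq
  have h6 : sol S =ᶠ[𝓝 0] fun y => sol S (-y) := by
    filter_upwards [(isOpen_solDisc S).mem_nhds h.zero_mem_solDisc] with z hz using hall hz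
  have h7 := h6.deriv_eq
  rw [deriv_comp_neg, neg_zero] at h7
  have h8 := h.deriv_sol_zero_re
  have h9 := congrArg Complex.re h7
  rw [Complex.neg_re] at h9
  linarith

theorem coeff_formalIntegral_eq (h : IsAction S) (m : ℕ) :
    PowerSeries.coeff m (formalIntegral (maclaurin S)) =
      ((2 * m + 1)‼ : ℝ) * PowerSeries.coeff (2 * m + 1) (localSolution (maclaurin S)) :=
  coeff_formalIntegral _ _ h.coeff_zero h.coeff_one (by rw [h.coeff_two]; norm_num)
    h.isLocalSolution m

end IsAction

/-! ### No singularity of square-root type on the imaginary axis -/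

theorem im_deriv_eq_zero {f : ℂ → ℂ} {t : ℝ} (hf : DifferentiableAt ℂ f t)
    (h : ∀ s : ℝ, (f s).im = 0) : (deriv f t).im = 0 := by
  have h3 := Complex.imCLM.hasFDerivAt.comp_hasDerivAt t hf.hasDerivAt.comp_ofReal
  have h5 : HasDerivAt (fun s : ℝ => (f s).im) 0 t :=
    (hasDerivAt_const t 0).congr_of_eventuallyEq (Eventually.of_forall h)
  exact h3.unique h5

theorem le_of_tendsto_of_hasDerivAt_nonneg {f f' : ℝ → ℝ} {a b A B : ℝ} (hab : a < b)
    (hf : ∀ t ∈ Set.Ioo a b, HasDerivAt f (f' t) t) (hf' : ∀ t ∈ Set.Ioo a b, 0 ≤ f' t)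
    (hA : Tendsto f (𝓝[>] a) (𝓝 A)) (hB : Tendsto f (𝓝[<] b) (𝓝 B)) : A ≤ B := by
  have hmono : MonotoneOn f (Set.Ioo a b) := by
    refine monotoneOn_of_deriv_nonneg (convex_Ioo a b)
      (fun t ht => (hf t ht).continuousAt.continuousWithinAt) ?_ ?_
    · rw [interior_Ioo]; exact fun t ht => (hf t ht).differentiableAt.differentiableWithinAt
    · rw [interior_Ioo]; intro t ht; rw [(hf t ht).deriv]; exact hf' t ht
  obtain ⟨c, hc⟩ := exists_between hab
  have h1 : A ≤ f c := by
    refine le_of_tendsto hA ?_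
    filter_upwards [Ioo_mem_nhdsGT hc.1] with t ht
    exact hmono ⟨ht.1, ht.2.trans hc.2⟩ hc ht.2.le
  have h2 : f c ≤ B := by
    refine ge_of_tendsto hB ?_
    filter_upwards [Ioo_mem_nhdsLT hc.2] with t ht
    exact hmono hc ⟨hc.1.trans ht.1, ht.2⟩ ht.1.le
  exact h1.trans h2

/-- Approached from above, the argument does not jump at the negative axis. -/
theorem continuousWithinAt_arg_upper {z : ℂ} (hz : z ≠ 0) :
    ContinuousWithinAt Complex.arg {w : ℂ | 0 ≤ w.im} z := by
  by_cases h : z ∈ Complex.slitPlane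
  · exact (Complex.continuousAt_arg h).continuousWithinAt
  · rw [Complex.mem_slitPlane_iff, not_or, not_not, not_lt] at h
    refine Complex.continuousWithinAt_arg_of_re_neg_of_im_zero (lt_of_le_of_ne h.1 ?_) h.2
    intro h0
    exact hz (Complex.ext h0 h.2)

/-- A curve in the upper half plane that joins two real points on either side of `c` cannot be
mapped into `[0, ∞)` by an entire function that is real on the real line and negative at `c`. -/
theorem not_nonneg_along_upper_curve {S : ℂ → ℂ} (hS : Differentiable ℂ S)
    (hreal : ∀ t : ℝ, (S t).im = 0) {γ γ' : ℝ → ℂ} {r c x₀ x₁ : ℝ} (hr : 0 < r)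
    (hγ : ∀ t ∈ Set.Ioo 0 r, HasDerivAt γ (γ' t) t) (him : ∀ t ∈ Set.Ioo 0 r, 0 < (γ t).im)
    (hSγ : ∀ t ∈ Set.Ioo 0 r, S (γ t) = ((t ^ 2 / 2 : ℝ) : ℂ))
    (h0 : Tendsto γ (𝓝[>] 0) (𝓝 x₀)) (h1 : Tendsto γ (𝓝[<] r) (𝓝 x₁))
    (hc : (x₀ - c) * (x₁ - c) < 0) : 0 ≤ (S c).re := by
  by_contra! hneg
  -- Only `exp (-l S(c)) > 1` matters below, so the value `3` is a convenient normalisation.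
  obtain ⟨l, hl, hlS⟩ : ∃ l : ℝ, 0 < l ∧ -l * (S c).re = 3 :=
    ⟨3 / -(S c).re, div_pos (by norm_num) (by linarith), by field_simp [hneg.ne]⟩
  set F : ℂ → ℂ := fun z => Complex.exp (-(l : ℂ) * S z) with hF
  have hFd : Differentiable ℂ F := (hS.const_mul _).cexp
  have hFreal : ∀ t : ℝ, F t = (Real.exp (-l * (S t).re) : ℝ) := by
    intro t
    have : S t = ((S t).re : ℂ) := Complex.ext (by simp) (by simpa using hreal t)
    simp only [hF]
    rw [this]; push_cast; rfl
  have hFim : ∀ t : ℝ, (F t).im = 0 := fun t => by rw [hFreal, Complex.ofReal_im]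
  have hFc : F c = (Real.exp 3 : ℝ) := by rw [hFreal, hlS]
  set E := Real.exp 3 with hE
  -- The entire function `(F(z) - F(c)) / (z - c)`. Its primitive `H` makes its integral along the
  -- curve depend on the endpoints only.
  set G := dslope F c with hG
  have hGd : Differentiable ℂ G := by
    have := (Complex.differentiableOn_dslope (s := Set.univ) (c := (c : ℂ)) (f := F) univ_mem).2 hFd.differentiableOn
    exact differentiableOn_univ.1 this
  obtain ⟨H, hH⟩ := hGd.isExactOn_univ
  have hH : ∀ z, HasDerivAt H (G z) z := fun z => hH z (Set.mem_univ z)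
  have hGim : ∀ t : ℝ, (G t).im = 0 := by
    intro t
    rcases eq_or_ne t c with rfl | htc
    · rw [hG, dslope_same]; exact im_deriv_eq_zero (hFd _) hFim
    · rw [hG, dslope_of_ne _ (by exact_mod_cast htc), slope_def_field, hFreal, hFreal,
        ← Complex.ofReal_sub, ← Complex.ofReal_sub, ← Complex.ofReal_div, Complex.ofReal_im]
  -- `G` is real on the real line, so comparison with the real segment shows that the integral along
  -- the curve has no imaginary part.
  have hHim : (H x₁).im = (H x₀).im := by
    have hd : ∀ t : ℝ, HasDerivAt (fun s : ℝ => (H s).im) 0 t := by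
      intro t
      have := Complex.imCLM.hasFDerivAt.comp_hasDerivAt t (hH t).comp_ofReal
      rw [Complex.imCLM_apply, hGim] at this
      exact this
    exact is_const_of_deriv_eq_zero (fun t => (hd t).differentiableAt) (fun t => (hd t).deriv) x₁ x₀
  -- The angle seen from `c`; it stays in `[0, π]` and runs between `0` and `π`, as the endpoints
  -- lie on either side of `c`.
  set α : ℝ → ℝ := fun t => (γ t - c).arg with hα
  have hmem : ∀ t ∈ Set.Ioo 0 r, 0 < (γ t - c).im := fun t ht => by
    simpa using him t ht
  have hαd : ∀ t ∈ Set.Ioo 0 r, HasDerivAt α (γ' t / (γ t - c)).im t := by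
    intro t ht
    have hsl : γ t - c ∈ Complex.slitPlane := Complex.mem_slitPlane_iff.2 (Or.inr (hmem t ht).ne')
    have := ((hγ t ht).sub_const (c : ℂ)).clog_real hsl
    have := Complex.imCLM.hasFDerivAt.comp_hasDerivAt t this
    exact this.congr_of_eventuallyEq (Eventually.of_forall fun s => (Complex.log_im _).symm)
  have hα0 : ∀ t ∈ Set.Ioo 0 r, 0 ≤ α t := fun t ht => Complex.arg_nonneg_iff.2 (hmem t ht).le
  have hαπ : ∀ t, α t ≤ Real.pi := fun t => Complex.arg_le_pi _
  have hαlim : ∀ {l : Filter ℝ} {x : ℝ}, (∀ᶠ t in l, t ∈ Set.Ioo 0 r) → Tendsto γ l (𝓝 x) → x - c ≠ 0 →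
      Tendsto α l (𝓝 (Complex.arg ((x - c : ℝ) : ℂ))) := by
    intro l x hl hx hxc
    have h2 := continuousWithinAt_arg_upper (z := ((x - c : ℝ) : ℂ)) (by exact_mod_cast hxc)
    refine h2.tendsto.comp (tendsto_nhdsWithin_iff.2 ⟨?_, ?_⟩)
    · push_cast; exact hx.sub_const _
    · filter_upwards [hl] with t ht using (hmem t ht).le
  have hl0 : ∀ᶠ t in 𝓝[>] (0 : ℝ), t ∈ Set.Ioo 0 r := Ioo_mem_nhdsGT hr
  have hlr : ∀ᶠ t in 𝓝[<] r, t ∈ Set.Ioo 0 r := Ioo_mem_nhdsLT hr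
  have hne0 : x₀ - c ≠ 0 := fun h => by rw [h, zero_mul] at hc; exact lt_irrefl _ hc
  have hne1 : x₁ - c ≠ 0 := fun h => by rw [h, mul_zero] at hc; exact lt_irrefl _ hc
  have hα0lim := hαlim hl0 h0 hne0
  have hα1lim := hαlim hlr h1 hne1
  set a₀ := Complex.arg ((x₀ - c : ℝ) : ℂ) with ha₀
  set a₁ := Complex.arg ((x₁ - c : ℝ) : ℂ) with ha₁
  have hcases : (a₀ = 0 ∧ a₁ = Real.pi) ∨ (a₀ = Real.pi ∧ a₁ = 0) := by
    rcases mul_neg_iff.1 hc with ⟨h2, h3⟩ | ⟨h2, h3⟩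
    · exact Or.inl ⟨Complex.arg_ofReal_of_nonneg h2.le, Complex.arg_ofReal_of_neg h3⟩
    · exact Or.inr ⟨Complex.arg_ofReal_of_neg h2, Complex.arg_ofReal_of_nonneg h3.le⟩
  set e : ℝ → ℝ := fun t => Real.exp (-l * (t ^ 2 / 2)) with he
  have hed : ∀ t, HasDerivAt e (e t * (-l * t)) t := by
    intro t
    have : HasDerivAt (fun t : ℝ => -l * (t ^ 2 / 2)) (-l * t) t := by
      have := (((hasDerivAt_id t).pow 2).div_const 2).const_mul (-l)
      refine this.congr_deriv ?_
      simp
    exact this.exp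
  have hec : Continuous e := by simp only [he]; fun_prop
  -- On the curve `d(Im H) = (e - E) dα`; integrating `e dα` by parts leaves `dΨ = -e' α dt = l t e
  -- α dt`, which has a sign.
  set Ψ : ℝ → ℝ := fun t => (H (γ t)).im + E * α t - e t * α t with hΨ
  have hΨd : ∀ t ∈ Set.Ioo 0 r, HasDerivAt Ψ (l * t * e t * α t) t := by
    intro t ht
    have d1 : HasDerivAt (fun t => (H (γ t)).im) (G (γ t) * γ' t).im t :=
      Complex.imCLM.hasFDerivAt.comp_hasDerivAt t ((hH (γ t)).comp_of_eq t (hγ t ht) rfl)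
    have d2 := (d1.add ((hαd t ht).const_mul E)).sub ((hed t).mul (hαd t ht))
    refine d2.congr_deriv ?_
    have hne : γ t - c ≠ 0 := fun h => by have := hmem t ht; rw [h] at this; simp at this
    have hne' : γ t ≠ c := sub_ne_zero.1 hne
    have hGγ : G (γ t) * γ' t = ((e t : ℝ) : ℂ) * (γ' t / (γ t - c)) - (E : ℂ) * (γ' t / (γ t - c)) := by
      have hFγ : F (γ t) = ((e t : ℝ) : ℂ) := by
        simp only [hF, he]; rw [hSγ t ht]; push_cast; rfl
      rw [hG, dslope_of_ne _ hne', slope_def_field, hFγ, hFc]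
      field_simp
    rw [hGγ, Complex.sub_im, Complex.im_ofReal_mul, Complex.im_ofReal_mul]
    ring
  have hHlim : ∀ {l : Filter ℝ} {x : ℝ}, Tendsto γ l (𝓝 x) →
      Tendsto (fun t => (H (γ t)).im) l (𝓝 (H x).im) := fun hx =>
    (Complex.continuous_im.tendsto _).comp ((hH _).continuousAt.tendsto.comp hx)
  have hΨ0 : Tendsto Ψ (𝓝[>] 0) (𝓝 ((H x₀).im + E * a₀ - e 0 * a₀)) :=
    ((hHlim h0).add (hα0lim.const_mul E)).sub
      (((hec.tendsto 0).mono_left nhdsWithin_le_nhds).mul hα0lim)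
  have hΨ1 : Tendsto Ψ (𝓝[<] r) (𝓝 ((H x₁).im + E * a₁ - e r * a₁)) :=
    ((hHlim h1).add (hα1lim.const_mul E)).sub
      (((hec.tendsto r).mono_left nhdsWithin_le_nhds).mul hα1lim)
  have he0 : e 0 = 1 := by simp [he]
  have hepos : ∀ t, 0 < e t := fun t => Real.exp_pos _
  have her : e r ≤ 1 := by
    simp only [he]; rw [Real.exp_le_one_iff]; nlinarith [sq_nonneg r]
  -- The bounds `0 ≤ α` and `α ≤ π` make `Ψ` and `-π e - Ψ` nondecreasing. According to the
  -- direction of the curve, one of the two resulting inequalities says `E ≤ 1`.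
  have k1 := le_of_tendsto_of_hasDerivAt_nonneg hr hΨd
    (fun t ht => mul_nonneg (mul_nonneg (mul_nonneg hl.le ht.1.le) (hepos t).le) (hα0 t ht)) hΨ0 hΨ1
  have k2 := le_of_tendsto_of_hasDerivAt_nonneg (f := fun t => -Real.pi * e t - Ψ t) hr
    (fun t ht => ((hed t).const_mul (-Real.pi)).sub (hΨd t ht))
    (fun t ht => by
      have : 0 ≤ l * t * e t * (Real.pi - α t) :=
        mul_nonneg (mul_nonneg (mul_nonneg hl.le ht.1.le) (hepos t).le) (sub_nonneg.2 (hαπ t))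
      linarith)
    ((((hec.tendsto 0).mono_left nhdsWithin_le_nhds).const_mul (-Real.pi)).sub hΨ0)
    ((((hec.tendsto r).mono_left nhdsWithin_le_nhds).const_mul (-Real.pi)).sub hΨ1)
  rw [hHim, he0] at *
  have hEbig : 4 ≤ E := by have := Real.add_one_le_exp (3 : ℝ); linarith
  have hpi := Real.pi_pos
  have := hepos r
  rcases hcases with ⟨h2, h3⟩ | ⟨h2, h3⟩
  · rw [h2, h3] at k1 k2; nlinarith
  · rw [h2, h3] at k1 k2; nlinarith

/-! ### Singularities of square-root type -/

theorem ofReal_re_sol (S : ℂ → ℂ) (t : ℝ) : ((sol S t).re : ℂ) = sol S t :=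
  Complex.ext (by simp) (by rw [Complex.ofReal_im, sol_ofReal_im])

theorem solDisc_eq_ball {S : ℂ → ℂ} {r : ℝ}
    (hr : ENNReal.ofReal r = convergenceRadius (localSolution (maclaurin S))) :
    solDisc S = Metric.ball 0 r := by
  rw [solDisc, convergenceDisc, ← hr, Metric.eball_ofReal]

theorem tendsto_mul_nhdsWithin_ball {r : ℝ} (hr : 0 < r) {u : ℂ} (hu : ‖u‖ = 1) :
    Tendsto (fun t : ℝ => u * t) (𝓝[<] r) (𝓝[Metric.ball 0 r] (u * r)) := by
  refine tendsto_nhdsWithin_iff.2 ⟨((by fun_prop : Continuous fun t : ℝ => u * t).tendsto r).mono_left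
    nhdsWithin_le_nhds, ?_⟩
  filter_upwards [Ioo_mem_nhdsLT hr] with t ht
  simpa [hu, abs_of_pos ht.1] using ht.2

namespace IsSquareRootSingularity

variable {S : ℂ → ℂ} {σ ρ : ℂ}

theorem radius_eq (hs : IsSquareRootSingularity S σ ρ) :
    ENNReal.ofReal ‖ρ‖ = convergenceRadius (localSolution (maclaurin S)) := hs.1.1

theorem tendsto_sol (hs : IsSquareRootSingularity S σ ρ) :
    Tendsto (sol S) (𝓝[Metric.ball 0 ‖ρ‖] ρ) (𝓝 σ) := by
  have := hs.2.1
  rwa [← solDisc, solDisc_eq_ball hs.radius_eq] at this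

theorem norm_pos (hs : IsSquareRootSingularity S σ ρ) (h : IsAction S) : 0 < ‖ρ‖ := by
  have := h.radius_pos
  rwa [← hs.radius_eq, ENNReal.ofReal_pos] at this

/-- If `S'(σ) ≠ 0`, a local inverse `L` of `S` at `σ` yields `y ↦ L(-y²/2)`, an analytic
continuation of `x(y)` to a neighbourhood of `ρ`. -/
theorem deriv_eq_zero (hs : IsSquareRootSingularity S σ ρ) (h : IsAction S) : deriv S σ = 0 := by
  by_contra hne
  have hSa := h.differentiable.analyticAt σ
  have hloc := HasStrictDerivAt.eventually_left_inverse hSa.hasStrictDerivAt hne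
  have hinv := hSa.analyticAt_localInverse hne
  set L := hSa.hasStrictDerivAt.localInverse _ _ _ hne
  apply hs.1.2
  refine ⟨fun y => L (-y ^ 2 / 2), ?_, ?_⟩
  · have : AnalyticAt ℂ L (-ρ ^ 2 / 2) := by
      rwa [show -ρ ^ 2 / 2 = S σ by linear_combination -hs.2.2.1]
    exact this.comp_of_eq (g := L) (f := fun y : ℂ => -y ^ 2 / 2) (by fun_prop) rfl
  · change _ =ᶠ[𝓝[solDisc S] ρ] sol S
    have h1 : ∀ᶠ y in 𝓝[solDisc S] ρ, L (S (sol S y)) = sol S y := hs.2.1.eventually hloc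
    filter_upwards [h1, self_mem_nhdsWithin] with y h2 h3
    rw [← h2, h.apply_sol h3]

end IsSquareRootSingularity

/-- A real value at `it` would equal the value at the conjugate `-it`, against injectivity. So the
imaginary part never vanishes on the segment, and `x'(0) > 0` decides its sign. -/
theorem IsAction.im_sol_I_mul_pos {S : ℂ → ℂ} (h : IsAction S) {r : ℝ}
    (hD : solDisc S = Metric.ball 0 r) : ∀ t ∈ Set.Ioo 0 r, 0 < (sol S (Complex.I * t)).im := by
  have hmem : ∀ t ∈ Set.Ico 0 r, Complex.I * (t : ℂ) ∈ solDisc S := by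
    intro t ht; rw [hD]; simpa [abs_of_nonneg ht.1] using ht.2
  have hne : ∀ t ∈ Set.Ioo 0 r, (sol S (Complex.I * t)).im ≠ 0 := by
    intro t ht h0
    have hy := hmem t ⟨ht.1.le, ht.2⟩
    have h1 := Complex.conj_eq_iff_im.2 h0
    rw [← sol_conj] at h1
    have h2 := h.injOn_sol (conj_mem_solDisc hy) hy h1
    have h3 := Complex.conj_eq_iff_im.1 h2
    simp at h3
    exact ht.1.ne' h3
  have hder : HasDerivAt (fun t : ℝ => (sol S (Complex.I * t)).im) (deriv (sol S) 0).re 0 := by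
    have h1 : HasDerivAt (fun t : ℝ => Complex.I * (t : ℂ)) Complex.I 0 := by
      simpa using (Complex.ofRealCLM.hasDerivAt (x := (0 : ℝ))).const_mul Complex.I
    have h2 := (h.hasDerivAt_sol h.zero_mem_solDisc).comp_of_eq (0 : ℝ) h1 (by simp)
    have h3 := Complex.imCLM.hasFDerivAt.comp_hasDerivAt (0 : ℝ) h2
    refine h3.congr_deriv ?_
    simp
  have hev : ∀ᶠ t : ℝ in 𝓝[>] 0, 0 < (sol S (Complex.I * t)).im := by
    have h1 := (hasDerivAt_iff_tendsto_slope.1 hder).mono_left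
      (nhdsWithin_mono 0 (fun t (ht : 0 < t) => ht.ne') : 𝓝[>] (0 : ℝ) ≤ _)
    filter_upwards [h1.eventually_const_lt h.deriv_sol_zero_re, self_mem_nhdsWithin] with t ht1 ht2
    rw [slope_def_field] at ht1
    simp only [Complex.ofReal_zero, mul_zero, h.sol_zero, Complex.zero_im, sub_zero] at ht1
    exact (div_pos_iff_of_pos_right ht2).1 ht1
  intro t ht
  by_contra! hle
  have hlt : (sol S (Complex.I * t)).im < 0 := lt_of_le_of_ne hle (hne t ht)
  obtain ⟨s, hs1, hs2⟩ := (hev.and (Ioo_mem_nhdsGT ht.1)).exists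
  have hcont : ContinuousOn (fun t : ℝ => (sol S (Complex.I * t)).im) (Set.Icc s t) := by
    intro v hv
    have hv' := hmem v ⟨hs2.1.le.trans hv.1, hv.2.trans_lt ht.2⟩
    have h1 : ContinuousAt (sol S) (Complex.I * v) := (h.analyticOnNhd_sol _ hv').continuousAt
    have h2 : ContinuousAt (fun t : ℝ => Complex.I * (t : ℂ)) v := by fun_prop
    exact (Complex.continuous_im.continuousAt.comp (h1.comp_of_eq h2 rfl)).continuousWithinAt
  obtain ⟨v, hv1, hv2⟩ := intermediate_value_Icc' hs2.2.le hcont ⟨hlt.le, hs1.le⟩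
  exact hne v ⟨hs2.1.trans_le hv1.1, hv1.2.trans_lt ht.2⟩ hv2

/-- Take `c = x(δτ)` with small `δ > 0`: it lies between `0` and `τ` because `x'(0) > 0`, and `S(c)
= -(δτ)²/2`. -/
theorem IsAction.exists_sol_between {S : ℂ → ℂ} (h : IsAction S) {τ : ℝ} (hτ : τ ≠ 0) :
    ∃ c : ℝ, (0 - c) * (τ - c) < 0 ∧ (S c).re < 0 := by
  have hder : HasDerivAt (fun t : ℝ => (sol S t).re) (deriv (sol S) 0).re 0 := by
    have := h.hasDerivAt_sol h.zero_mem_solDisc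
    have h' : HasDerivAt (sol S) (deriv (sol S) 0) ((0 : ℝ) : ℂ) := by simpa using this
    exact h'.real_of_complex
  have h1 := (hasDerivAt_iff_tendsto_slope.1 hder)
  have hf : Tendsto (fun δ : ℝ => δ * τ) (𝓝[>] 0) (𝓝[≠] 0) := by
    refine tendsto_nhdsWithin_iff.2 ⟨?_, ?_⟩
    · have : Tendsto (fun δ : ℝ => δ * τ) (𝓝 0) (𝓝 (0 * τ)) := (continuous_mul_const τ).tendsto 0
      rw [zero_mul] at this
      exact this.mono_left nhdsWithin_le_nhds
    · filter_upwards [self_mem_nhdsWithin] with δ hδ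
      exact mul_ne_zero (ne_of_gt hδ) hτ
  have h2 := (h1.comp hf).eventually_const_lt h.deriv_sol_zero_re
  have h3 : Tendsto (fun δ : ℝ => (sol S ((δ * τ : ℝ) : ℂ)).re) (𝓝[>] 0) (𝓝 0) := by
    have := hder.continuousAt.tendsto.comp (hf.mono_right nhdsWithin_le_nhds)
    simpa only [Function.comp_def, Complex.ofReal_zero, h.sol_zero, Complex.zero_re] using this
  have h4 := h3.eventually (Metric.ball_mem_nhds (0 : ℝ) (abs_pos.2 hτ))
  have h5 : ∀ᶠ δ : ℝ in 𝓝[>] 0, ((δ * τ : ℝ) : ℂ) ∈ solDisc S := by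
    have : Tendsto (fun δ : ℝ => ((δ * τ : ℝ) : ℂ)) (𝓝[>] 0) (𝓝 0) := by
      have := (Complex.continuous_ofReal.tendsto 0).comp (hf.mono_right nhdsWithin_le_nhds)
      simpa only [Function.comp_def, Complex.ofReal_zero] using this
    exact this.eventually ((isOpen_solDisc S).mem_nhds h.zero_mem_solDisc)
  obtain ⟨δ, h2, h4, h5, h6⟩ := (h2.and (h4.and (h5.and self_mem_nhdsWithin))).exists
  have h6 : 0 < δ := h6
  set c := (sol S ((δ * τ : ℝ) : ℂ)).re with hc
  have hcc : sol S ((δ * τ : ℝ) : ℂ) = c := (ofReal_re_sol S _).symm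
  refine ⟨c, ?_, ?_⟩
  · simp only [Function.comp, slope_def_field, Complex.ofReal_zero, h.sol_zero, Complex.zero_re,
      sub_zero] at h2
    rw [← hc] at h2
    rw [Real.dist_eq, sub_zero] at h4
    rcases lt_or_gt_of_ne hτ with ht | ht
    · have : δ * τ < 0 := mul_neg_of_pos_of_neg h6 ht
      have hc0 : c < 0 := (div_pos_iff.1 h2).elim (fun h => absurd h.2 (not_lt.2 this.le)) (fun h => h.1)
      rw [abs_of_neg hc0, abs_of_neg ht] at h4
      exact mul_neg_of_pos_of_neg (by linarith) (by linarith)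
    · have : 0 < δ * τ := mul_pos h6 ht
      have hc0 : 0 < c := (div_pos_iff_of_pos_right this).1 h2
      rw [abs_of_pos hc0, abs_of_pos ht] at h4
      exact mul_neg_of_neg_of_pos (by linarith) (by linarith)
  · rw [← hcc, h.apply_sol h5, 
      show -((δ * τ : ℝ) : ℂ) ^ 2 / 2 = ((-(δ * τ) ^ 2 / 2 : ℝ) : ℂ) by push_cast; ring, Complex.ofReal_re]
    have : 0 < (δ * τ) ^ 2 := by positivity
    linarith

theorem IsAction.not_tendsto_sol_I_mul {S : ℂ → ℂ} (h : IsAction S) {r τ : ℝ} (hr : 0 < r)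
    (hD : solDisc S = Metric.ball 0 r)
    (hlim : Tendsto (fun t : ℝ => sol S (Complex.I * t)) (𝓝[<] r) (𝓝 τ)) : False := by
  have hmem : ∀ t ∈ Set.Ico 0 r, Complex.I * (t : ℂ) ∈ solDisc S := by
    intro t ht; rw [hD]; simpa [abs_of_nonneg ht.1] using ht.2
  have hSγ : ∀ t ∈ Set.Ioo 0 r, S (sol S (Complex.I * t)) = ((t ^ 2 / 2 : ℝ) : ℂ) := by
    intro t ht
    rw [h.apply_sol (hmem t ⟨ht.1.le, ht.2⟩), mul_pow, Complex.I_sq]; push_cast; ring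
  -- The limit of `S` along the ray is `r²/2`, whereas `S(0) = 0`.
  have hτ : τ ≠ 0 := by
    rintro rfl
    have h1 := (h.differentiable.continuous.tendsto _).comp hlim
    have h2 : Tendsto (fun t : ℝ => ((t ^ 2 / 2 : ℝ) : ℂ)) (𝓝[<] r) (𝓝 ((r ^ 2 / 2 : ℝ) : ℂ)) :=
      ((by fun_prop : Continuous fun t : ℝ => ((t ^ 2 / 2 : ℝ) : ℂ)).tendsto r).mono_left
        nhdsWithin_le_nhds
    have h3 := h1.congr' (by filter_upwards [Ioo_mem_nhdsLT hr] with t ht using hSγ t ht)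
    have h4 := tendsto_nhds_unique h3 h2
    rw [Complex.ofReal_zero, h.map_zero] at h4
    have h5 : r ^ 2 / 2 = 0 := by exact_mod_cast h4.symm
    have : 0 < r ^ 2 / 2 := by positivity
    linarith
  obtain ⟨c, hc1, hc2⟩ := h.exists_sol_between hτ
  have hγ : ∀ t ∈ Set.Ioo 0 r, HasDerivAt (fun t : ℝ => sol S (Complex.I * t))
      (deriv (sol S) (Complex.I * t) * Complex.I) t := by
    intro t ht
    have h1 : HasDerivAt (fun t : ℝ => Complex.I * (t : ℂ)) Complex.I t := by
      simpa using (Complex.ofRealCLM.hasDerivAt (x := t)).const_mul Complex.I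
    exact (h.hasDerivAt_sol (hmem t ⟨ht.1.le, ht.2⟩)).comp_of_eq t h1 rfl
  have h0 : Tendsto (fun t : ℝ => sol S (Complex.I * t)) (𝓝[>] 0) (𝓝 ((0 : ℝ) : ℂ)) := by
    have h1 : ContinuousAt (sol S) (Complex.I * (0 : ℝ)) :=
      (h.analyticOnNhd_sol _ (hmem 0 ⟨le_rfl, hr⟩)).continuousAt
    have h2 : ContinuousAt (fun t : ℝ => Complex.I * (t : ℂ)) 0 := by fun_prop
    have h3 := (h1.comp_of_eq h2 rfl).tendsto
    have h4 : sol S (Complex.I * (0 : ℝ)) = ((0 : ℝ) : ℂ) := by simp [h.sol_zero]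
    simp only [Function.comp_def, h4] at h3
    exact h3.mono_left nhdsWithin_le_nhds
  exact absurd (not_nonneg_along_upper_curve h.differentiable h.im_eq_zero hr hγ
    (h.im_sol_I_mul_pos hD) hSγ h0 hlim hc1) (not_le.2 hc2)

/-- What a square-root singularity `(τ, ρ)` looks like when the critical points of `S` are real and
nondegenerate. -/
structure IsRealSaddle (S : ℂ → ℂ) (τ ρ : ℝ) : Prop where
  ne_zero : ρ ≠ 0
  radius_eq : ENNReal.ofReal |ρ| = convergenceRadius (localSolution (maclaurin S))
  tendsto : Tendsto (sol S) (𝓝[Metric.ball 0 |ρ|] (ρ : ℂ)) (𝓝 τ)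
  deriv_eq : deriv S τ = 0
  map_eq : S τ = ((-(ρ ^ 2 / 2) : ℝ) : ℂ)
  deriv2_pos : 0 < (iteratedDeriv 2 S τ).re
  deriv2_im : (iteratedDeriv 2 S τ).im = 0
  isLocalMin : IsLocalMin (fun t : ℝ => (S t).re) τ

/-- `τ` is critical, hence real, so `ρ² = -2 S(τ)` is real and `ρ` lies on one of the axes; the
imaginary axis is excluded by `IsAction.not_tendsto_sol_I_mul`. -/
theorem IsSquareRootSingularity.exists_isRealSaddle {S : ℂ → ℂ} {σ ρ : ℂ}
    (hs : IsSquareRootSingularity S σ ρ) (h : IsAction S)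
    (hcrit : ∀ z : ℂ, deriv S z = 0 → z.im = 0 ∧ iteratedDeriv 2 S z ≠ 0) :
    ∃ τ v : ℝ, σ = τ ∧ ρ = v ∧ IsRealSaddle S τ v := by
  have hd := hs.deriv_eq_zero h
  obtain ⟨him, hd2⟩ := hcrit σ hd
  obtain ⟨τ, rfl⟩ : ∃ τ : ℝ, σ = τ := ⟨σ.re, Complex.ext (by simp) (by simpa using him)⟩
  set r := ‖ρ‖ with hr
  have hrpos : 0 < r := hs.norm_pos h
  have hD : solDisc S = Metric.ball 0 r := solDisc_eq_ball hs.radius_eq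
  have hρS : ρ ^ 2 / 2 = -S τ := hs.2.2.1
  have hsq : ρ.re * ρ.im = 0 := by
    have h1 := congrArg Complex.im (show ρ ^ 2 = 2 * -S τ by linear_combination 2 * hρS)
    rw [show (2 : ℂ) = ((2 : ℝ) : ℂ) by norm_num, Complex.im_ofReal_mul, Complex.neg_im,
      h.im_eq_zero, neg_zero, mul_zero, sq, Complex.mul_im] at h1
    linarith
  have hlim := hs.tendsto_sol
  rcases mul_eq_zero.1 hsq with hre | him
  · exfalso
    refine h.not_tendsto_sol_I_mul (τ := τ) hrpos hD ?_
    have hρ : ρ = Complex.I * ρ.im := Complex.ext (by simp [hre]) (by simp)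
    have hrim : r = |ρ.im| := by rw [hr, hρ]; simp
    rcases abs_cases ρ.im with ⟨h1, _⟩ | ⟨h1, _⟩
    · have h2 := hlim.comp (tendsto_mul_nhdsWithin_ball hrpos (u := Complex.I) (by simp) |>.mono_right (by
        rw [hrim, h1, ← hρ, ← h1, ← hrim]))
      exact h2
    -- Conjugation moves the limit at `-ir` to one at `ir`.
    · have h2 := hlim.comp (tendsto_mul_nhdsWithin_ball hrpos (u := -Complex.I) (by simp) |>.mono_right (by
        rw [hrim, h1, Complex.ofReal_neg, neg_mul_neg, ← hρ, ← h1, ← hrim]))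
      have h3 := (Complex.continuous_conj.tendsto _).comp h2
      rw [Complex.conj_ofReal] at h3
      refine h3.congr fun t => ?_
      simp only [Function.comp]
      rw [← sol_conj]; simp
  · obtain ⟨v, rfl⟩ : ∃ v : ℝ, ρ = v := ⟨ρ.re, Complex.ext (by simp) (by simpa using him)⟩
    have hrv : r = |v| := by rw [hr, Complex.norm_real, Real.norm_eq_abs]
    have hv : v ≠ 0 := by rw [hrv] at hrpos; exact abs_pos.1 hrpos
    have hSτ : S τ = ((-(v ^ 2 / 2) : ℝ) : ℂ) := by push_cast; rw [hρS, neg_neg]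
    have hdS : ∀ t : ℝ, HasDerivAt (fun t : ℝ => (S t).re) (deriv S t).re t := fun t =>
      (h.differentiable t).hasDerivAt.real_of_complex
    have hder : deriv (fun t : ℝ => (S t).re) = fun t : ℝ => (deriv S t).re := by
      funext t; exact (hdS t).deriv
    have hS' : Differentiable ℂ (deriv S) := fun z =>
      (h.differentiable.analyticAt z).deriv.differentiableAt
    have hder2 : deriv (deriv (fun t : ℝ => (S t).re)) τ = (iteratedDeriv 2 S τ).re := by
      rw [hder, iteratedDeriv_succ, iteratedDeriv_one]
      exact ((hS' τ).hasDerivAt.real_of_complex).deriv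
    have hder1 : deriv (fun t : ℝ => (S t).re) τ = 0 := by rw [hder]; simp [hd]
    have hcont : ContinuousAt (fun t : ℝ => (S t).re) τ := (hdS τ).continuousAt
    have him2 : (iteratedDeriv 2 S τ).im = 0 := by
      rw [iteratedDeriv_succ, iteratedDeriv_one]
      exact im_deriv_eq_zero (hS' τ) fun t => im_deriv_eq_zero (h.differentiable t) h.im_eq_zero
    -- For a negative second derivative `τ` would be a local maximum, but `S(x(y)) = -y²/2 > S(τ)`
    -- at the real points `y` just before `ρ`.
    have hpos : 0 < (iteratedDeriv 2 S τ).re := by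
      by_contra! hle
      have hlt : (iteratedDeriv 2 S τ).re < 0 := lt_of_le_of_ne hle fun h0 =>
        hd2 (Complex.ext h0 him2)
      have hmax := isLocalMax_of_deriv_deriv_neg (by rw [hder2]; exact hlt) hder1 hcont
      have hε : ∃ ε : ℝ, |ε| = 1 ∧ v = ε * r := by
        rcases abs_cases v with ⟨h1, _⟩ | ⟨h1, _⟩
        · exact ⟨1, by simp, by rw [hrv, h1, one_mul]⟩
        · exact ⟨-1, by simp, by rw [hrv, h1]; ring⟩
      obtain ⟨ε, hε1, hε2⟩ := hε
      have h2 := hlim.comp ((tendsto_mul_nhdsWithin_ball hrpos (u := (ε : ℂ)) (by simp [hε1])).mono_right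
        (by rw [← Complex.ofReal_mul, ← hε2]))
      have h3 := (Complex.continuous_re.tendsto _).comp h2
      rw [Complex.ofReal_re] at h3
      obtain ⟨t, ht1, ht2⟩ := ((h3.eventually hmax).and (Ioo_mem_nhdsLT hrpos)).exists
      have ht : ((ε * t : ℝ) : ℂ) ∈ solDisc S := by
        rw [hD]; simpa [hε1, abs_of_pos ht2.1] using ht2.2
      simp only [Function.comp, ← Complex.ofReal_mul] at ht1
      have h4 : (((sol S ((ε * t : ℝ) : ℂ)).re : ℝ) : ℂ) = sol S ((ε * t : ℝ) : ℂ) := ofReal_re_sol S _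
      rw [h4, h.apply_sol ht, hSτ, Complex.ofReal_re,
        show -((ε * t : ℝ) : ℂ) ^ 2 / 2 = ((-(ε * t) ^ 2 / 2 : ℝ) : ℂ) by push_cast; ring,
        Complex.ofReal_re, hε2, mul_pow, mul_pow, ← sq_abs ε, hε1] at ht1
      nlinarith [ht2.1, ht2.2]
    exact ⟨τ, v, rfl, rfl, hv, by rw [← hrv]; exact hs.radius_eq, by rw [← hrv]; exact hlim, hd, hSτ,
      hpos, him2, isLocalMin_of_deriv_deriv_pos (by rw [hder2]; exact hpos) hder1 hcont⟩

/-! ### Infinite radius of convergence -/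

theorem IsAction.coeff_localSolution {S : ℂ → ℂ} (h : IsAction S) (n : ℕ) :
    ((PowerSeries.coeff n (localSolution (maclaurin S)) : ℝ) : ℂ) =
      PowerSeries.coeff n (taylor (sol S)) := by
  have h1 := h.hasFPowerSeriesOnBall_sol.hasFPowerSeriesAt
  have h2 := h1.analyticAt.hasFPowerSeriesAt
  have h3 := h1.eq_formalMultilinearSeries h2
  rw [complexSeries] at h3
  rw [coeff_taylor]
  exact congrFun (FormalMultilinearSeries.ofScalars_series_injective ℂ ℂ h3) n

/-- Cauchy's estimate on the circle of radius `R` around `c`; this `R` ensures `M ≤ ‖z‖ ≤ 2R` on the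
circle. -/
theorem deriv_eq_zero_of_isLittleO_id {f : ℂ → ℂ} (hf : Differentiable ℂ f)
    (hO : ∀ ε > 0, ∃ M : ℝ, ∀ y : ℂ, M ≤ ‖y‖ → ‖f y‖ ≤ ε * ‖y‖) (c : ℂ) : deriv f c = 0 := by
  rw [← norm_le_zero_iff]
  refine le_of_forall_pos_le_add fun ε hε => ?_
  rw [zero_add]
  obtain ⟨M, hM⟩ := hO (ε / 2) (half_pos hε)
  set R := |M| + ‖c‖ + 1 with hR
  have hM0 := abs_nonneg M
  have hMM := le_abs_self M
  have hc0 := norm_nonneg c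
  have hRpos : 0 < R := by positivity
  have hb : ∀ z ∈ Metric.sphere c R, ‖f z‖ ≤ ε * R := by
    intro z hz
    have hz' : ‖z - c‖ = R := by simpa [dist_eq_norm] using hz
    have h1 : R ≤ ‖z‖ + ‖c‖ := by rw [← hz']; exact norm_sub_le z c
    have h2 : ‖z‖ ≤ R + ‖c‖ := by
      rw [← hz']; simpa using norm_add_le (z - c) c
    have h3 := hM z (by linarith)
    have h4 : ‖z‖ ≤ 2 * R := by linarith
    nlinarith
  have := Complex.norm_deriv_le_of_forall_mem_sphere_norm_le hRpos hf.diffContOnCl hb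
  rwa [mul_div_assoc, div_self hRpos.ne', mul_one] at this

/-- `g = x(y)/y` is entire without zeros, since `x(y) = 0` forces `y² = -2 S(0) = 0`. As `x(y) → ∞`,
the entire function `1/g` is `o(y)`, hence constant. -/
theorem IsAction.sol_eq_of_radius_eq_top {S : ℂ → ℂ} (h : IsAction S)
    (htop : convergenceRadius (localSolution (maclaurin S)) = ⊤) :
    sol S = fun y => deriv (sol S) 0 * y := by
  have hD : ∀ y, y ∈ solDisc S := fun y => by
    rw [solDisc, convergenceDisc, htop, Metric.mem_eball]; exact edist_lt_top _ _
  have hX : Differentiable ℂ (sol S) := fun y => (h.analyticOnNhd_sol y (hD y)).differentiableAt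
  set g := dslope (sol S) 0 with hg
  have hgd : Differentiable ℂ g := by
    have := (Complex.differentiableOn_dslope (s := Set.univ) (c := (0 : ℂ)) univ_mem).2
      hX.differentiableOn
    exact differentiableOn_univ.1 this
  have hg0 : g 0 = deriv (sol S) 0 := dslope_same _ _
  have hgy : ∀ y, sol S y = g y * y := by
    intro y
    have := sub_smul_dslope (sol S) 0 y
    rw [h.sol_zero, sub_zero, sub_zero, smul_eq_mul] at this
    rw [← this, mul_comm]
  have hne : ∀ y, g y ≠ 0 := by
    intro y hy
    rcases eq_or_ne y 0 with rfl | hy0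
    · exact h.deriv_sol_ne_zero (hD 0) (by rw [← hg0, hy])
    · have h1 := h.apply_sol (hD y)
      rw [hgy, hy, zero_mul, h.map_zero] at h1
      exact hy0 (by simpa using h1.symm)
  have hinv : Differentiable ℂ fun y => (g y)⁻¹ := fun y => (hgd y).inv (hne y)
  -- `S` is bounded on a compact ball while `S(x(y)) = -y²/2` is unbounded, so `x(y)` leaves every
  -- ball.
  have hbig : ∀ K : ℝ, ∃ M : ℝ, ∀ y : ℂ, M ≤ ‖y‖ → K ≤ ‖sol S y‖ := by
    intro K
    obtain ⟨B, hB⟩ := (isCompact_closedBall (0 : ℂ) K).exists_bound_of_continuousOn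
      h.differentiable.continuous.continuousOn
    refine ⟨2 * |B| + 2, fun y hy => ?_⟩
    by_contra! hlt
    have h1 := hB (sol S y) (by simpa using hlt.le)
    rw [h.apply_sol (hD y), norm_div, norm_neg, norm_pow, Complex.norm_ofNat] at h1
    have := le_abs_self B
    have := abs_nonneg B
    nlinarith
  have hzero := deriv_eq_zero_of_isLittleO_id hinv (by
    intro ε hε
    obtain ⟨M, hM⟩ := hbig ε⁻¹
    refine ⟨max M 1, fun y hy => ?_⟩
    have h1 := hM y ((le_max_left _ _).trans hy)
    have hy1 : 0 < ‖y‖ := lt_of_lt_of_le one_pos ((le_max_right _ _).trans hy)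
    have hgpos : 0 < ‖g y‖ := norm_pos_iff.2 (hne y)
    rw [hgy, norm_mul] at h1
    rw [norm_inv, inv_le_iff_one_le_mul₀ hgpos]
    have h2 := mul_le_mul_of_nonneg_left h1 hε.le
    rw [mul_inv_cancel₀ hε.ne'] at h2
    linarith)
  have hconst := is_const_of_deriv_eq_zero hinv hzero
  funext y
  rw [hgy, ← hg0, inv_inj.1 (hconst y 0)]

theorem IsAction.coeff_formalIntegral_of_radius_eq_top {S : ℂ → ℂ} (h : IsAction S)
    (htop : convergenceRadius (localSolution (maclaurin S)) = ⊤) {n : ℕ} (hn : 1 ≤ n) :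
    PowerSeries.coeff n (formalIntegral (maclaurin S)) = 0 := by
  have h1 := h.coeff_localSolution (2 * n + 1)
  rw [h.sol_eq_of_radius_eq_top htop, taylor_mul (by fun_prop) (by fun_prop), taylor_const, taylor_id,
    PowerSeries.coeff_C_mul, PowerSeries.coeff_X, if_neg (by omega), mul_zero] at h1
  rw [h.coeff_formalIntegral_eq, Complex.ofReal_eq_zero.1 h1, mul_zero]

/-! ### Continuation from a disc to a larger closed half disc -/

/-- The closed upper half plane. -/
def upper : Set ℂ := {y | 0 ≤ y.im}

/-- `g` continues `f` from the disc of radius `r` to the part of `V` in the upper half plane,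
continuously up to the real line. -/
structure IsUpperExtension (f : ℂ → ℂ) (r : ℝ) (g : ℂ → ℂ) (V : Set ℂ) : Prop where
  continuousOn : ContinuousOn g (V ∩ upper)
  differentiableOn : DifferentiableOn ℂ g (V ∩ {y | 0 < y.im})
  eqOn : Set.EqOn g f (V ∩ Metric.ball 0 r ∩ upper)

theorem isOpen_im_pos : IsOpen {y : ℂ | 0 < y.im} := isOpen_lt continuous_const Complex.continuous_im

theorem inter_upper_subset_closure {V : Set ℂ} (hV : IsOpen V) :
    V ∩ upper ⊆ closure (V ∩ {y | 0 < y.im}) := by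
  rintro y ⟨hyV, hy⟩
  have h1 : Tendsto (fun t : ℝ => y + t * Complex.I) (𝓝[>] 0) (𝓝 y) := by
    have : Tendsto (fun t : ℝ => y + t * Complex.I) (𝓝 0) (𝓝 (y + (0 : ℝ) * Complex.I)) :=
      (by fun_prop : Continuous fun t : ℝ => y + t * Complex.I).tendsto 0
    rw [Complex.ofReal_zero, zero_mul, add_zero] at this
    exact this.mono_left nhdsWithin_le_nhds
  refine mem_closure_of_tendsto h1 ?_
  filter_upwards [h1.eventually (hV.mem_nhds hyV), self_mem_nhdsWithin] with t h2 h3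
  refine ⟨h2, ?_⟩
  have hy' : 0 ≤ y.im := hy
  have h3 : 0 < t := h3
  simp only [Set.mem_ofPred_eq, Complex.add_im, Complex.mul_im, Complex.ofReal_re, Complex.I_im,
    Complex.ofReal_im, Complex.I_re]
  linarith

theorem nonempty_inter_ball_inter_upper {V : Set ℂ} (hV : IsOpen V) {r : ℝ} (hr : 0 < r) {p : ℂ}
    (hp : p ∈ V) (hpr : ‖p‖ ≤ r) (him : 0 ≤ p.im) :
    (V ∩ Metric.ball 0 r ∩ {y | 0 < y.im}).Nonempty := by
  -- Inward at first order, upward at second order: for `0 < t < min 1 r` the norm is at most `(1 -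
  -- t) r + t² < r`.
  set w : ℝ → ℂ := fun t => (1 - t : ℝ) * p + (t ^ 2 : ℝ) * Complex.I with hw
  have hwc : Continuous w := by simp only [hw]; fun_prop
  have h1 : Tendsto w (𝓝[>] 0) (𝓝 p) := by
    have := hwc.tendsto 0
    have h0 : w 0 = p := by simp [hw]
    rw [h0] at this
    exact this.mono_left nhdsWithin_le_nhds
  obtain ⟨t, h2, h3⟩ := ((h1.eventually (hV.mem_nhds hp)).and
    (Ioo_mem_nhdsGT (lt_min one_pos hr))).exists
  have h30 : 0 < t := h3.1
  have h31 : t < 1 := h3.2.trans_le (min_le_left _ _)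
  have h32 : t < r := h3.2.trans_le (min_le_right _ _)
  refine ⟨w t, ⟨h2, ?_⟩, ?_⟩
  · rw [mem_ball_zero_iff]
    calc ‖w t‖ ≤ ‖((1 - t : ℝ) : ℂ) * p‖ + ‖((t ^ 2 : ℝ) : ℂ) * Complex.I‖ := norm_add_le _ _
      _ = (1 - t) * ‖p‖ + t ^ 2 := by
        rw [norm_mul, norm_mul, Complex.norm_I, mul_one, Complex.norm_of_nonneg (by linarith),
          Complex.norm_of_nonneg (by positivity)]
      _ < r := by nlinarith
  · simp only [hw, Set.mem_ofPred_eq, Complex.add_im, Complex.im_ofReal_mul, Complex.I_im, mul_one]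
    have : 0 < t ^ 2 := by positivity
    have := mul_nonneg (sub_nonneg.2 h31.le) him
    linarith

namespace IsUpperExtension

variable {f g g₁ g₂ : ℂ → ℂ} {r : ℝ} {V V₁ V₂ : Set ℂ}

theorem mono (h : IsUpperExtension f r g V) (hV : V₁ ⊆ V) : IsUpperExtension f r g V₁ :=
  ⟨h.1.mono (Set.inter_subset_inter_left _ hV), h.2.mono (Set.inter_subset_inter_left _ hV),
    h.3.mono (Set.inter_subset_inter_left _ (Set.inter_subset_inter_left _ hV))⟩

/-- The identity theorem applies on the open half plane, anchored at a point of the disc; continuity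
carries the equality to the real line. -/
theorem eqOn_inter (h₁ : IsUpperExtension f r g₁ V₁) (h₂ : IsUpperExtension f r g₂ V₂)
    (ho : IsOpen (V₁ ∩ V₂)) (hc : Convex ℝ (V₁ ∩ V₂))
    (hne : ((V₁ ∩ V₂) ∩ Metric.ball 0 r ∩ {y | 0 < y.im}).Nonempty) :
    Set.EqOn g₁ g₂ ((V₁ ∩ V₂) ∩ upper) := by
  have hU : IsOpen ((V₁ ∩ V₂) ∩ {y : ℂ | 0 < y.im}) := ho.inter isOpen_im_pos
  obtain ⟨w, ⟨hwV, hwr⟩, hw⟩ := hne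
  have h₁' := (h₁.2.mono (Set.inter_subset_inter_left _ Set.inter_subset_left)).analyticOnNhd hU
  have h₂' := (h₂.2.mono (Set.inter_subset_inter_left _ Set.inter_subset_right)).analyticOnNhd hU
  have hconv : Convex ℝ ((V₁ ∩ V₂) ∩ {y : ℂ | 0 < y.im}) := hc.inter (convex_halfSpace_im_gt 0)
  have heq : Set.EqOn g₁ g₂ ((V₁ ∩ V₂) ∩ {y : ℂ | 0 < y.im}) := by
    refine h₁'.eqOn_of_preconnected_of_eventuallyEq h₂' hconv.isPreconnected ⟨hwV, hw⟩ ?_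
    filter_upwards [(hU.inter Metric.isOpen_ball).mem_nhds ⟨⟨hwV, hw⟩, hwr⟩] with z hz
    rw [h₁.3 ⟨⟨hz.1.1.1, hz.2⟩, le_of_lt (show 0 < z.im from hz.1.2)⟩,
      h₂.3 ⟨⟨hz.1.1.2, hz.2⟩, le_of_lt (show 0 < z.im from hz.1.2)⟩]
  refine heq.of_subset_closure (h₁.1.mono (Set.inter_subset_inter_left _ Set.inter_subset_left))
    (h₂.1.mono (Set.inter_subset_inter_left _ Set.inter_subset_right)) ?_
    (inter_upper_subset_closure ho)
  exact Set.inter_subset_inter_right _ fun y (hy : 0 < y.im) => hy.le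

end IsUpperExtension

/-- The upper half circle is compact, so the local extensions can be taken on discs of one radius
`δ`. A point outside the disc uses the extension centred at its radial projection, and neighbouring
extensions agree. -/
theorem exists_isUpperExtension {f : ℂ → ℂ} {r : ℝ} (hr : 0 < r)
    (hf : DifferentiableOn ℂ f (Metric.ball 0 r))
    (hloc : ∀ ρ : ℂ, ‖ρ‖ = r → 0 ≤ ρ.im →
      ∃ ε > 0, ∃ g, IsUpperExtension f r g (Metric.ball ρ ε)) :
    ∃ R > r, ∃ g, IsUpperExtension f r g (Metric.ball 0 R) := by
  set K : Set ℂ := Metric.sphere 0 r ∩ upper with hK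
  have hKc : IsCompact K :=
    (isCompact_sphere 0 r).inter_right (isClosed_le continuous_const Complex.continuous_im)
  have hKr : ∀ x ∈ K, ‖x‖ = r := fun x hx => by simpa using hx.1
  have hloc' : ∀ x : K, ∃ ε > 0, ∃ g, IsUpperExtension f r g (Metric.ball x ε) := fun x =>
    hloc x (hKr x x.2) x.2.2
  choose ε hε G₀ hG₀ using hloc'
  obtain ⟨δ, hδ, hδc⟩ := lebesgue_number_lemma_of_metric hKc
    (c := fun x : K => Metric.ball (x : ℂ) (ε x)) (fun _ => Metric.isOpen_ball)
    (fun x hx => Set.mem_iUnion.2 ⟨⟨x, hx⟩, Metric.mem_ball_self (hε _)⟩)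
  have hG : ∀ x : ℂ, ∃ g, x ∈ K → IsUpperExtension f r g (Metric.ball x δ) := by
    intro x
    by_cases hx : x ∈ K
    · obtain ⟨i, hi⟩ := hδc x hx
      exact ⟨G₀ i, fun _ => (hG₀ i).mono hi⟩
    · exact ⟨f, fun h => absurd h hx⟩
  choose G hG using hG
  -- The identity theorem needs a common point inside the disc: the midpoint of the two centres lies
  -- in both balls, has norm at most `r` and is not below the real line.
  have hover : ∀ x ∈ K, ∀ x' ∈ K, ∀ y ∈ Metric.ball x δ, y ∈ Metric.ball x' δ → y ∈ upper →
      G x y = G x' y := by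
    intro x hx x' hx' y hy hy' hyu
    have ho : IsOpen (Metric.ball x δ ∩ Metric.ball x' δ) := Metric.isOpen_ball.inter Metric.isOpen_ball
    refine (hG x hx).eqOn_inter (hG x' hx') ho ((convex_ball x δ).inter (convex_ball x' δ)) ?_
      ⟨⟨hy, hy'⟩, hyu⟩
    have hdist : dist x x' < 2 * δ := by
      have := dist_triangle x y x'
      rw [Metric.mem_ball] at hy hy'
      rw [dist_comm] at hy
      linarith
    have hm1 : dist (midpoint ℝ x x') x < δ := by
      rw [dist_midpoint_left]; norm_num; linarith
    have hm2 : dist (midpoint ℝ x x') x' < δ := by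
      rw [dist_midpoint_right]; norm_num; linarith
    have hmid : midpoint ℝ x x' = ((1 / 2 : ℝ) : ℂ) * (x + x') := by
      rw [midpoint_eq_smul_add]; simp [mul_add]
    refine nonempty_inter_ball_inter_upper ho hr (p := midpoint ℝ x x') ⟨hm1, hm2⟩ ?_ ?_
    · rw [hmid, norm_mul, Complex.norm_of_nonneg (by norm_num)]
      have := norm_add_le x x'
      rw [hKr x hx, hKr x' hx'] at this
      linarith
    · have h1 : 0 ≤ x.im := hx.2
      have h2 : 0 ≤ x'.im := hx'.2
      rw [hmid, Complex.im_ofReal_mul, Complex.add_im]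
      linarith
  set proj : ℂ → ℂ := fun y => ((r / ‖y‖ : ℝ) : ℂ) * y with hproj
  have hprojK : ∀ y : ℂ, r ≤ ‖y‖ → y ∈ upper → proj y ∈ K := by
    intro y hy hyu
    have hy0 : 0 < ‖y‖ := hr.trans_le hy
    refine ⟨?_, ?_⟩
    · simp only [mem_sphere_iff_norm, sub_zero, hproj]
      rw [norm_mul, Complex.norm_of_nonneg (by positivity)]
      field_simp
    · change 0 ≤ (proj y).im
      simp only [hproj, Complex.im_ofReal_mul]
      exact mul_nonneg (by positivity) hyu
  have hprojd : ∀ y : ℂ, r ≤ ‖y‖ → ‖y‖ < r + δ → y ∈ Metric.ball (proj y) δ := by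
    intro y hy hyδ
    have hy0 : 0 < ‖y‖ := hr.trans_le hy
    rw [Metric.mem_ball, dist_eq_norm]
    have : y - proj y = ((1 - r / ‖y‖ : ℝ) : ℂ) * y := by simp only [hproj]; push_cast; ring
    rw [this, norm_mul, Complex.norm_of_nonneg (by rw [sub_nonneg, div_le_one hy0]; exact hy),
      sub_mul, div_mul_cancel₀ _ hy0.ne']
    linarith
  classical
  set g : ℂ → ℂ := fun y => if ‖y‖ < r then f y else G (proj y) y with hg
  have hcov : ∀ y ∈ Metric.ball (0 : ℂ) (r + δ), y ∈ upper → ∃ N F, IsOpen N ∧ y ∈ N ∧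
      ContinuousOn F (N ∩ upper) ∧ DifferentiableOn ℂ F (N ∩ {y | 0 < y.im}) ∧
      Set.EqOn g F (N ∩ upper) := by
    intro y hy hyu
    rw [mem_ball_zero_iff] at hy
    rcases lt_or_ge ‖y‖ r with hyr | hyr
    · refine ⟨Metric.ball 0 r, f, Metric.isOpen_ball, by simpa using hyr,
        hf.continuousOn.mono Set.inter_subset_left, hf.mono Set.inter_subset_left, ?_⟩
      intro z hz
      simp only [hg]
      rw [if_pos (by simpa using hz.1)]
    · set x := proj y with hx
      have hxK := hprojK y hyr hyu
      refine ⟨Metric.ball x δ ∩ Metric.ball 0 (r + δ), G x, Metric.isOpen_ball.inter Metric.isOpen_ball,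
        ⟨hprojd y hyr hy, by simpa using hy⟩,
        (hG x hxK).1.mono (Set.inter_subset_inter_left _ Set.inter_subset_left),
        (hG x hxK).2.mono (Set.inter_subset_inter_left _ Set.inter_subset_left), ?_⟩
      rintro z ⟨⟨hz1, hz2⟩, hzu⟩
      rw [mem_ball_zero_iff] at hz2
      simp only [hg]
      split_ifs with hzr
      · exact ((hG x hxK).3 ⟨⟨hz1, by simpa using hzr⟩, hzu⟩).symm
      · rw [not_lt] at hzr
        exact hover _ (hprojK z hzr hzu) _ hxK z (hprojd z hzr hz2) hz1 hzu
  refine ⟨r + δ, by linarith, g, ?_, ?_, ?_⟩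
  · rintro y ⟨hy, hyu⟩
    obtain ⟨N, F, hNo, hyN, hFcont, -, heq⟩ := hcov y hy hyu
    have h1 : ContinuousWithinAt g (N ∩ upper) y :=
      (hFcont y ⟨hyN, hyu⟩).congr (fun z hz => heq hz) (heq ⟨hyN, hyu⟩)
    refine (h1.mono_of_mem_nhdsWithin ?_)
    rw [mem_nhdsWithin]
    exact ⟨N, hNo, hyN, fun z hz => ⟨hz.1, hz.2.2⟩⟩
  · rintro y ⟨hy, hyu⟩
    have hyu' : 0 < y.im := hyu
    obtain ⟨N, F, hNo, hyN, -, hFdiff, heq⟩ := hcov y hy hyu'.le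
    have hopen : N ∩ {y : ℂ | 0 < y.im} ∈ 𝓝 y := (hNo.inter isOpen_im_pos).mem_nhds ⟨hyN, hyu⟩
    have h1 : DifferentiableAt ℂ F y := hFdiff.differentiableAt hopen
    have h2 : g =ᶠ[𝓝 y] F := by
      filter_upwards [hopen] with z hz
      exact heq ⟨hz.1, le_of_lt (show 0 < z.im from hz.2)⟩
    exact (h1.congr_of_eventuallyEq h2).differentiableWithinAt
  · rintro y ⟨⟨-, hy⟩, -⟩
    simp only [hg]
    rw [if_pos (by simpa using hy)]

theorem exists_isUpperExtension_of_not_singular {x : PowerSeries ℝ} {r : ℝ} {ρ : ℂ}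
    (hD : convergenceDisc x = Metric.ball 0 r)
    (h : ∃ g : ℂ → ℂ, AnalyticAt ℂ g ρ ∧ g =ᶠ[𝓝[convergenceDisc x] ρ] evalSeries x) :
    ∃ ε > 0, ∃ g, AnalyticAt ℂ g ρ ∧ IsUpperExtension (evalSeries x) r g (Metric.ball ρ ε) := by
  obtain ⟨g, hg, hgx⟩ := h
  rw [hD] at hgx
  have h1 := hg.eventually_analyticAt
  obtain ⟨ε, hε, h2⟩ := Metric.eventually_nhds_iff_ball.1
    (h1.and (eventually_nhdsWithin_iff.1 hgx))
  refine ⟨ε, hε, g, hg, ?_, ?_, ?_⟩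
  · exact fun y hy => (h2 y hy.1).1.continuousAt.continuousWithinAt
  · exact fun y hy => (h2 y hy.1).1.differentiableAt.differentiableWithinAt
  · exact fun y hy => (h2 y hy.1.1).2 hy.1.2

/-! ### Continuation past a singularity of square-root type -/

/-- The branch of `√(ρ² - y²)`, for `ρ = ε r`, that is used in the upper half plane near `ρ`. -/
def branch (ε r : ℝ) (y : ℂ) : ℂ :=
  Complex.I * ((1 + ε * Complex.I) / (Real.sqrt 2 : ℝ)) *
    (Complex.I * ε * ((r : ℂ) ^ 2 - y ^ 2)) ^ (2⁻¹ : ℂ)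

section branch

variable {ε r : ℝ}

theorem ofReal_sqrt_two_sq : ((Real.sqrt 2 : ℝ) : ℂ) ^ 2 = 2 := by
  rw [← Complex.ofReal_pow, Real.sq_sqrt (by norm_num)]; norm_num

theorem ofReal_sqrt_two_ne : ((Real.sqrt 2 : ℝ) : ℂ) ≠ 0 := by
  exact_mod_cast (Real.sqrt_pos.2 (by norm_num : (0 : ℝ) < 2)).ne'

/-- The prefactor is a square root of `-iε`, which cancels the factor `iε` under the root. -/
theorem branch_sq (hε : ε ^ 2 = 1) (y : ℂ) : branch ε r y ^ 2 = (r : ℂ) ^ 2 - y ^ 2 := by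
  have h1 : (Complex.I * ε * ((r : ℂ) ^ 2 - y ^ 2)) ^ (2⁻¹ : ℂ) *
      (Complex.I * ε * ((r : ℂ) ^ 2 - y ^ 2)) ^ (2⁻¹ : ℂ) = Complex.I * ε * ((r : ℂ) ^ 2 - y ^ 2) := by
    rw [← sq]
    exact Complex.cpow_nat_inv_pow _ two_ne_zero
  have hε' : (ε : ℂ) ^ 2 = 1 := by exact_mod_cast hε
  have hI := Complex.I_sq
  rw [branch, sq]
  generalize (Complex.I * ε * ((r : ℂ) ^ 2 - y ^ 2)) ^ (2⁻¹ : ℂ) = z at *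
  have h2 := ofReal_sqrt_two_sq
  have h3 := ofReal_sqrt_two_ne
  field_simp
  rw [h2]
  have e : z ^ 2 = Complex.I * ε * ((r : ℂ) ^ 2 - y ^ 2) := by rw [sq, h1]
  rw [hI, e]
  linear_combination (-(2 : ℂ) * ε ^ 2 * (r ^ 2 - y ^ 2) - ε ^ 3 * Complex.I * (r ^ 2 - y ^ 2)) * hI +
    (2 * (r ^ 2 - y ^ 2) + Complex.I * ε * (r ^ 2 - y ^ 2)) * hε'

/-- The reason for the rotation by `iε`: in the quadrant `ε Re y > 0`, `Im y ≥ 0` the radicand has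
nonnegative real part and avoids the cut of the principal root. -/
theorem branch_arg_re (y : ℂ) :
    (Complex.I * ε * ((r : ℂ) ^ 2 - y ^ 2)).re = 2 * (ε * y.re * y.im) := by
  simp [Complex.mul_re, Complex.mul_im, sq]; ring

theorem continuousAt_branch {y : ℂ} (hy : 0 ≤ ε * y.re * y.im) : ContinuousAt (branch ε r) y := by
  have h1 := Complex.continuousAt_cpow_const_of_re_pos
    (z := Complex.I * ε * ((r : ℂ) ^ 2 - y ^ 2)) (w := 2⁻¹)
    (Or.inl (by rw [branch_arg_re]; linarith)) (by norm_num)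
  have h2 : ContinuousAt (fun y : ℂ => Complex.I * ε * ((r : ℂ) ^ 2 - y ^ 2)) y := by fun_prop
  exact continuousAt_const.mul (h1.comp_of_eq h2 rfl)

theorem differentiableAt_branch {y : ℂ} (hy : 0 < ε * y.re * y.im) :
    DifferentiableAt ℂ (branch ε r) y := by
  have h2 : DifferentiableAt ℂ (fun y : ℂ => Complex.I * ε * ((r : ℂ) ^ 2 - y ^ 2)) y := by fun_prop
  refine (h2.cpow_const (Or.inl ?_)).const_mul _
  rw [branch_arg_re]; linarith

/-- For `s = ±1` the factor `(1 + s i)/√2` is an eighth root of unity. Its real part is positive for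
every real `s`, so the base of the square is the principal root. -/
theorem branch_sqrt_of_sq {b s : ℝ} (hb : 0 < b) {y : ℂ}
    (h : Complex.I * ε * ((r : ℂ) ^ 2 - y ^ 2) =
      (((Real.sqrt b : ℝ) : ℂ) * ((1 + s * Complex.I) / (Real.sqrt 2 : ℝ))) ^ 2) :
    branch ε r y = Complex.I * ((1 + ε * Complex.I) / (Real.sqrt 2 : ℝ)) *
      (((Real.sqrt b : ℝ) : ℂ) * ((1 + s * Complex.I) / (Real.sqrt 2 : ℝ))) := by
  rw [branch, h]
  congr 1
  have := Complex.sq_cpow_two_inv (x := ((Real.sqrt b : ℝ) : ℂ) * ((1 + s * Complex.I) / (Real.sqrt 2 : ℝ))) ?_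
  · exact_mod_cast this
  · rw [Complex.re_ofReal_mul, Complex.div_ofReal_re]
    simp
    exact hb

theorem branch_outer (hε : ε ^ 2 = 1) {u : ℝ} (hu : r ^ 2 < u ^ 2) :
    branch ε r ((ε * u : ℝ) : ℂ) = Complex.I * (Real.sqrt (u ^ 2 - r ^ 2) : ℝ) := by
  have hε' : (ε : ℂ) ^ 2 = 1 := by exact_mod_cast hε
  have hI := Complex.I_sq
  have hb : 0 < u ^ 2 - r ^ 2 := by linarith
  have hs : ((Real.sqrt (u ^ 2 - r ^ 2) : ℝ) : ℂ) ^ 2 = u ^ 2 - r ^ 2 := by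
    rw [← Complex.ofReal_pow, Real.sq_sqrt hb.le]; push_cast; ring
  have h2 := ofReal_sqrt_two_sq
  have h3 := ofReal_sqrt_two_ne
  rw [branch_sqrt_of_sq (s := -ε) hb]
  · push_cast
    field_simp
    rw [h2]
    linear_combination ((Real.sqrt (u ^ 2 - r ^ 2) : ℝ) : ℂ) * (-(ε : ℂ) ^ 2 * hI + hε')
  · rw [mul_pow, hs, div_pow, h2]
    push_cast
    field_simp
    linear_combination (-2 * Complex.I * ε * u ^ 2 + (u ^ 2 - r ^ 2)) * hε' -
      (ε ^ 2 * (u ^ 2 - r ^ 2)) * hI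

/-- The sign `-ε` is the one with which `τ + ψ(branch)` reaches `τ` from the side of the origin. -/
theorem branch_inner (hε : ε ^ 2 = 1) {u : ℝ} (hu : u ^ 2 < r ^ 2) :
    branch ε r ((ε * u : ℝ) : ℂ) = ((-ε * Real.sqrt (r ^ 2 - u ^ 2) : ℝ) : ℂ) := by
  have hε' : (ε : ℂ) ^ 2 = 1 := by exact_mod_cast hε
  have hI := Complex.I_sq
  have hb : 0 < r ^ 2 - u ^ 2 := by linarith
  have hs : ((Real.sqrt (r ^ 2 - u ^ 2) : ℝ) : ℂ) ^ 2 = r ^ 2 - u ^ 2 := by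
    rw [← Complex.ofReal_pow, Real.sq_sqrt hb.le]; push_cast; ring
  have h2 := ofReal_sqrt_two_sq
  have h3 := ofReal_sqrt_two_ne
  rw [branch_sqrt_of_sq (s := ε) hb]
  · push_cast
    field_simp
    rw [h2]
    linear_combination ((Real.sqrt (r ^ 2 - u ^ 2) : ℝ) : ℂ) * ((2 * ε + ε ^ 2 * Complex.I) * hI - Complex.I * hε')
  · rw [mul_pow, hs, div_pow, h2]
    push_cast
    field_simp
    linear_combination (-2 * Complex.I * ε * u ^ 2 + (r ^ 2 - u ^ 2)) * hε' -
      (ε ^ 2 * (r ^ 2 - u ^ 2)) * hI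

end branch

theorem abs_eq_one_of_sq_eq_one {ε : ℝ} (hε : ε ^ 2 = 1) : |ε| = 1 :=
  (pow_eq_one_iff_of_nonneg (abs_nonneg ε) two_ne_zero).1 (by rw [sq_abs, hε])

/-- On the real diameter `x'` is real, never zero, and positive at `0`. -/
theorem IsAction.deriv_sol_re_pos {S : ℂ → ℂ} (h : IsAction S) {r : ℝ}
    (hD : solDisc S = Metric.ball 0 r) {t : ℝ} (ht : |t| < r) : 0 < (deriv (sol S) t).re := by
  have hmem : ∀ s ∈ Set.uIcc 0 t, (s : ℂ) ∈ solDisc S := by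
    intro s hs
    rw [hD, mem_ball_zero_iff, Complex.norm_real, Real.norm_eq_abs]
    have := Set.abs_sub_left_of_mem_uIcc hs
    rw [sub_zero, sub_zero] at this
    exact this.trans_lt ht
  have hcont : ContinuousOn (fun s : ℝ => (deriv (sol S) s).re) (Set.uIcc 0 t) := by
    intro s hs
    have h1 : ContinuousAt (deriv (sol S)) (s : ℂ) := (h.analyticOnNhd_sol _ (hmem s hs)).deriv.continuousAt
    exact (Complex.continuous_re.continuousAt.comp
      (h1.comp_of_eq Complex.continuous_ofReal.continuousAt rfl)).continuousWithinAt
  by_contra! hle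
  have h0 := h.deriv_sol_zero_re
  obtain ⟨s, hs, hs0⟩ := intermediate_value_uIcc hcont
    (show (0 : ℝ) ∈ Set.uIcc ((deriv (sol S) ((0 : ℝ) : ℂ)).re) ((deriv (sol S) (t : ℂ)).re) from by
      rw [Complex.ofReal_zero]; exact Set.mem_uIcc.2 (Or.inr ⟨hle, h0.le⟩))
  refine h.deriv_sol_ne_zero (hmem s hs) (Complex.ext hs0 ?_)
  exact im_deriv_eq_zero (h.analyticOnNhd_sol _ (hmem s hs)).differentiableAt (sol_ofReal_im S)

/-- By monotonicity `x(y)` approaches `τ` from the side of the origin; this selects the sign of the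
square root at the saddle. -/
theorem IsAction.mul_sol_le {S : ℂ → ℂ} (h : IsAction S) {r ε τ : ℝ} (hε : ε ^ 2 = 1)
    (hD : solDisc S = Metric.ball 0 r)
    (hlim : Tendsto (fun t : ℝ => (sol S ((ε * t : ℝ) : ℂ)).re) (𝓝[<] r) (𝓝 τ)) {u : ℝ}
    (hu : u ∈ Set.Ioo 0 r) : ε * (sol S ((ε * u : ℝ) : ℂ)).re ≤ ε * τ := by
  have hεabs : |ε| = 1 := abs_eq_one_of_sq_eq_one hε
  have habs : ∀ t ∈ Set.Ioo 0 r, |ε * t| < r := fun t ht => by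
    rw [abs_mul, hεabs, one_mul, abs_of_pos ht.1]; exact ht.2
  have hd : ∀ t ∈ Set.Ioo 0 r, HasDerivAt (fun t : ℝ => ε * (sol S ((ε * t : ℝ) : ℂ)).re)
      ((deriv (sol S) ((ε * t : ℝ) : ℂ)).re) t := by
    intro t ht
    have hm : ((ε * t : ℝ) : ℂ) ∈ solDisc S := by
      rw [hD, mem_ball_zero_iff, Complex.norm_real, Real.norm_eq_abs]; exact habs t ht
    have h1 := (h.hasDerivAt_sol hm).real_of_complex
    have h2 : HasDerivAt (fun t : ℝ => ε * t) ε t := by simpa using (hasDerivAt_id t).const_mul ε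
    have h3 := (h1.comp_of_eq t h2 rfl).const_mul ε
    refine h3.congr_deriv ?_
    linear_combination (deriv (sol S) ((ε * t : ℝ) : ℂ)).re * hε
  refine le_of_tendsto_of_hasDerivAt_nonneg hu.2 (fun t ht => hd t ⟨hu.1.trans ht.1, ht.2⟩)
    (fun t ht => (h.deriv_sol_re_pos hD (habs t ⟨hu.1.trans ht.1, ht.2⟩)).le)
    ((hd u hu).continuousAt.tendsto.mono_left nhdsWithin_le_nhds) (hlim.const_mul ε)

namespace IsRealSaddle

variable {S : ℂ → ℂ} {τ : ℝ}

theorem analyticAt_saddle (h : IsAction S) (τ : ℝ) :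
    AnalyticAt ℂ (fun x : ℂ => S τ - S (x + τ)) 0 := by
  have h1 : AnalyticAt ℂ (fun x : ℂ => S (x + τ)) 0 :=
    (h.differentiable.analyticAt _).comp_of_eq (by fun_prop) rfl
  exact analyticAt_const.fun_sub h1

theorem im_saddle (h : IsAction S) (τ : ℝ) :
    ∀ᶠ t : ℝ in 𝓝 0, ((fun x : ℂ => S τ - S (x + τ)) t).im = 0 :=
  Eventually.of_forall fun t => by
    simp only [Complex.sub_im]
    rw [← Complex.ofReal_add, h.im_eq_zero, h.im_eq_zero, sub_zero]

theorem deriv_saddle {ρ : ℝ} (hs : IsRealSaddle S τ ρ) :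
    deriv (fun x : ℂ => S τ - S (x + τ)) 0 = 0 := by
  rw [deriv_const_sub, deriv_comp_add_const, zero_add, hs.deriv_eq, neg_zero]

theorem iteratedDeriv_saddle {ρ : ℝ} (hs : IsRealSaddle S τ ρ) :
    iteratedDeriv 2 (fun x : ℂ => S τ - S (x + τ)) 0 = -(((iteratedDeriv 2 S τ).re : ℝ) : ℂ) := by
  have h1 : deriv (fun x : ℂ => S τ - S (x + τ)) = fun x => -deriv S (x + τ) := by
    funext x
    rw [deriv_const_sub, deriv_comp_add_const]
  rw [iteratedDeriv_succ, iteratedDeriv_one, h1, deriv.fun_neg, deriv_comp_add_const, zero_add]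
  have h2 : iteratedDeriv 2 S τ = deriv (deriv S) τ := by rw [iteratedDeriv_succ, iteratedDeriv_one]
  rw [← h2]
  congr 1
  exact Complex.ext (by simp) (by simpa using hs.deriv2_im)

theorem exists_chart {ρ : ℝ} (hs : IsRealSaddle S τ ρ) (h : IsAction S) :
    ∃ ψ P : ℂ → ℂ, IsMorseChart (fun x => S τ - S (x + τ)) ψ P :=
  exists_isMorseChart (analyticAt_saddle h τ) (im_saddle h τ) (by simp) hs.deriv_saddle
    hs.iteratedDeriv_saddle hs.deriv2_pos

theorem _root_.FormalIntegral.IsMorseChart.div_pos {f ψ P : ℂ → ℂ} (hc : IsMorseChart f ψ P) :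
    ∀ᶠ t : ℝ in 𝓝[≠] 0, 0 < (ψ t).re / t := by
  have h1 : HasDerivAt ψ (deriv ψ 0) ((0 : ℝ) : ℂ) := by
    simpa using hc.analyticAt_inv.differentiableAt.hasDerivAt
  have h2 := hasDerivAt_iff_tendsto_slope.1 h1.real_of_complex
  filter_upwards [h2.eventually_const_lt hc.deriv_pos] with t ht
  rw [slope_def_field] at ht
  simpa [hc.inv_zero] using ht

/-- In the Morse coordinate the curve reads `P(x - τ)² = r² - y²`, so `x = τ + ψ(κ(y))` once `κ` is
known to be the right root. -/
theorem exists_continuation {ε r : ℝ} (hε : ε ^ 2 = 1) (hr : 0 < r)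
    (hs : IsRealSaddle S τ (ε * r)) (h : IsAction S) {ψ P : ℂ → ℂ}
    (hc : IsMorseChart (fun x => S τ - S (x + τ)) ψ P) :
    ∃ δ > 0, ∃ g, IsUpperExtension (sol S) r g (Metric.ball ((ε * r : ℝ) : ℂ) δ) ∧
      ∀ u : ℝ, r < u → g ((ε * u : ℝ) : ℂ) = τ + ψ (Complex.I * (Real.sqrt (u ^ 2 - r ^ 2) : ℝ)) := by
  have hεabs : |ε| = 1 := abs_eq_one_of_sq_eq_one hε
  have hε' : (ε : ℂ) ^ 2 = 1 := by exact_mod_cast hε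
  have habs : |ε * r| = r := by rw [abs_mul, hεabs, one_mul, abs_of_pos hr]
  have hD : solDisc S = Metric.ball 0 r := by
    have := solDisc_eq_ball hs.radius_eq; rwa [habs] at this
  set ρ : ℂ := ((ε * r : ℝ) : ℂ) with hρ
  have hlim : Tendsto (sol S) (𝓝[Metric.ball 0 r] ρ) (𝓝 τ) := by
    have := hs.tendsto; rwa [habs] at this
  set κ := branch ε r with hκ
  have hκcont : ∀ y : ℂ, 0 ≤ ε * y.re * y.im → ContinuousAt κ y := fun y hy => continuousAt_branch hy
  have hκρ : κ ρ = 0 := by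
    have h1 : κ ρ ^ 2 = 0 := by
      rw [hκ, branch_sq hε, hρ]; push_cast; linear_combination (-(r : ℂ) ^ 2) * hε'
    exact pow_eq_zero_iff two_ne_zero |>.1 h1
  have hκlim : Tendsto κ (𝓝 ρ) (𝓝 0) := by
    have := (hκcont ρ (by simp [hρ])).tendsto
    rwa [hκρ] at this
  have e1 : ∀ᶠ y in 𝓝 ρ, AnalyticAt ℂ ψ (κ y) := hκlim.eventually hc.analyticAt_inv.eventually_analyticAt
  have e2 : ∀ᶠ y in 𝓝 ρ, 0 < ε * y.re := by
    have : ContinuousAt (fun y : ℂ => ε * y.re) ρ := by fun_prop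
    refine this.eventually_const_lt ?_
    show 0 < ε * ((ε * r : ℝ) : ℂ).re
    rw [Complex.ofReal_re, ← mul_assoc, ← sq, hε, one_mul]; exact hr
  have hlim0 : Tendsto (fun y => sol S y - τ) (𝓝[Metric.ball 0 r] ρ) (𝓝 0) := by
    simpa using hlim.sub_const (τ : ℂ)
  have e3 : ∀ᶠ y in 𝓝 ρ, y ∈ Metric.ball (0 : ℂ) r → P (sol S y - τ) ^ 2 = -2 * (S τ - S (sol S y - τ + τ)) :=
    eventually_nhdsWithin_iff.1 (hlim0.eventually hc.coord_sq)
  have e4 : ∀ᶠ y in 𝓝 ρ, y ∈ Metric.ball (0 : ℂ) r → ψ (P (sol S y - τ)) = sol S y - τ :=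
    eventually_nhdsWithin_iff.1 (hlim0.eventually hc.inv_coord)
  have e5 : ∀ᶠ y in 𝓝 ρ, y ∈ Metric.ball (0 : ℂ) r → AnalyticAt ℂ P (sol S y - τ) :=
    eventually_nhdsWithin_iff.1 (hlim0.eventually hc.analyticAt_coord.eventually_analyticAt)
  obtain ⟨δ, hδ, hball⟩ := Metric.eventually_nhds_iff_ball.1 (e1.and (e2.and (e3.and (e4.and e5))))
  have hsign : ∀ y ∈ Metric.ball ρ δ, y ∈ upper → 0 ≤ ε * y.re * y.im := fun y hy hyu =>
    mul_nonneg (hball y hy).2.1.le hyu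
  set W := Metric.ball ρ δ ∩ Metric.ball 0 r ∩ upper with hW
  have hWconv : Convex ℝ W :=
    ((convex_ball _ _).inter (convex_ball _ _)).inter (convex_halfSpace_im_ge 0)
  have hsq : ∀ y ∈ W, P (sol S y - τ) ^ 2 = κ y ^ 2 := by
    intro y hy
    rw [(hball y hy.1.1).2.2.1 hy.1.2, hκ, branch_sq hε, sub_add_cancel, h.apply_sol (hD ▸ hy.1.2),
      hs.map_eq]
    push_cast
    linear_combination (r : ℂ) ^ 2 * hε'
  have hκne : ∀ y ∈ W, κ y ≠ 0 := by
    intro y hy h0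
    have h1 : (r : ℂ) ^ 2 - y ^ 2 = 0 := by rw [← branch_sq hε, ← hκ, h0]; simp
    have h2 : ‖y‖ ^ 2 = r ^ 2 := by
      rw [← norm_pow, ← sub_eq_zero.1 h1, norm_pow, Complex.norm_of_nonneg hr.le]
    have h3 : ‖y‖ < r := by simpa using hy.1.2
    nlinarith [norm_nonneg y]
  have hPc : ContinuousOn (fun y => P (sol S y - τ)) W := by
    intro y hy
    have h1 : ContinuousAt P (sol S y - τ) := ((hball y hy.1.1).2.2.2.2 hy.1.2).continuousAt
    have h2 : ContinuousAt (fun y => sol S y - τ) y :=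
      (h.analyticOnNhd_sol y (hD ▸ hy.1.2)).continuousAt.sub continuousAt_const
    exact (h1.comp_of_eq h2 rfl).continuousWithinAt
  -- The sign is tested at one real point before `ρ`: the opposite root would put `x(y)` beyond `τ`,
  -- since `ψ(t)/t > 0` near `0`.
  obtain ⟨y₀, hy₀W, hy₀⟩ : ∃ y ∈ W, P (sol S y - τ) = κ y := by
    have hpath : Tendsto (fun u : ℝ => ((ε * u : ℝ) : ℂ)) (𝓝[<] r) (𝓝[Metric.ball 0 r] ρ) := by
      have := tendsto_mul_nhdsWithin_ball hr (u := (ε : ℂ)) (by simp [hεabs])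
      simpa [hρ] using this
    have hpath' : Tendsto (fun u : ℝ => ((ε * u : ℝ) : ℂ)) (𝓝[<] r) (𝓝 ρ) :=
      hpath.mono_right nhdsWithin_le_nhds
    have hsqrt : Tendsto (fun u : ℝ => ε * Real.sqrt (r ^ 2 - u ^ 2)) (𝓝[<] r) (𝓝[≠] 0) := by
      refine tendsto_nhdsWithin_iff.2 ⟨?_, ?_⟩
      · have hcont : Continuous fun u : ℝ => ε * Real.sqrt (r ^ 2 - u ^ 2) := by fun_prop
        have := hcont.tendsto r
        rw [sub_self, Real.sqrt_zero, mul_zero] at this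
        exact this.mono_left nhdsWithin_le_nhds
      · filter_upwards [Ioo_mem_nhdsLT hr] with u hu
        have : 0 < r ^ 2 - u ^ 2 := by nlinarith [hu.1, hu.2]
        have hε0 : ε ≠ 0 := by rintro rfl; norm_num at hε
        exact mul_ne_zero hε0 (Real.sqrt_pos.2 this).ne'
    have hIoo : ∀ᶠ u in 𝓝[<] r, u ∈ Set.Ioo 0 r := Ioo_mem_nhdsLT hr
    have hδu : ∀ᶠ u in 𝓝[<] r, ((ε * u : ℝ) : ℂ) ∈ Metric.ball ρ δ :=
      hpath'.eventually (Metric.ball_mem_nhds ρ hδ)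
    have hru : ∀ᶠ u in 𝓝[<] r, ((ε * u : ℝ) : ℂ) ∈ Metric.ball (0 : ℂ) r :=
      hpath.eventually self_mem_nhdsWithin
    obtain ⟨u, ⟨hu1, hu2⟩, hu3, hu4⟩ :=
      ((hδu.and (hsqrt.eventually hc.div_pos)).and (hIoo.and hru)).exists
    have hyW : ((ε * u : ℝ) : ℂ) ∈ W := ⟨⟨hu1, hu4⟩, by simp [upper]⟩
    refine ⟨_, hyW, ?_⟩
    rcases sq_eq_sq_iff_eq_or_eq_neg.1 (hsq _ hyW) with h1 | h1
    · exact h1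
    exfalso
    have hu5 : u ^ 2 < r ^ 2 := by nlinarith [hu3.1, hu3.2]
    have h2 := (hball _ hu1).2.2.2.1 hu4
    rw [h1, hκ, branch_inner hε hu5, ← Complex.ofReal_neg,
      show -(-ε * √(r ^ 2 - u ^ 2)) = ε * √(r ^ 2 - u ^ 2) by ring] at h2
    rw [h2, Complex.sub_re, Complex.ofReal_re] at hu2
    have h3 := h.mul_sol_le (τ := τ) hε hD
      ((Complex.continuous_re.tendsto _).comp (hlim.comp hpath)) hu3
    have hspos : 0 < √(r ^ 2 - u ^ 2) := Real.sqrt_pos.2 (by linarith)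
    have h4 : ((sol S ((ε * u : ℝ) : ℂ)).re - τ) / (ε * √(r ^ 2 - u ^ 2)) =
        (ε * ((sol S ((ε * u : ℝ) : ℂ)).re - τ)) / √(r ^ 2 - u ^ 2) := by
      have hε0 : ε ≠ 0 := by rintro rfl; norm_num at hε
      field_simp
      linear_combination (-((sol S ((ε * u : ℝ) : ℂ)).re - τ)) * hε
    rw [h4, div_pos_iff_of_pos_right hspos] at hu2
    linarith
  have hκc : ContinuousOn κ W := fun y hy =>
    (hκcont y (hsign y hy.1.1 hy.2)).continuousWithinAt
  -- Two continuous roots of the same nonvanishing function on a connected set agree once they agree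
  -- at a point.
  have heq : Set.EqOn (fun y => P (sol S y - τ)) κ W :=
    hWconv.isPreconnected.eq_of_sq_eq hPc hκc (fun y hy => hsq y hy) (fun {y} hy => hκne y hy) hy₀W hy₀
  refine ⟨δ, hδ, fun y => τ + ψ (κ y), ⟨?_, ?_, ?_⟩, ?_⟩
  · intro y hy
    have h1 : ContinuousAt ψ (κ y) := (hball y hy.1).1.continuousAt
    exact (continuousAt_const.add (h1.comp (hκcont y (hsign y hy.1 hy.2)))).continuousWithinAt
  · intro y hy
    have h1 : DifferentiableAt ℂ ψ (κ y) := (hball y hy.1).1.differentiableAt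
    have h2 : DifferentiableAt ℂ κ y := differentiableAt_branch (mul_pos (hball y hy.1).2.1 hy.2)
    exact ((h1.comp y h2).const_add _).differentiableWithinAt
  · intro y hy
    have h1 := (hball y hy.1.1).2.2.2.1 hy.1.2
    have h2 : P (sol S y - τ) = κ y := heq hy
    rw [h2] at h1
    simp only [h1]; ring
  · intro u hu
    simp only [hκ]
    rw [branch_outer hε (by nlinarith)]

end IsRealSaddle

/-! ### Laplace integrals at a square-root branch point -/

/-- The function `(u² - r²)^(k + 1/2) u^{-(2n+1)}` at `u = exp s`. -/
def cutIntegrand (r : ℝ) (k n : ℕ) (s : ℝ) : ℝ :=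
  Real.sqrt (Real.exp s ^ 2 - r ^ 2) ^ (2 * k + 1) * Real.exp (-((2 * n + 1 : ℕ) * s))

/-- The integral of `(u² - r²)^(k + 1/2) u^{-(2n+2)}` over `u > r`. -/
def cutIntegral (r : ℝ) (k n : ℕ) : ℝ := ∫ s in Set.Ioi (Real.log r), cutIntegrand r k n s

theorem continuous_cutIntegrand (r : ℝ) (k n : ℕ) : Continuous (cutIntegrand r k n) := by
  unfold cutIntegrand; fun_prop

theorem cutIntegrand_nonneg (r : ℝ) (k n : ℕ) (s : ℝ) : 0 ≤ cutIntegrand r k n s := by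
  unfold cutIntegrand; positivity

theorem cutIntegrand_le (r : ℝ) {k n : ℕ} (hkn : k < n) (s : ℝ) :
    cutIntegrand r k n s ≤ Real.exp (-(2 * (n - k : ℕ)) * s) := by
  have h1 : Real.sqrt (Real.exp s ^ 2 - r ^ 2) ≤ Real.exp s :=
    Real.sqrt_le_iff.2 ⟨(Real.exp_pos s).le, by nlinarith [sq_nonneg r]⟩
  calc cutIntegrand r k n s
      ≤ Real.exp s ^ (2 * k + 1) * Real.exp (-((2 * n + 1 : ℕ) * s)) := by
        unfold cutIntegrand; gcongr
    _ = Real.exp (-(2 * (n - k : ℕ)) * s) := by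
        rw [← Real.exp_nat_mul, ← Real.exp_add]
        congr 1
        push_cast [Nat.cast_sub hkn.le]
        ring

theorem integrableOn_cutIntegrand (r : ℝ) {k n : ℕ} (hkn : k < n) (a : ℝ) :
    MeasureTheory.IntegrableOn (cutIntegrand r k n) (Set.Ioi a) := by
  have hpos : 0 < 2 * ((n - k : ℕ) : ℝ) := by
    have : 0 < n - k := Nat.sub_pos_of_lt hkn
    positivity
  refine (exp_neg_integrableOn_Ioi a hpos).mono'
    (continuous_cutIntegrand r k n).aestronglyMeasurable (MeasureTheory.ae_of_all _ fun s => ?_)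
  rw [Real.norm_of_nonneg (cutIntegrand_nonneg r k n s)]
  exact cutIntegrand_le r hkn s

/-- Integrated over the ray, this is the integration by parts behind the recurrence in `n`. -/
theorem hasDerivAt_cutIntegrand_succ {r : ℝ} (k n : ℕ) {s : ℝ} (hs : r ^ 2 < Real.exp s ^ 2) :
    HasDerivAt (cutIntegrand r (k + 1) (n + 1))
      ((2 * k + 3) * cutIntegrand r k n s - (2 * n + 3) *
        (cutIntegrand r k n s - r ^ 2 * cutIntegrand r k (n + 1) s)) s := by
  have hpos : 0 < Real.exp s ^ 2 - r ^ 2 := by linarith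
  have h1 : HasDerivAt (fun s => Real.exp s ^ 2 - r ^ 2) (2 * Real.exp s ^ 2) s :=
    (((Real.hasDerivAt_exp s).pow 2).sub_const _).congr_deriv (by norm_num; ring)
  have h2 := (h1.sqrt hpos.ne').pow (2 * (k + 1) + 1)
  have h3 : HasDerivAt (fun s : ℝ => Real.exp (-((2 * (n + 1) + 1 : ℕ) * s)))
      (Real.exp (-((2 * (n + 1) + 1 : ℕ) * s)) * (-(2 * (n + 1) + 1 : ℕ))) s := by
    have : HasDerivAt (fun s : ℝ => -((2 * (n + 1) + 1 : ℕ) * s)) (-(2 * (n + 1) + 1 : ℕ) : ℝ) s := by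
      exact (((hasDerivAt_id s).const_mul ((2 * (n + 1) + 1 : ℕ) : ℝ)).neg).congr_deriv (by simp)
    exact this.exp
  refine (h2.mul h3).congr_deriv ?_
  have hv := Real.sqrt_pos.2 hpos
  have hv2 := Real.sq_sqrt hpos.le
  have he : Real.exp (-((2 * n + 1 : ℕ) * s)) =
      Real.exp s ^ 2 * Real.exp (-((2 * (n + 1) + 1 : ℕ) * s)) := by
    rw [← Real.exp_nat_mul, ← Real.exp_add]; congr 1; push_cast; ring
  simp only [cutIntegrand, he]
  set v := √(Real.exp s ^ 2 - r ^ 2)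
  set E := Real.exp (-((2 * (n + 1) + 1 : ℕ) * s))
  rw [show 2 * (k + 1) + 1 - 1 = 2 * k + 2 by omega]
  simp only [Pi.pow_apply]
  have h4 : v ^ (2 * (k + 1) + 1) = (Real.exp s ^ 2 - r ^ 2) * v ^ (2 * k + 1) := by
    rw [← hv2]; ring
  have h5 : v ^ (2 * k + 2) * (2 * Real.exp s ^ 2 / (2 * v)) = v ^ (2 * k + 1) * Real.exp s ^ 2 := by
    field_simp
    ring
  rw [mul_assoc _ (v ^ (2 * k + 2)), h5, h4]
  push_cast
  ring

theorem tendsto_cutIntegrand (r : ℝ) {k n : ℕ} (hkn : k < n) :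
    Tendsto (cutIntegrand r k n) atTop (𝓝 0) := by
  have hpos : 0 < 2 * ((n - k : ℕ) : ℝ) := by
    have : 0 < n - k := Nat.sub_pos_of_lt hkn
    positivity
  refine squeeze_zero (cutIntegrand_nonneg r k n) (cutIntegrand_le r hkn) ?_
  refine Real.tendsto_exp_atBot.comp ?_
  exact tendsto_id.const_mul_atTop_of_neg (by linarith)

theorem cutIntegrand_log (r : ℝ) (hr : 0 < r) (k n : ℕ) : cutIntegrand r k n (Real.log r) = 0 := by
  simp [cutIntegrand, Real.exp_log hr]

theorem lt_exp_sq {r : ℝ} (hr : 0 < r) {s : ℝ} (hs : Real.log r < s) : r ^ 2 < Real.exp s ^ 2 := by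
  have := (Real.log_lt_iff_lt_exp hr).1 hs
  nlinarith

/-- Both boundary values vanish, at the branch point and at infinity. -/
theorem cutIntegral_succ {r : ℝ} (hr : 0 < r) {k n : ℕ} (hkn : k < n) :
    (2 * n + 3) * r ^ 2 * cutIntegral r k (n + 1) = 2 * (n - k) * cutIntegral r k n := by
  have h1 : MeasureTheory.IntegrableOn (fun s => cutIntegrand r k n s) (Set.Ioi (Real.log r)) :=
    integrableOn_cutIntegrand r hkn (Real.log r)
  have h2 : MeasureTheory.IntegrableOn (fun s => r ^ 2 * cutIntegrand r k (n + 1) s)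
      (Set.Ioi (Real.log r)) :=
    (integrableOn_cutIntegrand r (Nat.lt_succ_of_lt hkn) (Real.log r)).const_mul _
  have h12 : MeasureTheory.IntegrableOn (fun s => (2 * n + 3) *
        (cutIntegrand r k n s - r ^ 2 * cutIntegrand r k (n + 1) s)) (Set.Ioi (Real.log r)) :=
    (h1.sub h2).const_mul _
  have h3 : MeasureTheory.IntegrableOn (fun s => (2 * k + 3) * cutIntegrand r k n s - (2 * n + 3) *
        (cutIntegrand r k n s - r ^ 2 * cutIntegrand r k (n + 1) s)) (Set.Ioi (Real.log r)) :=
    (h1.const_mul _).sub h12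
  have h4 := MeasureTheory.integral_Ioi_of_hasDerivAt_of_tendsto
    (continuous_cutIntegrand r (k + 1) (n + 1)).continuousWithinAt
    (fun s hs => hasDerivAt_cutIntegrand_succ k n (lt_exp_sq hr hs)) h3
    (tendsto_cutIntegrand r (Nat.succ_lt_succ hkn))
  rw [cutIntegrand_log r hr, MeasureTheory.integral_sub (h1.const_mul _) h12, MeasureTheory.integral_const_mul,
    MeasureTheory.integral_const_mul, MeasureTheory.integral_sub h1 h2,
    MeasureTheory.integral_const_mul] at h4
  simp only [cutIntegral]
  linear_combination h4

/-- At `n = k` the two nonintegrable terms of the derivative cancel and the boundary value at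
infinity is `1` rather than `0`; this starts the recurrence. -/
theorem cutIntegral_self_succ {r : ℝ} (hr : 0 < r) (k : ℕ) :
    (2 * k + 3) * r ^ 2 * cutIntegral r k (k + 1) = 1 := by
  have h2 := integrableOn_cutIntegrand r (Nat.lt_succ_self k) (Real.log r)
  have hlim : Tendsto (cutIntegrand r (k + 1) (k + 1)) atTop (𝓝 1) := by
    have h5 : Tendsto (fun s => Real.sqrt (1 - r ^ 2 * Real.exp (-(2 * s))) ^ (2 * (k + 1) + 1))
        atTop (𝓝 (Real.sqrt (1 - r ^ 2 * 0) ^ (2 * (k + 1) + 1))) := by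
      have h6 : Tendsto (fun s : ℝ => Real.exp (-(2 * s))) atTop (𝓝 0) :=
        Real.tendsto_exp_neg_atTop_nhds_zero.comp (tendsto_id.const_mul_atTop two_pos)
      exact (((h6.const_mul _).const_sub 1).sqrt).pow _
    rw [mul_zero, sub_zero, Real.sqrt_one, one_pow] at h5
    refine h5.congr fun s => ?_
    have h6 : Real.sqrt (Real.exp s ^ 2 - r ^ 2) =
        Real.exp s * Real.sqrt (1 - r ^ 2 * Real.exp (-(2 * s))) := by
      rw [← Real.sqrt_sq (Real.exp_pos s).le, ← Real.sqrt_mul (by positivity),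
        Real.sqrt_sq (Real.exp_pos s).le]
      congr 1
      have : Real.exp s ^ 2 * Real.exp (-(2 * s)) = 1 := by
        rw [← Real.exp_nat_mul, ← Real.exp_add]; simp
      linear_combination r ^ 2 * this
    have h7 : Real.exp s ^ (2 * (k + 1) + 1) * Real.exp (-((2 * (k + 1) + 1 : ℕ) * s)) = 1 := by
      rw [← Real.exp_nat_mul, ← Real.exp_add]; simp
    rw [cutIntegrand, h6, mul_pow]
    linear_combination (-√(1 - r ^ 2 * Real.exp (-(2 * s))) ^ (2 * (k + 1) + 1)) * h7
  have h4 := MeasureTheory.integral_Ioi_of_hasDerivAt_of_tendsto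
    (continuous_cutIntegrand r (k + 1) (k + 1)).continuousWithinAt
    (f' := fun s => ((2 * k + 3) * r ^ 2) * cutIntegrand r k (k + 1) s)
    (fun s hs => (hasDerivAt_cutIntegrand_succ k k (lt_exp_sq hr hs)).congr_deriv (by ring))
    (h2.const_mul _) hlim
  rw [cutIntegrand_log r hr, MeasureTheory.integral_const_mul, sub_zero] at h4
  exact h4

/-- A Beta integral evaluated by induction on `n`: the factor `2n + 3` from the double factorial
cancels the one in the recurrence, leaving `(n - k)/(r²/2)`. -/
theorem doubleFactorial_mul_cutIntegral {r : ℝ} (hr : 0 < r) (k : ℕ) {n : ℕ} (hkn : k < n) :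
    ((2 * n + 1)‼ : ℝ) * cutIntegral r k n =
      1 / 2 * ((2 * k + 1)‼ : ℝ) * ((r ^ 2 / 2) ^ (-((n : ℤ) - k)) * Real.Gamma ((n : ℝ) - k)) := by
  induction n, hkn using Nat.le_induction with
  | base =>
    have h1 := cutIntegral_self_succ hr k
    have h2 : ((2 * (k + 1) + 1)‼ : ℝ) = (2 * k + 3) * ((2 * k + 1)‼ : ℝ) := by
      rw [show 2 * (k + 1) + 1 = (2 * k + 1) + 2 by ring, Nat.doubleFactorial_add_two]
      push_cast; ring
    rw [Nat.succ_eq_add_one, h2]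
    have h3 : ((k + 1 : ℕ) : ℝ) - k = 1 := by push_cast; ring
    have h4 : -(((k + 1 : ℕ) : ℤ) - k) = -1 := by push_cast; ring
    rw [h3, h4, Real.Gamma_one, zpow_neg_one]
    field_simp
    linear_combination h1
  | succ n hn ih =>
    have h1 := cutIntegral_succ hr (k := k) (n := n) hn
    have h2 : ((2 * (n + 1) + 1)‼ : ℝ) = (2 * n + 3) * ((2 * n + 1)‼ : ℝ) := by
      rw [show 2 * (n + 1) + 1 = (2 * n + 1) + 2 by ring, Nat.doubleFactorial_add_two]
      push_cast; ring
    have hnk : (0 : ℝ) < (n : ℝ) - k := by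
      have : (k : ℝ) < n := by exact_mod_cast hn
      linarith
    have h3 : Real.Gamma (((n + 1 : ℕ) : ℝ) - k) = (n - k) * Real.Gamma ((n : ℝ) - k) := by
      rw [← Real.Gamma_add_one hnk.ne']; congr 1; push_cast; ring
    have h4 : (r ^ 2 / 2) ^ (-(((n + 1 : ℕ) : ℤ) - k)) =
        (r ^ 2 / 2) ^ (-((n : ℤ) - k)) * (2 / r ^ 2) := by
      rw [show -(((n + 1 : ℕ) : ℤ) - k) = -((n : ℤ) - k) - 1 by push_cast; ring,
        zpow_sub_one₀ (by positivity), inv_div]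
    rw [h2, h3, h4]
    have h5 : (2 * (n : ℝ) + 3) * cutIntegral r k (n + 1) = 2 * (n - k) / r ^ 2 * cutIntegral r k n := by
      field_simp; linear_combination h1
    calc (2 * (n : ℝ) + 3) * ((2 * n + 1)‼ : ℝ) * cutIntegral r k (n + 1)
        = ((2 * n + 1)‼ : ℝ) * ((2 * n + 3) * cutIntegral r k (n + 1)) := by ring
      _ = 2 * (n - k) / r ^ 2 * (((2 * n + 1)‼ : ℝ) * cutIntegral r k n) := by rw [h5]; ring
      _ = _ := by rw [ih]; ring

theorem integral_le_cutIntegral {r : ℝ} {k n : ℕ} (hkn : k < n) {b : ℝ} (hb : Real.log r ≤ b) :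
    ∫ s in (Real.log r)..b, cutIntegrand r k n s ≤ cutIntegral r k n := by
  rw [intervalIntegral.integral_of_le hb]
  exact MeasureTheory.setIntegral_mono_set (integrableOn_cutIntegrand r hkn _)
    (MeasureTheory.ae_of_all _ fun s => cutIntegrand_nonneg r k n s) Set.Ioc_subset_Ioi_self.eventuallyLE

/-- `exp (-(2n+1)b)` is negligible against the Laplace integrals, for `b > log r`. -/
theorem isBigO_exp_cutIntegral {r : ℝ} (hr : 0 < r) (k : ℕ) {b : ℝ} (hb : Real.log r < b) :
    (fun n : ℕ => Real.exp (-((2 * n + 1 : ℕ) * b))) =O[atTop] fun n => cutIntegral r k n := by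
  -- On `[log r, b]` the exponential is at least its value at `b`, so `c` times that value bounds
  -- the integral from below.
  set c : ℝ := ∫ s in (Real.log r)..b, Real.sqrt (Real.exp s ^ 2 - r ^ 2) ^ (2 * k + 1) with hc
  have hcont : Continuous fun s : ℝ => Real.sqrt (Real.exp s ^ 2 - r ^ 2) ^ (2 * k + 1) := by fun_prop
  have hc0 : 0 < c := intervalIntegral.intervalIntegral_pos_of_pos_on (hcont.intervalIntegrable _ _)
    (fun s hs => by
      have := lt_exp_sq hr hs.1
      have : 0 < Real.exp s ^ 2 - r ^ 2 := by linarith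
      positivity) hb
  refine IsBigO.of_bound (1 / c) ?_
  filter_upwards [eventually_gt_atTop k] with n hn
  have h1 : c * Real.exp (-((2 * n + 1 : ℕ) * b)) ≤ cutIntegral r k n := by
    refine le_trans ?_ (integral_le_cutIntegral hn hb.le)
    rw [hc, ← intervalIntegral.integral_mul_const]
    refine intervalIntegral.integral_mono_on hb.le ((hcont.mul_const _).intervalIntegrable _ _)
      ((continuous_cutIntegrand r k n).intervalIntegrable _ _) fun s hs => ?_
    unfold cutIntegrand
    gcongr
    exact hs.2
  have h2 : 0 < Real.exp (-((2 * n + 1 : ℕ) * b)) := Real.exp_pos _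
  rw [Real.norm_of_nonneg h2.le, Real.norm_of_nonneg ((mul_pos hc0 h2).le.trans h1),
    one_div_mul_eq_div, le_div_iff₀ hc0, mul_comm]
  exact h1

theorem isBigO_tail_cutIntegrand (r : ℝ) (k : ℕ) (b : ℝ) :
    (fun n : ℕ => ∫ s in Set.Ioi b, cutIntegrand r k n s) =O[atTop]
      fun n : ℕ => Real.exp (-((2 * n + 1 : ℕ) * b)) := by
  refine IsBigO.of_bound (Real.exp ((2 * k + 1) * b)) ?_
  filter_upwards [eventually_gt_atTop k] with n hn
  have hpos : 1 ≤ ((n - k : ℕ) : ℝ) := by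
    have : 0 < n - k := Nat.sub_pos_of_lt hn
    exact_mod_cast this
  have h1 : ∫ s in Set.Ioi b, cutIntegrand r k n s ≤
      ∫ s in Set.Ioi b, Real.exp (-(2 * (n - k : ℕ)) * s) :=
    MeasureTheory.integral_mono (integrableOn_cutIntegrand r hn b)
      (exp_neg_integrableOn_Ioi b (by linarith)) (cutIntegrand_le r hn)
  have h2 : 0 ≤ ∫ s in Set.Ioi b, cutIntegrand r k n s :=
    MeasureTheory.integral_nonneg fun s => cutIntegrand_nonneg r k n s
  rw [Real.norm_of_nonneg h2, Real.norm_of_nonneg (Real.exp_pos _).le, ← Real.exp_add]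
  refine h1.trans ?_
  rw [integral_exp_mul_Ioi (by linarith)]
  have h3 : -(2 * ((n - k : ℕ) : ℝ)) * b = (2 * k + 1) * b + -((2 * n + 1 : ℕ) * b) := by
    push_cast [Nat.cast_sub hn.le]; ring
  rw [h3, neg_div, ← div_neg, neg_neg]
  exact div_le_self (Real.exp_pos _).le (by linarith)

/-- Termwise integration of an expansion at the branch point. -/
theorem isBigO_integral_sub_sum_cutIntegral {r b C : ℝ} (hr : 0 < r) (hb : Real.log r < b)
    {G : ℝ → ℝ} (hG : ContinuousOn G (Set.Icc (Real.log r) b)) (c : ℕ → ℝ) (R : ℕ)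
    (hC : ∀ s ∈ Set.Ioc (Real.log r) b,
      |G s - ∑ k ∈ Finset.range R, c k * Real.sqrt (Real.exp s ^ 2 - r ^ 2) ^ (2 * k + 1)| ≤
        C * Real.sqrt (Real.exp s ^ 2 - r ^ 2) ^ (2 * R + 1)) :
    (fun n : ℕ => (∫ s in (Real.log r)..b, G s * Real.exp (-((2 * n + 1 : ℕ) * s))) -
        ∑ k ∈ Finset.range R, c k * cutIntegral r k n) =O[atTop] fun n => cutIntegral r R n := by
  -- Each power is integrated to infinity at the cost of a tail beyond `b`, which is exponentially
  -- smaller.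
  have hsplit : ∀ᶠ n : ℕ in atTop,
      (∫ s in (Real.log r)..b, (G s * Real.exp (-((2 * n + 1 : ℕ) * s)) -
          ∑ k ∈ Finset.range R, c k * cutIntegrand r k n s)) -
        ∑ k ∈ Finset.range R, c k * ∫ s in Set.Ioi b, cutIntegrand r k n s =
      (∫ s in (Real.log r)..b, G s * Real.exp (-((2 * n + 1 : ℕ) * s))) -
        ∑ k ∈ Finset.range R, c k * cutIntegral r k n := by
    filter_upwards [eventually_gt_atTop R] with n hn
    have h1 : IntervalIntegrable (fun s => G s * Real.exp (-((2 * n + 1 : ℕ) * s)))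
        MeasureTheory.volume (Real.log r) b := by
      refine ContinuousOn.intervalIntegrable ?_
      rw [Set.uIcc_of_le hb.le]
      exact hG.mul (by fun_prop)
    have h2 : ∀ k, IntervalIntegrable (fun s => c k * cutIntegrand r k n s)
        MeasureTheory.volume (Real.log r) b := fun k =>
      ((continuous_cutIntegrand r k n).const_mul _).intervalIntegrable _ _
    have h3 : IntervalIntegrable (fun s => ∑ k ∈ Finset.range R, c k * cutIntegrand r k n s)
        MeasureTheory.volume (Real.log r) b :=
      (continuous_finsetSum _ fun k _ =>
        (continuous_cutIntegrand r k n).const_mul (c k)).intervalIntegrable _ _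
    rw [intervalIntegral.integral_sub h1 h3,
      intervalIntegral.integral_finsetSum fun k _ => h2 k, sub_sub, ← Finset.sum_add_distrib]
    congr 1
    refine Finset.sum_congr rfl fun k hk => ?_
    have hkn : k < n := (Finset.mem_range.1 hk).trans hn
    rw [intervalIntegral.integral_const_mul, ← mul_add, cutIntegral,
      intervalIntegral.integral_of_le hb.le, ← MeasureTheory.setIntegral_union
        (Set.Ioc_disjoint_Ioi le_rfl) measurableSet_Ioi
        ((integrableOn_cutIntegrand r hkn (Real.log r)).mono_set Set.Ioc_subset_Ioi_self)
        (integrableOn_cutIntegrand r hkn b), Set.Ioc_union_Ioi_eq_Ioi hb.le]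
  refine IsBigO.congr' ?_ hsplit EventuallyEq.rfl
  refine IsBigO.sub ?_ (IsBigO.fun_sum fun k _ =>
    ((isBigO_tail_cutIntegrand r k b).trans (isBigO_exp_cutIntegral hr R hb)).const_mul_left _)
  refine IsBigO.of_bound |C| ?_
  filter_upwards [eventually_gt_atTop R] with n hn
  have h3 : ‖∫ s in (Real.log r)..b, (G s * Real.exp (-((2 * n + 1 : ℕ) * s)) -
      ∑ k ∈ Finset.range R, c k * cutIntegrand r k n s)‖ ≤
        ∫ s in (Real.log r)..b, |C| * cutIntegrand r R n s := by
    refine intervalIntegral.norm_integral_le_of_norm_le hb.le (MeasureTheory.ae_of_all _ fun s hs => ?_)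
      (((continuous_cutIntegrand r R n).const_mul _).intervalIntegrable _ _)
    have h4 : G s * Real.exp (-((2 * n + 1 : ℕ) * s)) -
        ∑ k ∈ Finset.range R, c k * cutIntegrand r k n s =
        (G s - ∑ k ∈ Finset.range R, c k * Real.sqrt (Real.exp s ^ 2 - r ^ 2) ^ (2 * k + 1)) *
          Real.exp (-((2 * n + 1 : ℕ) * s)) := by
      rw [sub_mul, Finset.sum_mul]
      simp only [cutIntegrand, mul_assoc]
    rw [h4, norm_mul, Real.norm_eq_abs, Real.norm_of_nonneg (Real.exp_pos _).le, cutIntegrand,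
      ← mul_assoc]
    refine mul_le_mul_of_nonneg_right ((hC s hs).trans ?_) (Real.exp_pos _).le
    exact mul_le_mul_of_nonneg_right (le_abs_self C) (by positivity)
  refine h3.trans ?_
  rw [intervalIntegral.integral_const_mul]
  exact mul_le_mul_of_nonneg_left ((integral_le_cutIntegral hn hb.le).trans (Real.le_norm_self _))
    (abs_nonneg C)

/-! ### Coefficients as integrals over the boundary of a half annulus -/

theorem integral_cos_int_mul_zero_pi (j m : ℕ) :
    ∫ θ in (0 : ℝ)..Real.pi, Real.cos (((j : ℝ) - m) * θ) = if j = m then Real.pi else 0 := by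
  split_ifs with h
  · subst h; simp
  · have h0 : (j : ℝ) - m ≠ 0 := sub_ne_zero.2 (by exact_mod_cast h)
    rw [intervalIntegral.integral_comp_mul_left _ h0, integral_cos]
    have : Real.sin (((j : ℝ) - m) * Real.pi) = 0 := by
      have := Real.sin_int_mul_pi ((j : ℤ) - m)
      push_cast at this; exact this
    simp [this]

theorem IsAction.hasSum_sol {S : ℂ → ℂ} (h : IsAction S) {y : ℂ} (hy : y ∈ solDisc S) :
    HasSum (fun n => ((PowerSeries.coeff n (localSolution (maclaurin S)) : ℝ) : ℂ) * y ^ n)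
      (sol S y) := by
  have := h.hasFPowerSeriesOnBall_sol.hasSum hy
  rw [zero_add] at this
  refine this.congr_fun fun n => ?_
  rw [complexSeries, FormalMultilinearSeries.ofScalars_apply_eq, smul_eq_mul]

theorem IsAction.summable_norm_coeff {S : ℂ → ℂ} (h : IsAction S) {a : ℝ} (ha : 0 ≤ a)
    (hy : (a : ℂ) ∈ solDisc S) :
    Summable fun n => |PowerSeries.coeff n (localSolution (maclaurin S))| * a ^ n := by
  have := (h.hasSum_sol hy).summable.norm
  refine this.congr fun n => ?_
  rw [norm_mul, norm_pow, Complex.norm_real, Complex.norm_real, Real.norm_eq_abs,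
    Real.norm_of_nonneg ha]

/-- As the coefficients are real, the real part is a cosine series, and `cos ((n - m) θ)` integrates
to zero over `[0, π]` for `n ≠ m`. Hence half a circle suffices. -/
theorem IsAction.integral_halfCircle {S : ℂ → ℂ} (h : IsAction S) {a : ℝ}
    (ha : ((Real.exp a : ℝ) : ℂ) ∈ solDisc S) (m : ℕ) :
    ∫ θ in (0 : ℝ)..Real.pi, (sol S (Complex.exp (a + θ * Complex.I)) *
        Complex.exp (-(m * (a + θ * Complex.I)))).re =
      Real.pi * PowerSeries.coeff m (localSolution (maclaurin S)) := by
  set c : ℕ → ℝ := fun n => PowerSeries.coeff n (localSolution (maclaurin S)) with hc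
  have hmem : ∀ θ : ℝ, Complex.exp (a + θ * Complex.I) ∈ solDisc S := by
    intro θ
    rw [solDisc, convergenceDisc, Metric.mem_eball, edist_zero_right] at *
    rw [← ofReal_norm, Complex.norm_exp] at *
    rw [Complex.norm_of_nonneg (Real.exp_pos a).le] at ha
    simpa using ha
  have hexp : ∀ (n : ℕ) (θ : ℝ), ((c n : ℂ) * Complex.exp (a + θ * Complex.I) ^ n *
        Complex.exp (-(m * (a + θ * Complex.I)))).re =
      c n * Real.exp ((n - m) * a) * Real.cos (((n : ℝ) - m) * θ) := by
    intro n θ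
    rw [← Complex.exp_nat_mul, mul_assoc, ← Complex.exp_add, Complex.re_ofReal_mul, mul_assoc]
    congr 1
    have : (n : ℂ) * (a + θ * Complex.I) + -(m * (a + θ * Complex.I)) =
        (((n - m) * a : ℝ) : ℂ) + (((n - m) * θ : ℝ) : ℂ) * Complex.I := by push_cast; ring
    rw [this, Complex.exp_re]
    simp
  have hsum := intervalIntegral.hasSum_integral_of_dominated_convergence (μ := MeasureTheory.volume)
    (a := 0) (b := Real.pi)
    (F := fun n θ => c n * Real.exp ((n - m) * a) * Real.cos (((n : ℝ) - m) * θ))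
    (f := fun θ => (sol S (Complex.exp (a + θ * Complex.I)) *
        Complex.exp (-(m * (a + θ * Complex.I)))).re)
    (fun n _ => |c n| * Real.exp a ^ n * Real.exp (-(m * a)))
    (fun n => (by fun_prop : Continuous _).aestronglyMeasurable)
    (fun n => MeasureTheory.ae_of_all _ fun θ _ => ?_)
    (MeasureTheory.ae_of_all _ fun θ _ =>
      (h.summable_norm_coeff (Real.exp_pos a).le ha).mul_right _)
    intervalIntegrable_const
    (MeasureTheory.ae_of_all _ fun θ _ => ?_)
  · rw [← hsum.tsum_eq, tsum_eq_single m]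
    · rw [intervalIntegral.integral_const_mul, integral_cos_int_mul_zero_pi, if_pos rfl]
      simp [mul_comm, hc]
    · intro n hn
      rw [intervalIntegral.integral_const_mul, integral_cos_int_mul_zero_pi, if_neg hn, mul_zero]
  · rw [norm_mul, norm_mul, Real.norm_eq_abs, Real.norm_of_nonneg (Real.exp_pos _).le,
      ← Real.exp_nat_mul, mul_assoc _ (Real.exp _) (Real.exp _), ← Real.exp_add]
    have : (n : ℝ) * a + -(m * a) = (n - m) * a := by ring
    rw [this]
    exact mul_le_of_le_one_right (by positivity) (Real.abs_cos_le_one _)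
  · have h1 := Complex.hasSum_re ((h.hasSum_sol (hmem θ)).mul_right
      (Complex.exp (-(m * (a + θ * Complex.I)))))
    exact h1.congr_fun fun n => (hexp n θ).symm

/-- The imaginary part of Cauchy's theorem for `X(e^w) e^(-mw)` on the rectangle `[a, b] × [0, π]`:
in `w = log y` half circles become vertical sides, and the two real rays become the horizontal ones.
-/
theorem IsAction.pi_mul_coeff {S : ℂ → ℂ} (h : IsAction S) {r R : ℝ} (hD : solDisc S = Metric.ball 0 r)
    {X : ℂ → ℂ} (hX : IsUpperExtension (sol S) r X (Metric.ball 0 R)) {a b : ℝ} (ha : Real.exp a < r)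
    (hab : a ≤ b) (hb : Real.exp b < R) (m : ℕ) :
    Real.pi * PowerSeries.coeff m (localSolution (maclaurin S)) =
      (∫ θ in (0 : ℝ)..Real.pi, X (Complex.exp (b + θ * Complex.I)) *
        Complex.exp (-(m * (b + θ * Complex.I)))).re +
      ((∫ s in a..b, (X ((Real.exp s : ℝ) : ℂ)).im * Real.exp (-(m * s))) -
        (-1) ^ m * ∫ s in a..b, (X (-(Real.exp s : ℝ) : ℂ)).im * Real.exp (-(m * s))) := by
  have hmaps : Set.MapsTo Complex.exp (Set.uIcc a b ×ℂ Set.uIcc 0 Real.pi) (Metric.ball 0 R ∩ upper) := by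
    intro w hw
    rw [Complex.mem_reProdIm, Set.uIcc_of_le hab, Set.uIcc_of_le Real.pi_pos.le] at hw
    refine ⟨?_, ?_⟩
    · rw [mem_ball_zero_iff, Complex.norm_exp]
      exact (Real.exp_le_exp.2 hw.1.2).trans_lt hb
    · change 0 ≤ (Complex.exp w).im
      rw [Complex.exp_im]
      exact mul_nonneg (Real.exp_pos _).le (Real.sin_nonneg_of_mem_Icc hw.2)
  have hmaps' : Set.MapsTo Complex.exp (Set.Ioo a b ×ℂ Set.Ioo 0 Real.pi)
      (Metric.ball 0 R ∩ {y | 0 < y.im}) := by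
    intro w hw
    rw [Complex.mem_reProdIm] at hw
    refine ⟨?_, ?_⟩
    · rw [mem_ball_zero_iff, Complex.norm_exp]
      exact (Real.exp_lt_exp.2 hw.1.2).trans hb
    · change 0 < (Complex.exp w).im
      rw [Complex.exp_im]
      exact mul_pos (Real.exp_pos _) (Real.sin_pos_of_mem_Ioo hw.2)
  set F : ℂ → ℂ := fun w => X (Complex.exp w) * Complex.exp (-(m * w)) with hF
  have hFc : ContinuousOn F (Set.uIcc a b ×ℂ Set.uIcc 0 Real.pi) :=
    (hX.continuousOn.comp Complex.continuous_exp.continuousOn hmaps).mul (by fun_prop)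
  have hFd : DifferentiableOn ℂ F (Set.Ioo a b ×ℂ Set.Ioo 0 Real.pi) :=
    (hX.differentiableOn.comp Complex.differentiable_exp.differentiableOn hmaps').mul (by fun_prop)
  have hrect := Complex.integral_boundary_rect_eq_zero_of_continuousOn_of_differentiableOn F
    (a : ℂ) (b + Real.pi * Complex.I) (by simpa using hFc)
    (by simpa [hab, Real.pi_pos.le] using hFd)
  simp only [Complex.ofReal_re, Complex.ofReal_im, Complex.add_re, Complex.add_im, Complex.mul_re,
    Complex.mul_im, Complex.I_re, Complex.I_im, mul_zero, mul_one, zero_add, add_zero,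
    Complex.ofReal_zero, zero_mul, sub_self] at hrect
  have hint : ∀ {t : ℝ}, t ∈ Set.Icc 0 Real.pi → IntervalIntegrable (fun s : ℝ => F (s + t * Complex.I))
      MeasureTheory.volume a b := by
    intro t ht
    refine ContinuousOn.intervalIntegrable (hFc.comp (by fun_prop) fun s hs => ?_)
    rw [Complex.mem_reProdIm, Set.uIcc_of_le Real.pi_pos.le]
    simpa using ⟨hs, ht⟩
  have hint' : ∀ {t : ℝ}, t ∈ Set.Icc a b → IntervalIntegrable (fun θ : ℝ => F (t + θ * Complex.I))
      MeasureTheory.volume 0 Real.pi := by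
    intro t ht
    refine ContinuousOn.intervalIntegrable (hFc.comp (by fun_prop) fun s hs => ?_)
    rw [Complex.mem_reProdIm, Set.uIcc_of_le hab]
    simpa using ⟨ht, hs⟩
  have him : ∀ {f : ℝ → ℂ} {u v : ℝ}, IntervalIntegrable f MeasureTheory.volume u v →
      (∫ s in u..v, f s).im = ∫ s in u..v, (f s).im := fun hf =>
    (intervalIntegral.intervalIntegral_im hf).symm
  have hre : ∀ {f : ℝ → ℂ} {u v : ℝ}, IntervalIntegrable f MeasureTheory.volume u v →
      (∫ s in u..v, f s).re = ∫ s in u..v, (f s).re := fun hf =>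
    (intervalIntegral.intervalIntegral_re hf).symm
  have hbot := him (hint ⟨le_rfl, Real.pi_pos.le⟩)
  have htop := him (hint ⟨Real.pi_pos.le, le_rfl⟩)
  have hleft := hre (hint' ⟨le_rfl, hab⟩)
  have hcoef := h.integral_halfCircle (a := a)
    (by rw [hD, mem_ball_zero_iff, Complex.norm_of_nonneg (Real.exp_pos a).le]; exact ha) m
  have hleft' : ∫ θ in (0 : ℝ)..Real.pi, (F (a + θ * Complex.I)).re =
      ∫ θ in (0 : ℝ)..Real.pi, (sol S (Complex.exp (a + θ * Complex.I)) *
        Complex.exp (-(m * (a + θ * Complex.I)))).re := by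
    refine intervalIntegral.integral_congr fun θ hθ => ?_
    have hmem := hmaps (x := a + θ * Complex.I)
      (by rw [Complex.mem_reProdIm]; simpa using hθ)
    have h1 : Complex.exp (a + θ * Complex.I) ∈ Metric.ball (0 : ℂ) r := by
      rw [mem_ball_zero_iff, Complex.norm_exp]; simpa using ha
    simp only [hF]
    rw [hX.eqOn ⟨⟨hmem.1, h1⟩, hmem.2⟩]
  have hbot' : ∫ s in a..b, (F (s + (0 : ℝ) * Complex.I)).im =
      ∫ s in a..b, (X ((Real.exp s : ℝ) : ℂ)).im * Real.exp (-(m * s)) := by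
    refine intervalIntegral.integral_congr fun s _ => ?_
    simp only [hF, Complex.ofReal_zero, zero_mul, add_zero]
    have : Complex.exp (-(m * s)) = ((Real.exp (-(m * s)) : ℝ) : ℂ) := by push_cast; rfl
    rw [this, Complex.im_mul_ofReal, Complex.ofReal_exp]
  have htop' : ∫ s in a..b, (F (s + Real.pi * Complex.I)).im =
      (-1) ^ m * ∫ s in a..b, (X (-(Real.exp s : ℝ) : ℂ)).im * Real.exp (-(m * s)) := by
    rw [← intervalIntegral.integral_const_mul]
    refine intervalIntegral.integral_congr fun s _ => ?_
    simp only [hF]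
    have h1 : Complex.exp (s + Real.pi * Complex.I) = -((Real.exp s : ℝ) : ℂ) := by
      rw [Complex.exp_add, Complex.exp_pi_mul_I]; push_cast; ring
    have h2 : Complex.exp (-(m * (s + Real.pi * Complex.I))) =
        (((-1) ^ m * Real.exp (-(m * s)) : ℝ) : ℂ) := by
      have h3 : (-(m * (s + Real.pi * Complex.I)) : ℂ) = -(m * s) + m * (-(Real.pi * Complex.I)) := by
        ring
      have h4 : Complex.exp (-(Real.pi * Complex.I)) = -1 := by
        rw [Complex.exp_neg, Complex.exp_pi_mul_I]; norm_num
      rw [h3, Complex.exp_add, Complex.exp_nat_mul, h4]; push_cast; ring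
    rw [h1, h2, Complex.im_mul_ofReal]
    ring
  have hfin := congrArg Complex.im hrect
  simp only [Complex.sub_im, Complex.add_im, smul_eq_mul, Complex.I_mul_im, Complex.zero_im] at hfin
  simp only [Complex.ofReal_zero, zero_mul, add_zero] at hbot hbot'
  rw [hbot, hbot', htop, htop', hleft, hleft', hcoef] at hfin
  linear_combination -hfin

theorem IsUpperExtension.im_eq_zero {S X : ℂ → ℂ} {r R : ℝ}
    (hX : IsUpperExtension (sol S) r X (Metric.ball 0 R)) (hrR : r ≤ R) {u : ℝ} (hu : |u| < r) :
    (X u).im = 0 := by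
  have h1 : ((u : ℝ) : ℂ) ∈ Metric.ball (0 : ℂ) r := by simpa using hu
  rw [hX.eqOn ⟨⟨Metric.ball_subset_ball hrR h1, h1⟩, by simp [upper]⟩, sol_ofReal_im]

theorem IsUpperExtension.continuousOn_im {f X : ℂ → ℂ} {r R : ℝ}
    (hX : IsUpperExtension f r X (Metric.ball 0 R)) {ε : ℝ} (hε : |ε| = 1) {b : ℝ}
    (hb : Real.exp b < R) :
    ContinuousOn (fun s : ℝ => (X ((ε * Real.exp s : ℝ) : ℂ)).im) (Set.Iic b) := by
  refine Complex.continuous_im.comp_continuousOn (hX.continuousOn.comp (by fun_prop) fun s hs => ?_)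
  refine ⟨?_, by simp [upper]⟩
  rw [mem_ball_zero_iff, Complex.norm_real, Real.norm_eq_abs, abs_mul, hε, one_mul, Real.abs_exp]
  exact (Real.exp_le_exp.2 hs).trans_lt hb

/-- The part of the boundary integral along the ray in the direction `ε = ±1`. -/
def rayIntegral (X : ℂ → ℂ) (r b ε : ℝ) (m : ℕ) : ℝ :=
  ∫ s in (Real.log r)..b, (X ((ε * Real.exp s : ℝ) : ℂ)).im * Real.exp (-(m * s))

/-- Inside the disc `x(y)` is real on the real line, so that part of the ray contributes nothing;
the endpoint `log r` is a null set. -/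
theorem IsUpperExtension.integral_eq_rayIntegral {S X : ℂ → ℂ} {r R : ℝ} (hr : 0 < r)
    (hX : IsUpperExtension (sol S) r X (Metric.ball 0 R)) (hrR : r ≤ R) {ε : ℝ} (hε : |ε| = 1)
    {a b : ℝ} (ha : a ≤ Real.log r) (hrb : Real.log r ≤ b) (hb : Real.exp b < R) (m : ℕ) :
    ∫ s in a..b, (X ((ε * Real.exp s : ℝ) : ℂ)).im * Real.exp (-(m * s)) = rayIntegral X r b ε m := by
  have hc : ContinuousOn (fun s : ℝ => (X ((ε * Real.exp s : ℝ) : ℂ)).im * Real.exp (-(m * s)))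
      (Set.Iic b) := (hX.continuousOn_im hε hb).mul (by fun_prop)
  have hi : ∀ {u v : ℝ}, u ≤ b → v ≤ b → IntervalIntegrable
      (fun s : ℝ => (X ((ε * Real.exp s : ℝ) : ℂ)).im * Real.exp (-(m * s)))
      MeasureTheory.volume u v := fun hu hv =>
    ContinuousOn.intervalIntegrable (hc.mono fun s hs => hs.2.trans (max_le hu hv))
  rw [← intervalIntegral.integral_add_adjacent_intervals (hi (ha.trans hrb) hrb) (hi hrb le_rfl),
    rayIntegral, add_eq_right]
  refine intervalIntegral.integral_zero_ae ?_
  have hne : ∀ᵐ s : ℝ, s ≠ Real.log r := by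
    simp [MeasureTheory.ae_iff]
  filter_upwards [hne] with s hs hmem
  rw [Set.uIoc_of_le ha] at hmem
  have h1 : Real.exp s < r := (Real.lt_log_iff_exp_lt hr).1 (lt_of_le_of_ne hmem.2 hs)
  rw [hX.im_eq_zero hrR (by rwa [abs_mul, hε, one_mul, Real.abs_exp]), zero_mul]

/-- Up to an exponentially small error, the coefficients of `x(y)` are given by the imaginary part
of a continuation along the two real rays. -/
theorem IsAction.exists_coeff_sub_rayIntegral_le {S : ℂ → ℂ} (h : IsAction S) {r R : ℝ} (hr : 0 < r)
    (hD : solDisc S = Metric.ball 0 r) {X : ℂ → ℂ}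
    (hX : IsUpperExtension (sol S) r X (Metric.ball 0 R)) {b : ℝ} (hrb : Real.log r < b)
    (hb : Real.exp b < R) :
    ∃ C : ℝ, ∀ m : ℕ, |Real.pi * PowerSeries.coeff m (localSolution (maclaurin S)) -
      (rayIntegral X r b 1 m - (-1) ^ m * rayIntegral X r b (-1) m)| ≤ C * Real.exp (-(m * b)) := by
  have hrR : r ≤ R := (((Real.log_lt_iff_lt_exp hr).1 hrb).trans hb).le
  obtain ⟨M, hM⟩ : ∃ M, ∀ θ ∈ Set.Icc 0 Real.pi, ‖X (Complex.exp (b + θ * Complex.I))‖ ≤ M := by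
    refine isCompact_Icc.exists_bound_of_continuousOn
      (hX.continuousOn.comp (by fun_prop) fun θ hθ => ⟨?_, ?_⟩)
    · rw [mem_ball_zero_iff, Complex.norm_exp]; simpa using hb
    · change 0 ≤ (Complex.exp (b + θ * Complex.I)).im
      rw [Complex.exp_im]
      simpa using mul_nonneg (Real.exp_pos b).le (Real.sin_nonneg_of_mem_Icc hθ)
  refine ⟨M * Real.pi, fun m => ?_⟩
  have h1 := h.pi_mul_coeff hD hX (a := Real.log r - 1) (b := b)
    ((Real.lt_log_iff_exp_lt hr).1 (by linarith)) (by linarith) hb m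
  have h2 := hX.integral_eq_rayIntegral hr hrR (ε := 1) abs_one (a := Real.log r - 1) (by linarith)
    hrb.le hb m
  have h3 := hX.integral_eq_rayIntegral hr hrR (ε := -1) (by simp) (a := Real.log r - 1) (by linarith)
    hrb.le hb m
  simp only [one_mul] at h2
  simp only [neg_mul, one_mul, Complex.ofReal_neg] at h3
  rw [h1, h2, h3, add_sub_cancel_right]
  refine (Complex.abs_re_le_norm _).trans ?_
  have h4 := intervalIntegral.norm_integral_le_of_norm_le_const (a := 0) (b := Real.pi)
    (f := fun θ : ℝ => X (Complex.exp (b + θ * Complex.I)) *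
        Complex.exp (-(m * (b + θ * Complex.I)))) (C := M * Real.exp (-(m * b))) fun θ hθ => by
      rw [Set.uIoc_of_le Real.pi_pos.le] at hθ
      rw [norm_mul, Complex.norm_exp]
      have : (-(m * (b + θ * Complex.I)) : ℂ).re = -(m * b) := by simp
      rw [this]
      exact mul_le_mul_of_nonneg_right (hM θ ⟨hθ.1.le, hθ.2⟩) (Real.exp_pos _).le
  refine h4.trans_eq ?_
  rw [sub_zero, abs_of_pos Real.pi_pos]
  ring

/-! ### Contribution of a real ray -/

theorem sum_range_two_mul_add_one_of_even_eq_zero {M : Type*} [AddCommMonoid M] (f : ℕ → M)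
    (hf : ∀ k, f (2 * k) = 0) (N : ℕ) :
    ∑ j ∈ Finset.range (2 * N + 1), f j = ∑ k ∈ Finset.range N, f (2 * k + 1) := by
  induction N with
  | zero => simpa using hf 0
  | succ N ih =>
    rw [show 2 * (N + 1) + 1 = 2 * N + 1 + 1 + 1 by ring, Finset.sum_range_succ,
      Finset.sum_range_succ, ih, Finset.sum_range_succ, show 2 * N + 1 + 1 = 2 * (N + 1) by ring, hf,
      add_zero]

/-- With real Taylor coefficients the even powers of `iv` are real, and the odd ones give the signs
`(-1)^k`. -/
theorem exists_im_I_mul_sub_le {ψ : ℂ → ℂ} (hψ : AnalyticAt ℂ ψ 0)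
    (hr : ∀ᶠ t : ℝ in 𝓝 0, (ψ t).im = 0) (N : ℕ) :
    ∃ C : ℝ, ∀ᶠ v : ℝ in 𝓝 0, |(ψ (Complex.I * v)).im - ∑ k ∈ Finset.range N,
      (-1) ^ k * PowerSeries.coeff (2 * k + 1) (maclaurin ψ) * v ^ (2 * k + 1)| ≤
        C * |v| ^ (2 * N + 1) := by
  obtain ⟨g, hg, h⟩ := exists_taylor_remainder hψ (2 * N + 1)
  have hlim : Tendsto (fun v : ℝ => Complex.I * (v : ℂ)) (𝓝 0) (𝓝 0) := by
    have := (by fun_prop : Continuous fun v : ℝ => Complex.I * (v : ℂ)).tendsto 0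
    simpa using this
  have hb : ∀ᶠ z in 𝓝 (0 : ℂ), ‖g z‖ < ‖g 0‖ + 1 :=
    hg.continuousAt.norm.eventually_lt_const (by linarith)
  refine ⟨‖g 0‖ + 1, ?_⟩
  filter_upwards [hlim.eventually h, hlim.eventually hb] with v h1 h2
  have h3 : ∀ j, PowerSeries.coeff j (taylor ψ) = ((PowerSeries.coeff j (maclaurin ψ) : ℝ) : ℂ) := by
    intro j; rw [← map_maclaurin hψ hr, PowerSeries.coeff_map]; rfl
  have h4 : (∑ j ∈ Finset.range (2 * N + 1), PowerSeries.coeff j (taylor ψ) *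
      (Complex.I * v) ^ j).im = ∑ k ∈ Finset.range N,
      (-1) ^ k * PowerSeries.coeff (2 * k + 1) (maclaurin ψ) * v ^ (2 * k + 1) := by
    rw [Complex.im_sum, sum_range_two_mul_add_one_of_even_eq_zero]
    · refine Finset.sum_congr rfl fun k _ => ?_
      rw [h3, mul_pow, pow_succ, pow_mul, Complex.I_sq]
      have : ((PowerSeries.coeff (2 * k + 1) (maclaurin ψ) : ℝ) : ℂ) *
          ((-1) ^ k * Complex.I * (v : ℂ) ^ (2 * k + 1)) =
          (((-1) ^ k * PowerSeries.coeff (2 * k + 1) (maclaurin ψ) * v ^ (2 * k + 1) : ℝ) : ℂ) *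
            Complex.I := by push_cast; ring
      rw [this, Complex.im_ofReal_mul, Complex.I_im, mul_one]
    · intro k
      rw [h3, mul_pow, pow_mul, Complex.I_sq]
      have : ((PowerSeries.coeff (2 * k) (maclaurin ψ) : ℝ) : ℂ) *
          ((-1) ^ k * (v : ℂ) ^ (2 * k)) =
          ((PowerSeries.coeff (2 * k) (maclaurin ψ) * ((-1) ^ k * v ^ (2 * k)) : ℝ) : ℂ) := by
        push_cast; ring
      rw [this, Complex.ofReal_im]
  rw [h1, Complex.add_im, h4, add_sub_cancel_left]
  refine (Complex.abs_im_le_norm _).trans ?_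
  rw [norm_mul, norm_pow, norm_mul, Complex.norm_I, one_mul, Complex.norm_real, Real.norm_eq_abs,
    mul_comm]
  exact mul_le_mul_of_nonneg_right h2.le (by positivity)

theorem IsUpperExtension.eventually_eq {f X g : ℂ → ℂ} {r R δ ε : ℝ} (hr : 0 < r) (hrR : r < R)
    (hδ : 0 < δ) (hε : |ε| = 1) (hX : IsUpperExtension f r X (Metric.ball 0 R))
    (hg : IsUpperExtension f r g (Metric.ball ((ε * r : ℝ) : ℂ) δ)) :
    ∀ᶠ u : ℝ in 𝓝[>] r, X ((ε * u : ℝ) : ℂ) = g ((ε * u : ℝ) : ℂ) := by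
  have hn : ‖((ε * r : ℝ) : ℂ)‖ = r := by
    rw [Complex.norm_real, Real.norm_eq_abs, abs_mul, hε, one_mul, abs_of_pos hr]
  have hV : IsOpen (Metric.ball (0 : ℂ) R ∩ Metric.ball ((ε * r : ℝ) : ℂ) δ) :=
    Metric.isOpen_ball.inter Metric.isOpen_ball
  have hmem : ((ε * r : ℝ) : ℂ) ∈ Metric.ball (0 : ℂ) R ∩ Metric.ball ((ε * r : ℝ) : ℂ) δ :=
    ⟨by rwa [mem_ball_zero_iff, hn], Metric.mem_ball_self hδ⟩
  have heq := hX.eqOn_inter hg hV ((convex_ball _ _).inter (convex_ball _ _))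
    (nonempty_inter_ball_inter_upper hV hr hmem hn.le (by simp))
  have hcont : Tendsto (fun u : ℝ => ((ε * u : ℝ) : ℂ)) (𝓝[>] r) (𝓝 ((ε * r : ℝ) : ℂ)) :=
    ((by fun_prop : Continuous fun u : ℝ => ((ε * u : ℝ) : ℂ)).tendsto r).mono_left
      nhdsWithin_le_nhds
  filter_upwards [hcont.eventually (hV.mem_nhds hmem)] with u hu
  exact heq ⟨hu, by simp [upper]⟩

theorem eventually_forall_Ioc_log {r : ℝ} (hr : 0 < r) {p : ℝ → Prop} (h : ∀ᶠ u in 𝓝[>] r, p u) :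
    ∀ᶠ b in 𝓝[>] (Real.log r), ∀ s ∈ Set.Ioc (Real.log r) b, p (Real.exp s) := by
  have h1 : Tendsto Real.exp (𝓝[>] (Real.log r)) (𝓝[>] r) := by
    refine tendsto_nhdsWithin_iff.2 ⟨?_, ?_⟩
    · have := Real.continuous_exp.tendsto (Real.log r)
      rw [Real.exp_log hr] at this
      exact this.mono_left nhdsWithin_le_nhds
    · filter_upwards [self_mem_nhdsWithin] with s hs
      exact (Real.log_lt_iff_lt_exp hr).1 hs
  obtain ⟨c, hc, hsub⟩ := mem_nhdsGT_iff_exists_Ioo_subset.1 (h1.eventually h)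
  have hIoo : ∀ᶠ b in 𝓝[>] (Real.log r), b ∈ Set.Ioo (Real.log r) c := Ioo_mem_nhdsGT hc
  filter_upwards [hIoo] with b hb s hs
  exact hsub ⟨hs.1, hs.2.trans_lt hb.2⟩

theorem eventually_exp_lt {r R : ℝ} (hr : 0 < r) (hrR : r < R) :
    ∀ᶠ b in 𝓝[>] (Real.log r), Real.exp b < R := by
  have := Real.continuous_exp.tendsto (Real.log r)
  rw [Real.exp_log hr] at this
  exact (this.mono_left nhdsWithin_le_nhds).eventually_lt_const hrR

/-- A point of the circle of convergence that is not singular does not contribute. -/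
theorem IsUpperExtension.rayIntegral_eq_zero {S X : ℂ → ℂ} {r R ε : ℝ} (hr : 0 < r) (hrR : r < R)
    (hε : |ε| = 1) (hD : solDisc S = Metric.ball 0 r)
    (hX : IsUpperExtension (sol S) r X (Metric.ball 0 R))
    (hg : ∃ g : ℂ → ℂ, AnalyticAt ℂ g ((ε * r : ℝ) : ℂ) ∧
      g =ᶠ[𝓝[solDisc S] ((ε * r : ℝ) : ℂ)] sol S) :
    ∀ᶠ b in 𝓝[>] (Real.log r), ∀ m, rayIntegral X r b ε m = 0 := by
  obtain ⟨δ, hδ, g, hga, hg⟩ := exists_isUpperExtension_of_not_singular hD hg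
  have h1 := hX.eventually_eq hr hrR hδ hε hg
  set F : ℝ → ℝ := fun u => (g ((ε * u : ℝ) : ℂ)).im with hF
  have hFa : AnalyticAt ℝ F r := by
    have h2 : AnalyticAt ℝ (fun u : ℝ => ((ε * u : ℝ) : ℂ)) r :=
      (Complex.ofRealCLM.analyticAt _).comp (by fun_prop : AnalyticAt ℝ (fun u : ℝ => ε * u) r)
    have h3 : AnalyticAt ℝ g ((ε * r : ℝ) : ℂ) := hga.restrictScalars
    exact (Complex.imCLM.analyticAt _).comp (h3.comp (f := fun u : ℝ => ((ε * u : ℝ) : ℂ)) h2)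
  have hcont : Tendsto (fun u : ℝ => ((ε * u : ℝ) : ℂ)) (𝓝[<] r) (𝓝 ((ε * r : ℝ) : ℂ)) :=
    ((by fun_prop : Continuous fun u : ℝ => ((ε * u : ℝ) : ℂ)).tendsto r).mono_left
      nhdsWithin_le_nhds
  have hIoo : ∀ᶠ u in 𝓝[<] r, u ∈ Set.Ioo 0 r := Ioo_mem_nhdsLT hr
  have h4 : ∀ᶠ u in 𝓝[<] r, F u = 0 := by
    filter_upwards [hcont.eventually (Metric.ball_mem_nhds _ hδ), hIoo] with u h5 h6
    have h7 : ((ε * u : ℝ) : ℂ) ∈ Metric.ball (0 : ℂ) r := by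
      rw [mem_ball_zero_iff, Complex.norm_real, Real.norm_eq_abs, abs_mul, hε, one_mul,
        abs_of_pos h6.1]
      exact h6.2
    simp only [hF]
    rw [hg.eqOn ⟨⟨h5, h7⟩, by simp [upper]⟩]
    exact sol_ofReal_im S _
  -- `Im g` is real analytic along the ray and zero before `r`, hence also just beyond `r`.
  have h5 : ∀ᶠ u in 𝓝 r, F u = 0 := hFa.frequently_zero_iff_eventually_zero.1
    (h4.frequently.filter_mono (nhdsWithin_mono _ fun u hu => ne_of_lt hu))
  have h6 : ∀ᶠ u in 𝓝[>] r, (X ((ε * u : ℝ) : ℂ)).im = 0 := by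
    filter_upwards [h1, h5.filter_mono nhdsWithin_le_nhds] with u h7 h8
    rw [h7]; exact h8
  filter_upwards [eventually_forall_Ioc_log hr h6, self_mem_nhdsWithin] with b hb hrb m
  have hrb : Real.log r < b := hrb
  rw [rayIntegral]
  refine intervalIntegral.integral_zero_ae (MeasureTheory.ae_of_all _ fun s hs => ?_)
  rw [Set.uIoc_of_le hrb.le] at hs
  rw [hb s hs, zero_mul]

theorem IsRealSaddle.saddleCoeff_eq {S : ℂ → ℂ} {τ ρ : ℝ} (hs : IsRealSaddle S τ ρ) (h : IsAction S)
    {ψ P : ℂ → ℂ} (hc : IsMorseChart (fun x => S τ - S (x + τ)) ψ P) (k : ℕ) :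
    saddleCoeff S τ k = 1 / (2 * Real.pi) * ((-1) ^ k *
      (((2 * k + 1)‼ : ℝ) * PowerSeries.coeff (2 * k + 1) (maclaurin ψ))) := by
  rw [saddleCoeff, PowerSeries.coeff_rescale, saddleAction,
    hc.coeff_formalIntegral_maclaurin (analyticAt_saddle h τ) (im_saddle h τ) (by simp)
      hs.deriv_saddle hs.iteratedDeriv_saddle hs.deriv2_pos]

/-- Contribution of a singularity of square-root type. -/
theorem IsUpperExtension.isBigO_rayIntegral {S X : ℂ → ℂ} {τ r R ε : ℝ} (h : IsAction S)
    (hr : 0 < r) (hrR : r < R) (hε : ε ^ 2 = 1) (hs : IsRealSaddle S τ (ε * r))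
    (hX : IsUpperExtension (sol S) r X (Metric.ball 0 R)) (N : ℕ) :
    ∀ᶠ b in 𝓝[>] (Real.log r),
      (fun n : ℕ => 1 / Real.pi * ((2 * n + 1)‼ : ℝ) * rayIntegral X r b ε (2 * n + 1) -
        ∑ k ∈ Finset.range N, saddleCoeff S τ k * (r ^ 2 / 2) ^ (-((n : ℤ) - k)) *
          Real.Gamma ((n : ℝ) - k)) =O[atTop]
      fun n : ℕ => (r ^ 2 / 2) ^ (-(n : ℤ)) * Real.Gamma ((n : ℝ) - N) := by
  have hεabs : |ε| = 1 := abs_eq_one_of_sq_eq_one hε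
  obtain ⟨ψ, P, hc⟩ := hs.exists_chart h
  obtain ⟨δ, hδ, g, hg, hgu⟩ := hs.exists_continuation hε hr h hc
  have h1 := hX.eventually_eq hr hrR hδ hεabs hg
  obtain ⟨C, hC⟩ := exists_im_I_mul_sub_le hc.analyticAt_inv hc.im_inv N
  have hsqrt : Tendsto (fun u : ℝ => Real.sqrt (u ^ 2 - r ^ 2)) (𝓝[>] r) (𝓝 0) := by
    have := (by fun_prop : Continuous fun u : ℝ => Real.sqrt (u ^ 2 - r ^ 2)).tendsto r
    rw [sub_self, Real.sqrt_zero] at this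
    exact this.mono_left nhdsWithin_le_nhds
  have h2 : ∀ᶠ u in 𝓝[>] r, |(X ((ε * u : ℝ) : ℂ)).im - ∑ k ∈ Finset.range N,
      (-1) ^ k * PowerSeries.coeff (2 * k + 1) (maclaurin ψ) *
        Real.sqrt (u ^ 2 - r ^ 2) ^ (2 * k + 1)| ≤ C * Real.sqrt (u ^ 2 - r ^ 2) ^ (2 * N + 1) := by
    filter_upwards [h1, hsqrt.eventually hC, self_mem_nhdsWithin] with u h3 h4 h5
    rw [h3, hgu u h5, Complex.add_im, Complex.ofReal_im, zero_add]
    rwa [abs_of_nonneg (Real.sqrt_nonneg _)] at h4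
  filter_upwards [eventually_forall_Ioc_log hr h2, eventually_exp_lt hr hrR, self_mem_nhdsWithin]
    with b hb hbR hrb
  have hO := isBigO_integral_sub_sum_cutIntegral hr hrb
    (G := fun s => (X ((ε * Real.exp s : ℝ) : ℂ)).im)
    ((hX.continuousOn_im hεabs hbR).mono fun s hs => hs.2)
    (fun k => (-1) ^ k * PowerSeries.coeff (2 * k + 1) (maclaurin ψ)) N hb
  have hO' := (isBigO_refl (fun n : ℕ => 1 / Real.pi * ((2 * n + 1)‼ : ℝ)) atTop).mul hO
  -- The constant absorbs `1/π`, the value of the Laplace integral, and the factor `(r²/2)^N`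
  -- between `A^(-(n-N))` and `A^(-n)`.
  refine (hO'.congr' ?_ ?_).trans (isBigO_const_mul_self
    (1 / Real.pi * (1 / 2 * ((2 * N + 1)‼ : ℝ) * (r ^ 2 / 2) ^ N)) _ _)
  · filter_upwards [eventually_gt_atTop N] with n hn
    rw [mul_sub, Finset.mul_sum]
    congr 1
    refine Finset.sum_congr rfl fun k hk => ?_
    have := doubleFactorial_mul_cutIntegral hr k ((Finset.mem_range.1 hk).trans hn)
    rw [hs.saddleCoeff_eq h hc]
    linear_combination
      (1 / Real.pi * (-1) ^ k * PowerSeries.coeff (2 * k + 1) (maclaurin ψ)) * this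
  · filter_upwards [eventually_gt_atTop N] with n hn
    have := doubleFactorial_mul_cutIntegral hr N hn
    have h3 : (r ^ 2 / 2) ^ (-((n : ℤ) - N)) = (r ^ 2 / 2) ^ N * (r ^ 2 / 2) ^ (-(n : ℤ)) := by
      rw [← zpow_natCast (r ^ 2 / 2) N, ← zpow_add₀ (by positivity)]; congr 1; ring
    rw [h3] at this
    linear_combination (1 / Real.pi) * this

/-! ### Collecting the contributions -/

theorem IsSquareRootSingularity.exists_sign {S : ℂ → ℂ} {σ ρ : ℂ}
    (hs : IsSquareRootSingularity S σ ρ) (h : IsAction S)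
    (hcrit : ∀ z : ℂ, deriv S z = 0 → z.im = 0 ∧ iteratedDeriv 2 S z ≠ 0) {r : ℝ} (hr : 0 < r)
    (hrad : ENNReal.ofReal r = convergenceRadius (localSolution (maclaurin S))) :
    ∃ τ ε : ℝ, σ = τ ∧ (ε = 1 ∨ ε = -1) ∧ ρ = ((ε * r : ℝ) : ℂ) ∧ IsRealSaddle S τ (ε * r) := by
  obtain ⟨τ, v, hσ, hρ, hsad⟩ := hs.exists_isRealSaddle h hcrit
  have h1 : |v| = r := by
    have h2 := hsad.radius_eq
    rw [← hrad, ENNReal.ofReal_eq_ofReal_iff (abs_nonneg v) hr.le] at h2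
    exact h2
  rcases abs_eq hr.le |>.1 h1 with rfl | rfl
  · exact ⟨τ, 1, hσ, Or.inl rfl, by rw [one_mul, hρ], by rwa [one_mul]⟩
  · exact ⟨τ, -1, hσ, Or.inr rfl, by rw [neg_one_mul, hρ], by rwa [neg_one_mul]⟩

theorem exists_isUpperExtension_sol {S : ℂ → ℂ} (h : IsAction S)
    (hcrit : ∀ z : ℂ, deriv S z = 0 → z.im = 0 ∧ iteratedDeriv 2 S z ≠ 0) {r : ℝ} (hr : 0 < r)
    (hrad : ENNReal.ofReal r = convergenceRadius (localSolution (maclaurin S)))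
    (hdom : ∀ ρ : ℂ, IsDominantSingularity (localSolution (maclaurin S)) ρ →
      ∃ σ, IsSquareRootSingularity S σ ρ) :
    ∃ R > r, ∃ X, IsUpperExtension (sol S) r X (Metric.ball 0 R) := by
  have hD := solDisc_eq_ball hrad
  refine exists_isUpperExtension hr (fun y hy =>
    (h.analyticOnNhd_sol y (hD ▸ hy)).differentiableAt.differentiableWithinAt) fun ρ hρ _ => ?_
  by_cases hsing : IsDominantSingularity (localSolution (maclaurin S)) ρ
  · obtain ⟨σ, hs⟩ := hdom ρ hsing
    obtain ⟨τ, ε, -, hε, rfl, hsad⟩ := hs.exists_sign h hcrit hr hrad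
    obtain ⟨ψ, P, hc⟩ := hsad.exists_chart h
    have hε2 : ε ^ 2 = 1 := by rcases hε with rfl | rfl <;> norm_num
    obtain ⟨δ, hδ, g, hg, -⟩ := hsad.exists_continuation hε2 hr h hc
    exact ⟨δ, hδ, g, hg⟩
  · obtain ⟨δ, hδ, g, -, hg⟩ := exists_isUpperExtension_of_not_singular hD
      (not_not.1 fun hg => hsing ⟨by rw [hρ, hrad], hg⟩)
    exact ⟨δ, hδ, g, hg⟩

/-- There is a dominant singularity on the real line. -/
theorem exists_not_analytic_continuation {S X : ℂ → ℂ} (h : IsAction S) {r R : ℝ} (hr : 0 < r)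
    (hrR : r < R) (hrad : ENNReal.ofReal r = convergenceRadius (localSolution (maclaurin S)))
    (hX : IsUpperExtension (sol S) r X (Metric.ball 0 R)) :
    ∃ ρ : ℂ, IsDominantSingularity (localSolution (maclaurin S)) ρ := by
  by_contra! hno
  have hD := solDisc_eq_ball hrad
  have hreg : ∀ ε : ℝ, |ε| = 1 → ∃ g : ℂ → ℂ, AnalyticAt ℂ g ((ε * r : ℝ) : ℂ) ∧
      g =ᶠ[𝓝[solDisc S] ((ε * r : ℝ) : ℂ)] sol S := fun ε hε => by
    refine not_not.1 fun hg => hno ((ε * r : ℝ) : ℂ) ⟨?_, hg⟩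
    rw [Complex.norm_real, Real.norm_eq_abs, abs_mul, hε, one_mul, abs_of_pos hr, hrad]
  have h1 := hX.rayIntegral_eq_zero hr hrR abs_one hD (hreg 1 abs_one)
  have h2 := hX.rayIntegral_eq_zero hr hrR (ε := -1) (by simp) hD (hreg (-1) (by simp))
  have hgt : ∀ᶠ b in 𝓝[>] (Real.log r), Real.log r < b := self_mem_nhdsWithin
  obtain ⟨b, ⟨hb1, hb2⟩, hb, hrb⟩ := ((h1.and h2).and ((eventually_exp_lt hr hrR).and hgt)).exists
  obtain ⟨C, hC⟩ := h.exists_coeff_sub_rayIntegral_le hr hD hX hrb hb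
  -- With no ray contribution the coefficients are `O(e^(-mb))`, so the series would converge up to
  -- `e^b > r`.
  have hle : ENNReal.ofReal (Real.exp b) ≤ convergenceRadius (localSolution (maclaurin S)) := by
    refine FormalMultilinearSeries.le_radius_of_bound _ (C / Real.pi) fun m => ?_
    have h3 := hC m
    rw [hb1 m, hb2 m, mul_zero, sub_zero, sub_zero, abs_mul, abs_of_pos Real.pi_pos] at h3
    rw [complexSeries, FormalMultilinearSeries.ofScalars_norm, Complex.norm_real, Real.norm_eq_abs,
      Real.coe_toNNReal _ (Real.exp_pos b).le, ← Real.exp_nat_mul, le_div_iff₀ Real.pi_pos]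
    have h4 : Real.exp (-(m * b)) * Real.exp (m * b) = 1 := by rw [← Real.exp_add]; simp
    calc _ = Real.pi * |PowerSeries.coeff m (localSolution (maclaurin S))| * Real.exp (m * b) := by
          ring
      _ ≤ C * Real.exp (-(m * b)) * Real.exp (m * b) :=
          mul_le_mul_of_nonneg_right h3 (Real.exp_pos _).le
      _ = C := by rw [mul_assoc, h4, mul_one]
  rw [← hrad, ENNReal.ofReal_le_ofReal_iff hr.le] at hle
  exact absurd ((Real.log_lt_iff_lt_exp hr).1 hrb) (not_lt.2 hle)

/-- The asymptotic expansion, with the contributions of the two real points of the circle of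
convergence written as a sum over a finite set. -/
theorem IsAction.isBigO_coeff_formalIntegral {S X : ℂ → ℂ} (h : IsAction S) {r R : ℝ} (hr : 0 < r)
    (hrR : r < R) (hrad : ENNReal.ofReal r = convergenceRadius (localSolution (maclaurin S)))
    (hX : IsUpperExtension (sol S) r X (Metric.ball 0 R)) {I : Finset ℂ} {τ : ℂ → ℝ}
    (hI : I ⊆ {((1 * r : ℝ) : ℂ), ((-1 * r : ℝ) : ℂ)})
    (hsad : ∀ ε : ℝ, ((ε * r : ℝ) : ℂ) ∈ I → IsRealSaddle S (τ ((ε * r : ℝ) : ℂ)) (ε * r))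
    (hdom : ∀ ρ : ℂ, IsDominantSingularity (localSolution (maclaurin S)) ρ → ρ ∈ I) (N : ℕ) :
    (fun n : ℕ => PowerSeries.coeff n (formalIntegral (maclaurin S)) -
        ∑ k ∈ Finset.range N, ∑ ρ ∈ I,
          saddleCoeff S (τ ρ) k * (r ^ 2 / 2) ^ (-((n : ℤ) - k)) * Real.Gamma ((n : ℝ) - k))
      =O[atTop]
    (fun n : ℕ => (r ^ 2 / 2) ^ (-(n : ℤ)) * Real.Gamma ((n : ℝ) - N)) := by
  classical
  have hD := solDisc_eq_ball hrad
  set T : ℂ → ℕ → ℝ := fun ρ n => ∑ k ∈ Finset.range N,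
    saddleCoeff S (τ ρ) k * (r ^ 2 / 2) ^ (-((n : ℤ) - k)) * Real.Gamma ((n : ℝ) - k) with hT
  set e : ℕ → ℝ := fun n => (r ^ 2 / 2) ^ (-(n : ℤ)) * Real.Gamma ((n : ℝ) - N) with he
  have hray : ∀ ε : ℝ, ε = 1 ∨ ε = -1 → ∀ᶠ b in 𝓝[>] (Real.log r),
      (fun n : ℕ => 1 / Real.pi * ((2 * n + 1)‼ : ℝ) * rayIntegral X r b ε (2 * n + 1) -
        if ((ε * r : ℝ) : ℂ) ∈ I then T ((ε * r : ℝ) : ℂ) n else 0) =O[atTop] e := by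
    intro ε hε
    have hε2 : ε ^ 2 = 1 := by rcases hε with rfl | rfl <;> norm_num
    by_cases hmem : ((ε * r : ℝ) : ℂ) ∈ I
    · simp only [if_pos hmem]
      exact hX.isBigO_rayIntegral h hr hrR hε2 (hsad ε hmem) N
    · simp only [if_neg hmem]
      have hεabs := abs_eq_one_of_sq_eq_one hε2
      have hreg : ∃ g : ℂ → ℂ, AnalyticAt ℂ g ((ε * r : ℝ) : ℂ) ∧
          g =ᶠ[𝓝[solDisc S] ((ε * r : ℝ) : ℂ)] sol S := by
        refine not_not.1 fun hg => hmem (hdom _ ⟨?_, hg⟩)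
        rw [Complex.norm_real, Real.norm_eq_abs, abs_mul, hεabs, one_mul, abs_of_pos hr, hrad]
      filter_upwards [hX.rayIntegral_eq_zero hr hrR hεabs hD hreg] with b hb
      simp only [hb, mul_zero, sub_zero]
      exact isBigO_zero _ _
  have hgt : ∀ᶠ b in 𝓝[>] (Real.log r), Real.log r < b := self_mem_nhdsWithin
  obtain ⟨b, ⟨hb1, hb2⟩, hb, hrb⟩ := (((hray 1 (Or.inl rfl)).and (hray (-1) (Or.inr rfl))).and
    ((eventually_exp_lt hr hrR).and hgt)).exists
  obtain ⟨C, hC⟩ := h.exists_coeff_sub_rayIntegral_le hr hD hX hrb hb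
  have herr : (fun n : ℕ => ((2 * n + 1)‼ : ℝ) * (1 / Real.pi * (Real.pi *
      PowerSeries.coeff (2 * n + 1) (localSolution (maclaurin S)) -
      (rayIntegral X r b 1 (2 * n + 1) - (-1) ^ (2 * n + 1) * rayIntegral X r b (-1) (2 * n + 1)))))
      =O[atTop] e := by
    have h1 : (fun n : ℕ => Real.pi *
        PowerSeries.coeff (2 * n + 1) (localSolution (maclaurin S)) -
        (rayIntegral X r b 1 (2 * n + 1) - (-1) ^ (2 * n + 1) *
          rayIntegral X r b (-1) (2 * n + 1))) =O[atTop]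
        fun n : ℕ => Real.exp (-((2 * n + 1 : ℕ) * b)) :=
      IsBigO.of_bound C (Eventually.of_forall fun n => by
        rw [Real.norm_eq_abs, Real.norm_of_nonneg (Real.exp_pos _).le]
        exact hC (2 * n + 1))
    have h2 := (h1.trans (isBigO_exp_cutIntegral hr N hrb)).const_mul_left (1 / Real.pi)
    have h3 := (isBigO_refl (fun n : ℕ => ((2 * n + 1)‼ : ℝ)) atTop).mul h2
    refine h3.trans ((IsBigO.congr' (isBigO_const_mul_self
      (1 / 2 * ((2 * N + 1)‼ : ℝ) * (r ^ 2 / 2) ^ N) e atTop) ?_ EventuallyEq.rfl))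
    filter_upwards [eventually_gt_atTop N] with n hn
    have h4 : (r ^ 2 / 2) ^ (-((n : ℤ) - N)) = (r ^ 2 / 2) ^ N * (r ^ 2 / 2) ^ (-(n : ℤ)) := by
      rw [← zpow_natCast (r ^ 2 / 2) N, ← zpow_add₀ (by positivity)]; congr 1; ring
    rw [doubleFactorial_mul_cutIntegral hr N hn, h4]
    simp only [he]
    ring
  refine ((herr.add (hb1.add hb2))).congr_left fun n => ?_
  have hne : ((1 * r : ℝ) : ℂ) ≠ ((-1 * r : ℝ) : ℂ) := by
    rw [Ne, Complex.ofReal_inj]; intro h0; linarith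
  have hsum : ∑ k ∈ Finset.range N, ∑ ρ ∈ I,
      saddleCoeff S (τ ρ) k * (r ^ 2 / 2) ^ (-((n : ℤ) - k)) * Real.Gamma ((n : ℝ) - k) =
      (if ((1 * r : ℝ) : ℂ) ∈ I then T ((1 * r : ℝ) : ℂ) n else 0) +
        if ((-1 * r : ℝ) : ℂ) ∈ I then T ((-1 * r : ℝ) : ℂ) n else 0 := by
    rw [Finset.sum_comm, ← Finset.sum_pair (f := fun ρ => if ρ ∈ I then T ρ n else 0) hne,
      Finset.sum_ite_mem, Finset.inter_eq_right.2 hI]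
  -- Only odd `m = 2n + 1` occurs, so `-(-1)^m = 1` and the two rays add up.
  rw [h.coeff_formalIntegral_eq, hsum, pow_succ, pow_mul]
  have hpi := Real.pi_ne_zero
  field_simp
  ring

end

end FormalIntegral

/-! ### The main theorem -/

open FormalIntegral in
theorem mainTheorem2 (S : ℂ → ℂ) (hS : Differentiable ℂ S)
    (hreal : ∀ t : ℝ, (S t).im = 0)
    (h0 : S 0 = 0) (h1 : deriv S 0 = 0) (h2 : iteratedDeriv 2 S 0 = -1)
    (hcrit : ∀ z : ℂ, deriv S z = 0 → z.im = 0 ∧ iteratedDeriv 2 S z ≠ 0) :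
    ∃ (I : Finset ℂ) (τ : ℂ → ℝ) (A : ℝ),
      (∀ ρ : ℂ, ρ ∈ I ↔ ∃ σ : ℂ, IsSquareRootSingularity S σ ρ) ∧
      I.card ≤ 2 ∧
      0 < A ∧
      (∀ ρ ∈ I, IsSquareRootSingularity S (τ ρ) ρ ∧
        IsLocalMin (fun t : ℝ => (S t).re) (τ ρ) ∧
        S (τ ρ) = -A ∧
        PowerSeries.coeff 2 (saddleAction S (τ ρ)) < 0) ∧
      ((∀ ρ : ℂ, IsDominantSingularity (localSolution (maclaurin S)) ρ → ρ ∈ I) →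
        ∀ R : ℕ,
          (fun n : ℕ => PowerSeries.coeff n (formalIntegral (maclaurin S)) -
              ∑ k ∈ Finset.range R, ∑ ρ ∈ I,
                saddleCoeff S (τ ρ) k * A ^ (-((n : ℤ) - k)) * Real.Gamma ((n : ℝ) - k))
            =O[atTop]
          (fun n : ℕ => ∑ _ρ ∈ I, A ^ (-(n : ℤ)) * Real.Gamma ((n : ℝ) - R))) := by
  classical
  have h : IsAction S := ⟨hS, hreal, h0, h1, h2⟩
  -- With infinite radius the index set is empty and the error bound is `0`, so the claim is that
  -- the coefficients eventually vanish; the value `A = 1` is arbitrary.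
  by_cases htop : convergenceRadius (localSolution (maclaurin S)) = ⊤
  · have hno : ∀ ρ : ℂ, ¬ ∃ σ : ℂ, IsSquareRootSingularity S σ ρ := by
      rintro ρ ⟨σ, hs⟩
      exact ENNReal.ofReal_ne_top (hs.radius_eq.trans htop)
    refine ⟨∅, fun _ => 0, 1, fun ρ => by simpa using hno ρ, by simp, one_pos, by simp,
      fun _ R => ?_⟩
    simp only [Finset.sum_empty, Finset.sum_const_zero, sub_zero]
    refine EventuallyEq.isBigO ?_
    filter_upwards [eventually_ge_atTop 1] with n hn
    exact h.coeff_formalIntegral_of_radius_eq_top htop hn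
  obtain ⟨r, hr, hrad⟩ : ∃ r : ℝ, 0 < r ∧
      ENNReal.ofReal r = convergenceRadius (localSolution (maclaurin S)) :=
    ⟨_, ENNReal.toReal_pos h.radius_pos.ne' htop, ENNReal.ofReal_toReal htop⟩
  set I : Finset ℂ := ({((1 * r : ℝ) : ℂ), ((-1 * r : ℝ) : ℂ)} : Finset ℂ).filter
    fun ρ => ∃ σ : ℂ, IsSquareRootSingularity S σ ρ with hI
  have hmem : ∀ ρ : ℂ, ρ ∈ I ↔ ∃ σ : ℂ, IsSquareRootSingularity S σ ρ := by
    intro ρ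
    rw [hI, Finset.mem_filter, and_iff_right_iff_imp]
    rintro ⟨σ, hs⟩
    obtain ⟨τ, ε, -, rfl | rfl, rfl, -⟩ := hs.exists_sign h hcrit hr hrad <;> simp
  have hex : ∀ ρ : ℂ, ∃ τ : ℝ, ρ ∈ I → IsSquareRootSingularity S τ ρ ∧
      ∀ v : ℝ, ρ = v → IsRealSaddle S τ v := by
    intro ρ
    by_cases hρ : ρ ∈ I
    · obtain ⟨σ, hs⟩ := (hmem ρ).1 hρ
      obtain ⟨τ, v, rfl, rfl, hsad⟩ := hs.exists_isRealSaddle h hcrit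
      refine ⟨τ, fun _ => ⟨hs, fun v' hv => ?_⟩⟩
      rwa [← Complex.ofReal_inj.1 hv]
    · exact ⟨0, fun h => absurd h hρ⟩
  choose τ hτ using hex
  have hA : 0 < r ^ 2 / 2 := by positivity
  refine ⟨I, τ, r ^ 2 / 2, hmem, (Finset.card_filter_le _ _).trans Finset.card_le_two, hA,
    fun ρ hρ => ?_, fun hdom N => ?_⟩
  · obtain ⟨hs, hsad⟩ := hτ ρ hρ
    obtain ⟨-, ε, -, hε, rfl, -⟩ := hs.exists_sign h hcrit hr hrad
    have hsad := hsad _ rfl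
    refine ⟨hs, hsad.isLocalMin, ?_, ?_⟩
    · have hε2 : ε ^ 2 = 1 := by rcases hε with rfl | rfl <;> norm_num
      rw [hsad.map_eq, mul_pow, hε2, one_mul]
      push_cast
      ring
    · rw [saddleAction, coeff_maclaurin, hsad.iteratedDeriv_saddle, ← Complex.ofReal_neg,
        Complex.ofReal_re]
      exact div_neg_of_neg_of_pos (neg_neg_of_pos hsad.deriv2_pos) (by positivity)
  · obtain ⟨R, hrR, X, hX⟩ := exists_isUpperExtension_sol h hcrit hr hrad
      fun ρ hρ => (hmem ρ).1 (hdom ρ hρ)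
    -- The error term is a sum over `I`, so the bound requires at least one singularity.
    have hne : I.Nonempty := by
      obtain ⟨ρ, hρ⟩ := exists_not_analytic_continuation h hr hrR hrad hX
      exact ⟨ρ, hdom ρ hρ⟩
    have hO := h.isBigO_coeff_formalIntegral hr hrR hrad hX (Finset.filter_subset _ _)
      (fun ε hε => (hτ _ hε).2 _ rfl) hdom N
    refine hO.trans ?_
    simp only [Finset.sum_const, nsmul_eq_mul]
    have hcard : (I.card : ℝ) ≠ 0 := by exact_mod_cast hne.card_pos.ne'
    exact (isBigO_refl _ _).const_mul_right hcard
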